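/- Let $\mathbf\Sigma\in\mathbb R^{m\times n}$ have rank $d\ge1$ with singular values $\sigma_1\ge\dots\ge\sigma_d>0$, and let $f(\mathbf U,\mathbf V)=\frac12\|\mathbf U\mathbf V^\top-\mathbf\Sigma\|_F^2$ for $\mathbf U\in\mathbb R^{m\times d}$, $\mathbf V\in\mathbb R^{n\times d}$. Let the entries of $\mathbf U_0,\mathbf V_0$ be independent Gaussians with mean $0$ and variance $\varepsilon^2$, and let $(\mathbf U_t,\mathbf V_t)_{t\ge0}$ be the gradient flow $$\dot{\mathbf U}=(\mathbf\Sigma-\mathbf U\mathbf V^\top)\mathbf V,\qquad \dot{\mathbf V}=(\mathbf\Sigma-\mathbf U\mathbf V^\top)^\top\mathbf U$$ started at $(\mathbf U_0,\mathbf V_0)$. Write $\ln^+x=\max\{0,\ln x\}$. There are absolute constants $C>0$ and $q\in\mathbb N$ such that for every $p\in(0,1)$ there is $k>0$, depending only on $p$, with the following property. For all $m,n,d,\mathbf\Sigma$ as above, all $\varepsilon$ with $$0<\varepsilon\le \frac{k\,\sigma_d}{\sqrt{d^3\sigma_1}\,(m+n)}\Big(1+\ln\big((m+n)\tfrac{\sigma_1}{\sigma_d}\big)\Big)^{-q}$$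 and all $\delta>0$, there is a deterministic $T\ge0$ with $$T\le C\Big(\frac1{\sigma_d}\ln\frac{d\sigma_d}{\varepsilon^2}+\frac1{\sigma_d}\ln^+\frac{\sigma_d^2}{\delta}\Big),$$ and, whenever $\sigma_d\ge1$ or $\delta\le\sigma_d^2$, also $$T\le C\Big(\frac1{\sigma_d}\ln\frac{d\sigma_d}{\varepsilon}+\frac1{\sigma_d}\ln^+\frac{\sigma_d}{\delta}\Big),$$ such that with probability at least $1-p$ over the initialization, the flow exists for all times and $f(\mathbf U_t,\mathbf V_t)\le\delta$ for all $t\ge T$. -/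

import Mathlib

open MeasureTheory ProbabilityTheory

noncomputable section

namespace MatrixFactorization

/-- The `i`-th largest singular value `σ_i` of a real matrix, with `i = 1` the largest one
(Mathlib's sequence of singular values starts at index `0`). -/
def sigma {m n : ℕ} (S : Matrix (Fin m) (Fin n) ℝ) (i : ℕ) : ℝ :=
  (Matrix.toEuclideanLin S).singularValues (i - 1)

/-- The objective `f(U, V) = ½ ‖U Vᵀ - Σ‖_F²`. -/
def objective {m n d : ℕ} (S : Matrix (Fin m) (Fin n) ℝ)
    (U : Matrix (Fin m) (Fin d) ℝ) (V : Matrix (Fin n) (Fin d) ℝ) : ℝ :=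
  (1 / 2) * ∑ i, ∑ j, ((U * V.transpose - S) i j) ^ 2

/-- `(U, V)` is a gradient flow on `[0, ∞)` started at `(U₀, V₀)`:
`U' = (Σ - U Vᵀ) V` and `V' = (Σ - U Vᵀ)ᵀ U`, with derivatives taken entrywise
(one-sided at time `0`). -/
structure IsGradientFlow {m n d : ℕ} (S : Matrix (Fin m) (Fin n) ℝ)
    (U₀ : Matrix (Fin m) (Fin d) ℝ) (V₀ : Matrix (Fin n) (Fin d) ℝ)
    (U : ℝ → Matrix (Fin m) (Fin d) ℝ) (V : ℝ → Matrix (Fin n) (Fin d) ℝ) : Prop where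
  init_U : U 0 = U₀
  init_V : V 0 = V₀
  deriv_U : ∀ t : ℝ, 0 ≤ t → ∀ i k,
    HasDerivWithinAt (fun s => U s i k)
      (((S - U t * (V t).transpose) * V t) i k) (Set.Ici 0) t
  deriv_V : ∀ t : ℝ, 0 ≤ t → ∀ j k,
    HasDerivWithinAt (fun s => V s j k)
      (((S - U t * (V t).transpose).transpose * U t) j k) (Set.Ici 0) t

/-- Gradient flow started at `(U₀, V₀)` exists for all times, and `f ≤ δ` along it at
all times `t ≥ T`. -/
def ReachesBy {m n d : ℕ} (S : Matrix (Fin m) (Fin n) ℝ) (δ T : ℝ)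
    (U₀ : Matrix (Fin m) (Fin d) ℝ) (V₀ : Matrix (Fin n) (Fin d) ℝ) : Prop :=
  (∃ U V, IsGradientFlow S U₀ V₀ U V) ∧
    ∀ U V, IsGradientFlow S U₀ V₀ U V → ∀ t : ℝ, T ≤ t → objective S (U t) (V t) ≤ δ

/-- The law of the entries of an `m × d` matrix with independent Gaussian entries of mean `0`
and variance `ε²`. -/
def gaussianEntries (m d : ℕ) (ε : ℝ) : Measure (Fin m → Fin d → ℝ) :=
  Measure.pi fun _ => Measure.pi fun _ => gaussianReal 0 (Real.toNNReal (ε ^ 2))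

/-- The law of the initialization `(U₀, V₀)`: all entries of both matrices are independent
Gaussians of mean `0` and variance `ε²`. -/
def initLaw (m n d : ℕ) (ε : ℝ) : Measure ((Fin m → Fin d → ℝ) × (Fin n → Fin d → ℝ)) :=
  (gaussianEntries m d ε).prod (gaussianEntries n d ε)

end MatrixFactorization

end

/-!
In singular bases of `Σ` the two factors split into square blocks `U` and `V`, which have to
reproduce the diagonal matrix `D` of singular values, and blocks `J` and `K` in the complements of
the singular spaces, whose norms never increase. While the initialization is small,
`B = (U - V) / 2` stays of the order of its initial size and the residual `D - U Vᵀ` stays almost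
positive semidefinite, so that the least eigenvalue of `A Aᵀ` for `A = (U + V) / 2` follows a
logistic equation and reaches the order of `σ_d` after a time of order `log (σ_d / ε ^ 2) / σ_d`.
From then on both factors are well conditioned, the loss satisfies a Polyak–Łojasiewicz inequality
and decays exponentially; once it is small against `σ_d ^ 2`, the smallness of the loss and the
approximate conservation of `UᵀU - VᵀV` preserve the conditioning for all later times.

The initialization enters through its norm, bounded by Markov's inequality, and through the least
singular value of the square Gaussian matrix `U + V`, which is controlled by the norms of the
solutions of a linear system with this matrix and an independent Gaussian right-hand side.
-/

noncomputable section

namespace MatrixFactorization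

open Matrix Set Filter Topology

section FrobeniusInner

/-- The Frobenius inner product of two real matrices. Mathlib provides the Frobenius norm but not
the inner product. -/
def frobInner {ι κ : Type*} [Fintype ι] [Fintype κ] (A B : Matrix ι κ ℝ) : ℝ :=
  ∑ i, ∑ j, A i j * B i j

lemma dotProduct_self_nonneg {ι : Type*} [Fintype ι] (x : ι → ℝ) : 0 ≤ x ⬝ᵥ x := by
  simpa using dotProduct_self_star_nonneg x

lemma sq_dotProduct_le {ι : Type*} [Fintype ι] (x y : ι → ℝ) :
    (x ⬝ᵥ y) ^ 2 ≤ (x ⬝ᵥ x) * (y ⬝ᵥ y) := by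
  simpa only [dotProduct, sq] using Finset.sum_mul_sq_le_sq_mul_sq Finset.univ x y

lemma mul_apply_eq_transpose_mulVec {ι κ l : Type*} [Fintype κ] (A : Matrix ι κ ℝ)
    (B : Matrix κ l ℝ) (i : ι) : (A * B) i = Bᵀ *ᵥ A i := by
  rw [mulVec_transpose, mul_apply_eq_vecMul]

variable {ι κ l : Type*} [Fintype ι] [Fintype κ] [Fintype l]

lemma mulVec_dotProduct (A : Matrix ι κ ℝ) (x : κ → ℝ) (y : ι → ℝ) :
    (A *ᵥ x) ⬝ᵥ y = x ⬝ᵥ (Aᵀ *ᵥ y) := by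
  rw [mulVec_transpose, dotProduct_comm, dotProduct_mulVec, dotProduct_comm]

lemma frobInner_eq_trace (A B : Matrix ι κ ℝ) : frobInner A B = (A * Bᵀ).trace := by
  simp only [frobInner, trace, diag_apply, mul_apply, transpose_apply]

lemma frobInner_eq_sum_dotProduct (A B : Matrix ι κ ℝ) : frobInner A B = ∑ i, A i ⬝ᵥ B i := rfl

lemma frobInner_comm (A B : Matrix ι κ ℝ) : frobInner A B = frobInner B A := by
  simp only [frobInner, mul_comm]

lemma frobInner_add_left (A B C : Matrix ι κ ℝ) :
    frobInner (A + B) C = frobInner A C + frobInner B C := by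
  simp only [frobInner_eq_trace, Matrix.add_mul, trace_add]

lemma frobInner_sub_left (A B C : Matrix ι κ ℝ) :
    frobInner (A - B) C = frobInner A C - frobInner B C := by
  simp only [frobInner_eq_trace, Matrix.sub_mul, trace_sub]

lemma frobInner_neg_left (A B : Matrix ι κ ℝ) : frobInner (-A) B = -frobInner A B := by
  simp only [frobInner_eq_trace, Matrix.neg_mul, trace_neg]

lemma frobInner_smul_left (c : ℝ) (A B : Matrix ι κ ℝ) :
    frobInner (c • A) B = c * frobInner A B := by
  simp only [frobInner_eq_trace, Matrix.smul_mul, trace_smul, smul_eq_mul]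

lemma frobInner_add_right (A B C : Matrix ι κ ℝ) :
    frobInner A (B + C) = frobInner A B + frobInner A C := by
  simp only [frobInner_comm A, frobInner_add_left]

lemma frobInner_sub_right (A B C : Matrix ι κ ℝ) :
    frobInner A (B - C) = frobInner A B - frobInner A C := by
  simp only [frobInner_comm A, frobInner_sub_left]

lemma frobInner_neg_right (A B : Matrix ι κ ℝ) : frobInner A (-B) = -frobInner A B := by
  simp only [frobInner_comm A, frobInner_neg_left]

lemma frobInner_smul_right (c : ℝ) (A B : Matrix ι κ ℝ) :
    frobInner A (c • B) = c * frobInner A B := by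
  simp only [frobInner_comm A, frobInner_smul_left]

lemma frobInner_transpose (A B : Matrix ι κ ℝ) : frobInner Aᵀ Bᵀ = frobInner A B := by
  simp only [frobInner, transpose_apply]
  exact Finset.sum_comm

lemma frobInner_mul_left_eq_mul_transpose (A : Matrix ι κ ℝ) (B : Matrix κ l ℝ)
    (C : Matrix ι l ℝ) : frobInner (A * B) C = frobInner A (C * Bᵀ) := by
  simp only [frobInner_eq_trace, transpose_mul, transpose_transpose, Matrix.mul_assoc]

lemma frobInner_mul_left_eq_transpose_mul (A : Matrix ι κ ℝ) (B : Matrix κ l ℝ)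
    (C : Matrix ι l ℝ) : frobInner (A * B) C = frobInner B (Aᵀ * C) := by
  rw [← frobInner_transpose, transpose_mul, frobInner_mul_left_eq_mul_transpose,
    ← frobInner_transpose, transpose_mul, transpose_transpose, transpose_transpose,
    transpose_transpose]

lemma frobInner_self_nonneg (A : Matrix ι κ ℝ) : 0 ≤ frobInner A A :=
  Finset.sum_nonneg fun i _ => dotProduct_self_nonneg (A i)

lemma sq_frobInner_le (A B : Matrix ι κ ℝ) :
    frobInner A B ^ 2 ≤ frobInner A A * frobInner B B := by
  simpa only [frobInner, ← Fintype.sum_prod_type', sq] using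
    Finset.sum_mul_sq_le_sq_mul_sq (Finset.univ : Finset (ι × κ)) (fun p => A p.1 p.2)
      (fun p => B p.1 p.2)

lemma mulVec_dotProduct_self_le (A : Matrix ι κ ℝ) (x : κ → ℝ) :
    (A *ᵥ x) ⬝ᵥ (A *ᵥ x) ≤ frobInner A A * (x ⬝ᵥ x) := by
  rw [frobInner_eq_sum_dotProduct, Finset.sum_mul, dotProduct]
  refine Finset.sum_le_sum fun i _ => ?_
  rw [← sq]
  exact sq_dotProduct_le _ _

lemma frobInner_mul_self_le_of_forall {B : Matrix κ l ℝ} {c : ℝ}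
    (hB : ∀ x, (Bᵀ *ᵥ x) ⬝ᵥ (Bᵀ *ᵥ x) ≤ c * (x ⬝ᵥ x)) (A : Matrix ι κ ℝ) :
    frobInner (A * B) (A * B) ≤ c * frobInner A A := by
  simp only [frobInner_eq_sum_dotProduct, Finset.mul_sum, mul_apply_eq_transpose_mulVec]
  exact Finset.sum_le_sum fun i _ => hB _

lemma le_frobInner_mul_self_of_forall {B : Matrix κ l ℝ} {c : ℝ}
    (hB : ∀ x, c * (x ⬝ᵥ x) ≤ (Bᵀ *ᵥ x) ⬝ᵥ (Bᵀ *ᵥ x)) (A : Matrix ι κ ℝ) :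
    c * frobInner A A ≤ frobInner (A * B) (A * B) := by
  simp only [frobInner_eq_sum_dotProduct, Finset.mul_sum, mul_apply_eq_transpose_mulVec]
  exact Finset.sum_le_sum fun i _ => hB _

lemma frobInner_mul_self_le (A : Matrix ι κ ℝ) (B : Matrix κ l ℝ) :
    frobInner (A * B) (A * B) ≤ frobInner A A * frobInner B B := by
  rw [mul_comm, ← frobInner_transpose B B]
  exact frobInner_mul_self_le_of_forall (fun x => mulVec_dotProduct_self_le _ x) A

end FrobeniusInner

section QuadraticForms

variable {ι κ : Type*} [Fintype ι] [Fintype κ]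

lemma isCompact_dotProduct_self_le (c : ℝ) : IsCompact {x : ι → ℝ | x ⬝ᵥ x ≤ c} := by
  have hbdd : {x : ι → ℝ | x ⬝ᵥ x ≤ c} ⊆ Metric.closedBall 0 √c := by
    intro x (hx : x ⬝ᵥ x ≤ c)
    rw [mem_closedBall_zero_iff, pi_norm_le_iff_of_nonneg (Real.sqrt_nonneg c)]
    intro i
    have hi : x i * x i ≤ x ⬝ᵥ x :=
      Finset.single_le_sum (fun j _ => mul_self_nonneg (x j)) (Finset.mem_univ i)
    exact Real.abs_le_sqrt ((sq (x i)).trans_le (hi.trans hx))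
  exact Metric.isCompact_of_isClosed_isBounded
    (isClosed_le (by unfold dotProduct; fun_prop) continuous_const)
    (Metric.isBounded_closedBall.subset hbdd)

lemma isCompact_dotProduct_self_eq_one : IsCompact {x : ι → ℝ | x ⬝ᵥ x = 1} :=
  (isCompact_dotProduct_self_le 1).of_isClosed_subset
    (isClosed_eq (by unfold dotProduct; fun_prop) continuous_const) fun _ hx => le_of_eq hx

lemma inv_sqrt_smul_dotProduct_self {x : ι → ℝ} (hx : x ≠ 0) :
    ((√(x ⬝ᵥ x))⁻¹ • x) ⬝ᵥ ((√(x ⬝ᵥ x))⁻¹ • x) = 1 := by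
  rw [smul_dotProduct, dotProduct_smul, smul_eq_mul, smul_eq_mul, ← mul_assoc, ← mul_inv,
    Real.mul_self_sqrt (dotProduct_self_nonneg x), inv_mul_cancel₀]
  rwa [Ne, dotProduct_self_eq_zero]

lemma nonneg_of_forall_unit {q : (ι → ℝ) → ℝ} (hq : ∀ (c : ℝ) x, q (c • x) = c ^ 2 * q x)
    (hunit : ∀ x, x ⬝ᵥ x = 1 → 0 ≤ q x) (x : ι → ℝ) : 0 ≤ q x := by
  rcases eq_or_ne x 0 with rfl | hx
  · simpa using (hq 0 0).ge
  · have hpos : 0 < (√(x ⬝ᵥ x))⁻¹ := inv_pos.2 (Real.sqrt_pos.2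
      ((dotProduct_self_nonneg x).lt_of_ne' (mt dotProduct_self_eq_zero.1 hx)))
    have hunit_x := hunit _ (inv_sqrt_smul_dotProduct_self hx)
    rw [hq] at hunit_x
    exact nonneg_of_mul_nonneg_right hunit_x (pow_pos hpos 2)

lemma mulVec_eq_smul_of_rayleigh_eq {X : Matrix ι ι ℝ} (hX : Xᵀ = X) {c : ℝ}
    (hmin : ∀ w, c * (w ⬝ᵥ w) ≤ w ⬝ᵥ (X *ᵥ w)) {v : ι → ℝ} (hv : v ⬝ᵥ (X *ᵥ v) = c * (v ⬝ᵥ v)) :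
    X *ᵥ v = c • v := by
  classical
  have hquad : ∀ w, w ⬝ᵥ ((X - c • (1 : Matrix ι ι ℝ)) *ᵥ w)
      = w ⬝ᵥ (X *ᵥ w) - c * (w ⬝ᵥ w) := fun w => by
    rw [sub_mulVec, smul_mulVec, one_mulVec, dotProduct_sub, dotProduct_smul, smul_eq_mul]
  have hpos : (X - c • (1 : Matrix ι ι ℝ)).PosSemidef := by
    refine PosSemidef.of_dotProduct_mulVec_nonneg ?_ fun w => ?_
    · simp [IsHermitian, conjTranspose_eq_transpose_of_trivial, hX]
    · rw [star_trivial, hquad, sub_nonneg]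
      exact hmin w
  have hzero := (hpos.dotProduct_mulVec_zero_iff v).1 (by rw [star_trivial, hquad, hv, sub_self])
  rwa [sub_mulVec, smul_mulVec, one_mulVec, sub_eq_zero] at hzero

lemma mulVec_dotProduct_self_le_of_transpose {A : Matrix ι κ ℝ} {c : ℝ} (hc : 0 ≤ c)
    (hA : ∀ x, (Aᵀ *ᵥ x) ⬝ᵥ (Aᵀ *ᵥ x) ≤ c * (x ⬝ᵥ x)) (y : κ → ℝ) :
    (A *ᵥ y) ⬝ᵥ (A *ᵥ y) ≤ c * (y ⬝ᵥ y) := by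
  rcases (dotProduct_self_nonneg (A *ᵥ y)).eq_or_lt with h0 | hpos
  · rw [← h0]
    exact mul_nonneg hc (dotProduct_self_nonneg y)
  · refine le_of_mul_le_mul_right ?_ hpos
    calc (A *ᵥ y) ⬝ᵥ (A *ᵥ y) * ((A *ᵥ y) ⬝ᵥ (A *ᵥ y)) = (y ⬝ᵥ (Aᵀ *ᵥ (A *ᵥ y))) ^ 2 := by
          rw [← mulVec_dotProduct, sq]
      _ ≤ (y ⬝ᵥ y) * ((Aᵀ *ᵥ (A *ᵥ y)) ⬝ᵥ (Aᵀ *ᵥ (A *ᵥ y))) := sq_dotProduct_le _ _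
      _ ≤ (y ⬝ᵥ y) * (c * ((A *ᵥ y) ⬝ᵥ (A *ᵥ y))) :=
          mul_le_mul_of_nonneg_left (hA _) (dotProduct_self_nonneg y)
      _ = c * (y ⬝ᵥ y) * ((A *ᵥ y) ⬝ᵥ (A *ᵥ y)) := by ring

lemma le_mulVec_dotProduct_self_of_transpose {A : Matrix ι ι ℝ} {c : ℝ} (hc : 0 < c)
    (hA : ∀ x, c * (x ⬝ᵥ x) ≤ (Aᵀ *ᵥ x) ⬝ᵥ (Aᵀ *ᵥ x)) (y : ι → ℝ) :
    c * (y ⬝ᵥ y) ≤ (A *ᵥ y) ⬝ᵥ (A *ᵥ y) := by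
  classical
  have hinj : Function.Injective Aᵀ.mulVec := by
    refine (injective_iff_map_eq_zero Aᵀ.mulVecLin).2 fun x (hx : Aᵀ *ᵥ x = 0) => ?_
    have hle := hA x
    rw [hx, dotProduct_zero] at hle
    exact dotProduct_self_eq_zero.1 (by nlinarith [dotProduct_self_nonneg x])
  obtain ⟨x, rfl⟩ := mulVec_surjective_iff_isUnit.2 (mulVec_injective_iff_isUnit.1 hinj) y
  rcases (dotProduct_self_nonneg (Aᵀ *ᵥ x)).eq_or_lt with h0 | hpos
  · rw [← h0, mul_zero]
    exact dotProduct_self_nonneg _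
  · refine le_of_mul_le_mul_right ?_ hpos
    have hcs : ((Aᵀ *ᵥ x) ⬝ᵥ (Aᵀ *ᵥ x)) ^ 2
        ≤ (x ⬝ᵥ x) * ((A *ᵥ (Aᵀ *ᵥ x)) ⬝ᵥ (A *ᵥ (Aᵀ *ᵥ x))) := by
      simpa only [mulVec_dotProduct Aᵀ, transpose_transpose] using
        sq_dotProduct_le x (A *ᵥ (Aᵀ *ᵥ x))
    nlinarith [mul_le_mul_of_nonneg_right (hA x) (dotProduct_self_nonneg (A *ᵥ (Aᵀ *ᵥ x)))]

lemma le_frobInner_mul_of_forall {P : Matrix ι ι ℝ} {c : ℝ}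
    (hP : ∀ v, c * (v ⬝ᵥ v) ≤ v ⬝ᵥ (P *ᵥ v)) (B : Matrix ι κ ℝ) :
    c * frobInner B B ≤ frobInner B (P * B) := by
  rw [← frobInner_transpose B B, ← frobInner_transpose B (P * B), transpose_mul]
  simp only [frobInner_eq_sum_dotProduct, mul_apply_eq_transpose_mulVec, transpose_transpose,
    Finset.mul_sum]
  exact Finset.sum_le_sum fun i _ => hP _

lemma transpose_mulVec_dotProduct_self_le (B : Matrix ι κ ℝ) (v : ι → ℝ) :
    (Bᵀ *ᵥ v) ⬝ᵥ (Bᵀ *ᵥ v) ≤ frobInner B B * (v ⬝ᵥ v) := by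
  rw [← frobInner_transpose B B]
  exact mulVec_dotProduct_self_le _ _

lemma abs_dotProduct_le {x y : ι → ℝ} {c d : ℝ} (hc : 0 ≤ c) (hd : 0 ≤ d)
    (hx : x ⬝ᵥ x ≤ c ^ 2) (hy : y ⬝ᵥ y ≤ d ^ 2) : |x ⬝ᵥ y| ≤ c * d := by
  refine abs_le_of_sq_le_sq ((sq_dotProduct_le x y).trans ?_) (mul_nonneg hc hd)
  rw [mul_pow]
  exact mul_le_mul hx hy (dotProduct_self_nonneg y) (sq_nonneg c)

end QuadraticForms

section Derivatives

/-- `A'` is the entrywise derivative of the matrix-valued function `A` at `t` within `s`, the form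
in which `IsGradientFlow` prescribes derivatives. -/
def HasMatrixDerivWithinAt {ι κ : Type*} (A : ℝ → Matrix ι κ ℝ) (A' : Matrix ι κ ℝ) (s : Set ℝ)
    (t : ℝ) : Prop :=
  ∀ i j, HasDerivWithinAt (fun τ => A τ i j) (A' i j) s t

namespace HasMatrixDerivWithinAt

variable {ι κ l : Type*} {A B : ℝ → Matrix ι κ ℝ} {A' B' : Matrix ι κ ℝ} {s : Set ℝ} {t : ℝ}

lemma add (hA : HasMatrixDerivWithinAt A A' s t) (hB : HasMatrixDerivWithinAt B B' s t) :
    HasMatrixDerivWithinAt (fun τ => A τ + B τ) (A' + B') s t :=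
  fun i j => (hA i j).add (hB i j)

lemma sub (hA : HasMatrixDerivWithinAt A A' s t) (hB : HasMatrixDerivWithinAt B B' s t) :
    HasMatrixDerivWithinAt (fun τ => A τ - B τ) (A' - B') s t :=
  fun i j => (hA i j).sub (hB i j)

lemma const_smul (c : ℝ) (hA : HasMatrixDerivWithinAt A A' s t) :
    HasMatrixDerivWithinAt (fun τ => c • A τ) (c • A') s t :=
  fun i j => (hA i j).const_mul c

lemma const (C : Matrix ι κ ℝ) : HasMatrixDerivWithinAt (fun _ => C) 0 s t :=
  fun i j => hasDerivWithinAt_const t s (C i j)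

lemma transpose (hA : HasMatrixDerivWithinAt A A' s t) :
    HasMatrixDerivWithinAt (fun τ => (A τ)ᵀ) A'ᵀ s t :=
  fun i j => hA j i

lemma mul [Fintype κ] {C : ℝ → Matrix κ l ℝ} {C' : Matrix κ l ℝ}
    (hA : HasMatrixDerivWithinAt A A' s t) (hC : HasMatrixDerivWithinAt C C' s t) :
    HasMatrixDerivWithinAt (fun τ => A τ * C τ) (A' * C t + A t * C') s t := by
  intro i j
  simp only [Matrix.add_apply, mul_apply, ← Finset.sum_add_distrib]
  exact HasDerivWithinAt.fun_sum fun k _ => (hA i k).mul (hC k j)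

lemma const_mul [Fintype ι] (C : Matrix l ι ℝ) (hA : HasMatrixDerivWithinAt A A' s t) :
    HasMatrixDerivWithinAt (fun τ => C * A τ) (C * A') s t := by
  simpa only [Matrix.zero_mul, zero_add] using (const C).mul hA

protected lemma frobInner [Fintype ι] [Fintype κ] (hA : HasMatrixDerivWithinAt A A' s t)
    (hB : HasMatrixDerivWithinAt B B' s t) :
    HasDerivWithinAt (fun τ => frobInner (A τ) (B τ)) (frobInner A' (B t) + frobInner (A t) B')
      s t := by
  simp only [frobInner, ← Finset.sum_add_distrib]
  exact HasDerivWithinAt.fun_sum fun i _ => HasDerivWithinAt.fun_sum fun j _ =>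
    (hA i j).mul (hB i j)

lemma frobInner_self [Fintype ι] [Fintype κ] (hA : HasMatrixDerivWithinAt A A' s t) :
    HasDerivWithinAt (fun τ => frobInner (A τ) (A τ)) (2 * frobInner (A t) A') s t := by
  convert hA.frobInner hA using 1
  rw [frobInner_comm A', two_mul]

lemma mulVec_apply [Fintype κ] (hA : HasMatrixDerivWithinAt A A' s t) (x : κ → ℝ) (i : ι) :
    HasDerivWithinAt (fun τ => (A τ *ᵥ x) i) ((A' *ᵥ x) i) s t := by
  simp only [mulVec, dotProduct]
  exact HasDerivWithinAt.fun_sum fun j _ => (hA i j).mul_const _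

lemma mulVec_dotProduct_self [Fintype ι] [Fintype κ] (hA : HasMatrixDerivWithinAt A A' s t)
    (x : κ → ℝ) :
    HasDerivWithinAt (fun τ => (A τ *ᵥ x) ⬝ᵥ (A τ *ᵥ x)) (2 * ((A t *ᵥ x) ⬝ᵥ (A' *ᵥ x))) s t := by
  have hderiv : 2 * ((A t *ᵥ x) ⬝ᵥ (A' *ᵥ x))
      = ∑ i, ((A' *ᵥ x) i * (A t *ᵥ x) i + (A t *ᵥ x) i * (A' *ᵥ x) i) := by
    rw [Finset.sum_add_distrib, two_mul]
    exact congrArg₂ _ (dotProduct_comm _ _) rfl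
  rw [hderiv]
  exact HasDerivWithinAt.fun_sum fun i _ => (hA.mulVec_apply x i).mul (hA.mulVec_apply x i)

end HasMatrixDerivWithinAt

variable {ι κ : Type*} {A A' : ℝ → Matrix ι κ ℝ} {s : Set ℝ}

lemma continuousOn_apply_of_hasMatrixDerivWithinAt
    (hA : ∀ t ∈ s, HasMatrixDerivWithinAt A (A' t) s t) (i : ι) (j : κ) :
    ContinuousOn (fun τ => A τ i j) s :=
  fun t ht => (hA t ht i j).continuousWithinAt

lemma continuousOn_mulVec_dotProduct_self [Fintype ι] [Fintype κ]
    (hA : ∀ t ∈ s, HasMatrixDerivWithinAt A (A' t) s t) :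
    ContinuousOn (fun p : ℝ × (κ → ℝ) => (A p.1 *ᵥ p.2) ⬝ᵥ (A p.1 *ᵥ p.2)) (s ×ˢ univ) := by
  have hentry : ∀ i j, ContinuousOn (fun p : ℝ × (κ → ℝ) => A p.1 i j) (s ×ˢ univ) := fun i j =>
    (continuousOn_apply_of_hasMatrixDerivWithinAt hA i j).comp continuousOn_fst fun p hp => hp.1
  simp only [dotProduct, mulVec]
  have hrow : ∀ i, ContinuousOn (fun p : ℝ × (κ → ℝ) => ∑ j, A p.1 i j * p.2 j) (s ×ˢ univ) :=
    fun i => continuousOn_finsetSum _ fun j _ => (hentry i j).mul (by fun_prop)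
  exact continuousOn_finsetSum _ fun i _ => (hrow i).mul (hrow i)

lemma le_of_hasDerivWithinAt_nonpos {g g' : ℝ → ℝ} {a b : ℝ} (hab : a ≤ b)
    (hg : ∀ t ∈ Icc a b, HasDerivWithinAt g (g' t) (Icc a b) t)
    (hneg : ∀ t ∈ Icc a b, g' t ≤ 0) : g b ≤ g a :=
  antitoneOn_of_hasDerivWithinAt_nonpos (convex_Icc a b)
    (fun t ht => (hg t ht).continuousWithinAt)
    (fun t ht => (hg t (interior_subset ht)).mono interior_subset)
    (fun t ht => hneg t (interior_subset ht)) (left_mem_Icc.2 hab) (right_mem_Icc.2 hab) hab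

lemma le_mul_exp_of_hasDerivWithinAt_le {g g' : ℝ → ℝ} {a b c : ℝ} (hab : a ≤ b)
    (hg : ∀ t ∈ Icc a b, HasDerivWithinAt g (g' t) (Icc a b) t)
    (hle : ∀ t ∈ Icc a b, g' t ≤ -c * g t) : g b ≤ g a * Real.exp (-c * (b - a)) := by
  have hexp : ∀ t, HasDerivWithinAt (fun τ => Real.exp (c * (τ - a)))
      (Real.exp (c * (t - a)) * c) (Icc a b) t := fun t => by
    simpa using (((hasDerivAt_id t).sub_const a).const_mul c).exp.hasDerivWithinAt
  have hmono := le_of_hasDerivWithinAt_nonpos hab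
    (fun t ht => (hg t ht).mul (hexp t)) fun t ht => by
      nlinarith [hle t ht, Real.exp_pos (c * (t - a))]
  calc g b = g b * Real.exp (c * (b - a)) * Real.exp (-c * (b - a)) := by
        rw [mul_assoc, ← Real.exp_add]
        simp
    _ ≤ g a * Real.exp (-c * (b - a)) := by
        gcongr
        simpa using hmono

end Derivatives

section Barrier

variable {X θ : Type*} [TopologicalSpace X] {K : Set X} {a b : ℝ}

lemma exists_isLeast_nonpos [T2Space X] [Finite θ] (hK : IsCompact K) {φ : θ → ℝ → X → ℝ}
    (hcont : ∀ i, ContinuousOn (fun p : ℝ × X => φ i p.1 p.2) (Icc a b ×ˢ K))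
    (hne : ∃ t ∈ Icc a b, ∃ i, ∃ x ∈ K, φ i t x ≤ 0) :
    ∃ s, IsLeast {t ∈ Icc a b | ∃ i, ∃ x ∈ K, φ i t x ≤ 0} s := by
  have hbox : IsCompact (Icc a b ×ˢ K) := isCompact_Icc.prod hK
  have hcompact : IsCompact
      (⋃ i, Prod.fst '' ((Icc a b ×ˢ K) ∩ (fun p : ℝ × X => φ i p.1 p.2) ⁻¹' Iic 0)) :=
    isCompact_iUnion fun i => (hbox.of_isClosed_subset
      ((hcont i).preimage_isClosed_of_isClosed hbox.isClosed isClosed_Iic)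
      inter_subset_left).image continuous_fst
  have heq : {t ∈ Icc a b | ∃ i, ∃ x ∈ K, φ i t x ≤ 0}
      = ⋃ i, Prod.fst '' ((Icc a b ×ˢ K) ∩ (fun p : ℝ × X => φ i p.1 p.2) ⁻¹' Iic 0) := by
    ext t
    simp only [mem_ofPred_eq, mem_iUnion, mem_image, mem_inter_iff, mem_prod, mem_preimage, mem_Iic,
      Prod.exists, exists_and_right, exists_eq_right]
    tauto
  obtain ⟨t, ht⟩ := hne
  exact heq ▸ hcompact.exists_isLeast (heq ▸ ⟨t, ht⟩)

lemma nonpos_of_hasDerivWithinAt_of_forall_pos {g : ℝ → ℝ} {s D : ℝ} (has : a < s) (hs : g s = 0)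
    (hpos : ∀ t ∈ Ico a s, 0 < g t) (hg : HasDerivWithinAt g D (Icc a s) s) : D ≤ 0 := by
  have hnear : Ico a s ∈ 𝓝[<] s := Ico_mem_nhdsLT has
  have hslope : Tendsto (slope g s) (𝓝[<] s) (𝓝 D) := by
    refine ((hasDerivWithinAt_iff_tendsto_slope.1 hg)).mono_left (nhdsWithin_le_iff.2 ?_)
    filter_upwards [hnear] with t ht
    exact ⟨⟨ht.1, ht.2.le⟩, ht.2.ne⟩
  refine le_of_tendsto hslope ?_
  filter_upwards [hnear] with t ht
  rw [slope_def_field, hs]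
  exact div_nonpos_of_nonneg_of_nonpos (by linarith [hpos t ht]) (by linarith [ht.2])

-- At the first time at which some member vanishes, its time derivative would be nonpositive.
lemma forall_pos_of_barrier [T2Space X] [Finite θ] (hK : IsCompact K) {φ : θ → ℝ → X → ℝ}
    (hcont : ∀ i, ContinuousOn (fun p : ℝ × X => φ i p.1 p.2) (Icc a b ×ˢ K))
    (hinit : ∀ i, ∀ x ∈ K, 0 < φ i a x)
    (hstep : ∀ t ∈ Icc a b, (∀ i, ∀ x ∈ K, 0 ≤ φ i t x) → ∀ i, ∀ x ∈ K, φ i t x = 0 →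
      ∃ D, 0 < D ∧ HasDerivWithinAt (fun τ => φ i τ x) D (Icc a b) t) :
    ∀ t ∈ Icc a b, ∀ i, ∀ x ∈ K, 0 < φ i t x := by
  by_contra! hbad
  obtain ⟨s, ⟨hs, i, x, hx, hφ⟩, hmin⟩ := exists_isLeast_nonpos hK hcont hbad
  have has : a < s := lt_of_le_of_ne hs.1 fun h => (h ▸ hinit i x hx).not_ge hφ
  have hbefore : ∀ t ∈ Ico a s, ∀ j, ∀ y ∈ K, 0 < φ j t y := by
    intro t ht j y hy
    by_contra! h
    exact (hmin ⟨⟨ht.1, ht.2.le.trans hs.2⟩, j, y, hy, h⟩).not_gt ht.2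
  have hnonneg : ∀ j, ∀ y ∈ K, 0 ≤ φ j s y := by
    intro j y hy
    have hlim : ContinuousWithinAt (fun τ => φ j τ y) (Ico a s) s :=
      ContinuousWithinAt.comp (f := fun τ : ℝ => (τ, y)) (hcont j (s, y) ⟨hs, hy⟩) (by fun_prop)
        fun τ hτ => ⟨⟨hτ.1, hτ.2.le.trans hs.2⟩, hy⟩
    have : (𝓝[Ico a s] s).NeBot := right_nhdsWithin_Ico_neBot has
    exact ge_of_tendsto hlim
      (eventually_nhdsWithin_of_forall fun τ hτ => (hbefore τ hτ j y hy).le)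
  have hzero : φ i s x = 0 := le_antisymm hφ (hnonneg i x hx)
  obtain ⟨D, hD, hder⟩ := hstep s hs hnonneg i x hx hzero
  exact hD.not_ge (nonpos_of_hasDerivWithinAt_of_forall_pos has hzero
    (fun t ht => hbefore t ht i x hx) (hder.mono (Icc_subset_Icc_right hs.2)))

end Barrier

section Symmetrized

variable {ι μ ν : Type*} [Fintype ι] [Fintype μ] [Fintype ν]

/-- The symmetric part of the residual `D - U Vᵀ` for `U = A + B`, `V = A - B` and symmetric `D`. -/
def symPart (D A B : Matrix ι ι ℝ) : Matrix ι ι ℝ := D - A * Aᵀ + B * Bᵀ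

/-- The skew-symmetric part of the residual `D - U Vᵀ` for `U = A + B`, `V = A - B` and
symmetric `D`. -/
def skewPart (A B : Matrix ι ι ℝ) : Matrix ι ι ℝ := A * Bᵀ - B * Aᵀ

/-- The velocity of `A = (U + V) / 2` along the gradient flow, where `J` and `K` are the blocks of
the two factors which the matrix being factorized annihilates. -/
def velA (D A B : Matrix ι ι ℝ) (J : Matrix μ ι ℝ) (K : Matrix ν ι ℝ) : Matrix ι ι ℝ :=
  symPart D A B * A - skewPart A B * B
    - (1 / 2 : ℝ) • (A * (Kᵀ * K + Jᵀ * J) + B * (Kᵀ * K - Jᵀ * J))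

/-- The velocity of `B = (U - V) / 2` along the gradient flow, with `J` and `K` as for `velA`. -/
def velB (D A B : Matrix ι ι ℝ) (J : Matrix μ ι ℝ) (K : Matrix ν ι ℝ) : Matrix ι ι ℝ :=
  skewPart A B * A - symPart D A B * B
    - (1 / 2 : ℝ) • (A * (Kᵀ * K - Jᵀ * J) + B * (Kᵀ * K + Jᵀ * J))

lemma transpose_symPart {D : Matrix ι ι ℝ} (hD : Dᵀ = D) (A B : Matrix ι ι ℝ) :
    (symPart D A B)ᵀ = symPart D A B := by
  simp [symPart, hD]

lemma transpose_skewPart (A B : Matrix ι ι ℝ) : (skewPart A B)ᵀ = -skewPart A B := by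
  simp [skewPart]

lemma dotProduct_symPart_mulVec (D A B : Matrix ι ι ℝ) (v : ι → ℝ) :
    v ⬝ᵥ (symPart D A B *ᵥ v)
      = v ⬝ᵥ (D *ᵥ v) - (Aᵀ *ᵥ v) ⬝ᵥ (Aᵀ *ᵥ v) + (Bᵀ *ᵥ v) ⬝ᵥ (Bᵀ *ᵥ v) := by
  rw [mulVec_dotProduct Aᵀ, mulVec_dotProduct Bᵀ]
  simp [symPart, Matrix.add_mulVec, Matrix.sub_mulVec, dotProduct_add, dotProduct_sub]

lemma transpose_mulVec_dotProduct_velA {D : Matrix ι ι ℝ} (hD : Dᵀ = D) (A B : Matrix ι ι ℝ)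
    (J : Matrix μ ι ℝ) (K : Matrix ν ι ℝ) (v : ι → ℝ) {a b : ι → ℝ} (ha : Aᵀ *ᵥ v = a)
    (hb : Bᵀ *ᵥ v = b) :
    a ⬝ᵥ ((velA D A B J K)ᵀ *ᵥ v)
      = (A *ᵥ a) ⬝ᵥ (symPart D A B *ᵥ v) + (B *ᵥ a) ⬝ᵥ (A *ᵥ b) - (B *ᵥ a) ⬝ᵥ (B *ᵥ a)
        - (1 / 2) * ((K *ᵥ a) ⬝ᵥ (K *ᵥ a) + (J *ᵥ a) ⬝ᵥ (J *ᵥ a)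
          + (K *ᵥ a) ⬝ᵥ (K *ᵥ b) - (J *ᵥ a) ⬝ᵥ (J *ᵥ b)) := by
  have hvel : (velA D A B J K)ᵀ *ᵥ v
      = Aᵀ *ᵥ (symPart D A B *ᵥ v) + Bᵀ *ᵥ (A *ᵥ b) - Bᵀ *ᵥ (B *ᵥ a)
        - (1 / 2 : ℝ) • (Kᵀ *ᵥ (K *ᵥ a) + Jᵀ *ᵥ (J *ᵥ a) + Kᵀ *ᵥ (K *ᵥ b) - Jᵀ *ᵥ (J *ᵥ b)) := by
    rw [velA, transpose_sub, transpose_sub, transpose_mul, transpose_mul, transpose_symPart hD,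
      transpose_skewPart, ← ha, ← hb]
    simp only [skewPart, transpose_smul, transpose_add, transpose_sub, transpose_mul,
      transpose_transpose, sub_mulVec, add_mulVec, smul_mulVec, neg_mulVec, mulVec_mulVec,
      Matrix.mul_neg, Matrix.mul_sub, Matrix.add_mul, Matrix.mul_assoc]
    module
  rw [hvel]
  simp only [mulVec_dotProduct, dotProduct_add, dotProduct_sub, dotProduct_smul, smul_eq_mul]

lemma transpose_mulVec_dotProduct_velB {D : Matrix ι ι ℝ} (hD : Dᵀ = D) (A B : Matrix ι ι ℝ)
    (J : Matrix μ ι ℝ) (K : Matrix ν ι ℝ) (v : ι → ℝ) {a b : ι → ℝ} (ha : Aᵀ *ᵥ v = a)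
    (hb : Bᵀ *ᵥ v = b) :
    b ⬝ᵥ ((velB D A B J K)ᵀ *ᵥ v)
      = -((A *ᵥ b) ⬝ᵥ (A *ᵥ b)) + (A *ᵥ b) ⬝ᵥ (B *ᵥ a) - (B *ᵥ b) ⬝ᵥ (symPart D A B *ᵥ v)
        - (1 / 2) * ((K *ᵥ b) ⬝ᵥ (K *ᵥ a) - (J *ᵥ b) ⬝ᵥ (J *ᵥ a)
          + (K *ᵥ b) ⬝ᵥ (K *ᵥ b) + (J *ᵥ b) ⬝ᵥ (J *ᵥ b)) := by
  have hvel : (velB D A B J K)ᵀ *ᵥ v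
      = -(Aᵀ *ᵥ (A *ᵥ b)) + Aᵀ *ᵥ (B *ᵥ a) - Bᵀ *ᵥ (symPart D A B *ᵥ v)
        - (1 / 2 : ℝ) • (Kᵀ *ᵥ (K *ᵥ a) - Jᵀ *ᵥ (J *ᵥ a) + Kᵀ *ᵥ (K *ᵥ b) + Jᵀ *ᵥ (J *ᵥ b)) := by
    rw [velB, transpose_sub, transpose_sub, transpose_mul, transpose_mul, transpose_symPart hD,
      transpose_skewPart, ← ha, ← hb]
    simp only [skewPart, transpose_smul, transpose_add, transpose_sub, transpose_mul,
      transpose_transpose, sub_mulVec, add_mulVec, smul_mulVec, neg_mulVec, mulVec_mulVec,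
      Matrix.mul_neg, Matrix.mul_sub, Matrix.add_mul, Matrix.mul_assoc]
    module
  rw [hvel]
  simp only [mulVec_dotProduct, dotProduct_add, dotProduct_sub, dotProduct_smul, smul_eq_mul,
    dotProduct_neg]

-- With `W = B Aᵀ` the left-hand side is `⟨W, Wᵀ⟩ - ⟨W, W⟩`.
lemma frobInner_skewPart_mul_nonpos (A B : Matrix ι ι ℝ) :
    frobInner B (skewPart A B * A) ≤ 0 := by
  set W := B * Aᵀ with hW
  have hpair : frobInner B (skewPart A B * A) = frobInner W Wᵀ - frobInner W W := by
    rw [hW, frobInner_mul_left_eq_mul_transpose, frobInner_mul_left_eq_mul_transpose, skewPart,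
      ← frobInner_sub_right]
    simp [Matrix.sub_mul, Matrix.mul_assoc]
  have hcs : frobInner W Wᵀ ^ 2 ≤ frobInner W W ^ 2 := by
    have h := sq_frobInner_le W Wᵀ
    rwa [frobInner_transpose, ← sq] at h
  rw [hpair, sub_nonpos]
  exact le_of_abs_le (abs_le_of_sq_le_sq hcs (frobInner_self_nonneg W))

lemma abs_frobInner_mul_gram_le {A B : Matrix ι ι ℝ} (K : Matrix ν ι ℝ) {α β : ℝ} (hα : 0 ≤ α)
    (hβ : 0 ≤ β) (hA : ∀ x, (A *ᵥ x) ⬝ᵥ (A *ᵥ x) ≤ α ^ 2 * (x ⬝ᵥ x))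
    (hB : frobInner B B ≤ β ^ 2) :
    |frobInner B (A * (Kᵀ * K))| ≤ α * β * frobInner K K := by
  have hK := frobInner_self_nonneg K
  have hmove : frobInner B (A * (Kᵀ * K)) = frobInner (B * Kᵀ) (A * Kᵀ) := by
    rw [frobInner_mul_left_eq_mul_transpose, transpose_transpose, Matrix.mul_assoc]
  have hAK : frobInner (A * Kᵀ) (A * Kᵀ) ≤ α ^ 2 * frobInner K K := by
    rw [← frobInner_transpose, transpose_mul, transpose_transpose]
    exact frobInner_mul_self_le_of_forall (by simpa using hA) K
  have hBK : frobInner (B * Kᵀ) (B * Kᵀ) ≤ β ^ 2 * frobInner K K := by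
    have h := frobInner_mul_self_le B Kᵀ
    rw [frobInner_transpose] at h
    exact h.trans (by gcongr)
  rw [hmove]
  refine abs_le_of_sq_le_sq ((sq_frobInner_le (B * Kᵀ) (A * Kᵀ)).trans ?_) (by positivity)
  calc _ ≤ (β ^ 2 * frobInner K K) * (α ^ 2 * frobInner K K) :=
        mul_le_mul hBK hAK (frobInner_self_nonneg _) (by positivity)
    _ = _ := by ring

end Symmetrized

section Growth

variable {ι μ ν : Type*} [Fintype ι] [Fintype μ] [Fintype ν]
  {D : Matrix ι ι ℝ} {lam r N : ℝ}

/-- The scales of the growth phase: `lam` and `r ^ 2` bound the spectrum of the matrix to be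
factorized and `N` bounds the Frobenius norm of the initialization. -/
structure ScaleSeparation (lam r N : ℝ) : Prop where
  r_pos : 0 < r
  N_pos : 0 < N
  lam_le : lam ≤ r ^ 2
  mul_le : 200 * (r * N) ≤ lam

namespace ScaleSeparation

lemma lam_pos (h : ScaleSeparation lam r N) : 0 < lam :=
  lt_of_lt_of_le (by have := h.r_pos; have := h.N_pos; positivity) h.mul_le

lemma N_le (h : ScaleSeparation lam r N) : 200 * N ≤ r :=
  le_of_mul_le_mul_left (by linarith [h.mul_le, h.lam_le]) h.r_pos

lemma sq_N_le (h : ScaleSeparation lam r N) : N ^ 2 ≤ lam / 1000 := by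
  have := mul_le_mul_of_nonneg_right h.N_le h.N_pos.le
  linarith [h.mul_le, sq_nonneg N]

end ScaleSeparation

lemma forall_le_of_forall_unit {X : Matrix ι ι ℝ} {c : ℝ}
    (h : ∀ v, v ⬝ᵥ v = 1 → 0 ≤ v ⬝ᵥ (X *ᵥ v) - c * (v ⬝ᵥ v)) (v : ι → ℝ) :
    c * (v ⬝ᵥ v) ≤ v ⬝ᵥ (X *ᵥ v) := by
  refine sub_nonneg.1 (nonneg_of_forall_unit (q := fun v => v ⬝ᵥ (X *ᵥ v) - c * (v ⬝ᵥ v))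
    (fun c x => ?_) h v)
  simp only [mulVec_smul, smul_dotProduct, dotProduct_smul, smul_eq_mul]
  ring

lemma transpose_mulVec_dotProduct_self_le_of_symPart (hs : ScaleSeparation lam r N)
    (hup : ∀ v, v ⬝ᵥ (D *ᵥ v) ≤ r ^ 2 * (v ⬝ᵥ v)) {A B : Matrix ι ι ℝ}
    (hB : frobInner B B ≤ (2 * N) ^ 2)
    (hP : ∀ v, -(r * N / 10) * (v ⬝ᵥ v) ≤ v ⬝ᵥ (symPart D A B *ᵥ v)) (v : ι → ℝ) :
    (Aᵀ *ᵥ v) ⬝ᵥ (Aᵀ *ᵥ v) ≤ (2 * r) ^ 2 * (v ⬝ᵥ v) := by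
  have hv := dotProduct_self_nonneg v
  have hPv := hP v
  rw [dotProduct_symPart_mulVec] at hPv
  have hBv : (Bᵀ *ᵥ v) ⬝ᵥ (Bᵀ *ᵥ v) ≤ (2 * N) ^ 2 * (v ⬝ᵥ v) :=
    (transpose_mulVec_dotProduct_self_le B v).trans (by gcongr)
  have hscale : (r * N / 10 + r ^ 2 + (2 * N) ^ 2) * (v ⬝ᵥ v) ≤ (2 * r) ^ 2 * (v ⬝ᵥ v) := by
    refine mul_le_mul_of_nonneg_right ?_ hv
    nlinarith [hs.r_pos, hs.N_pos, hs.N_le]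
  linarith [hup v]

lemma sub_mul_le_dotProduct_symPart_mulVec (hlo : ∀ v, lam * (v ⬝ᵥ v) ≤ v ⬝ᵥ (D *ᵥ v))
    (A B : Matrix ι ι ℝ) (v : ι → ℝ) :
    (lam - frobInner A A) * (v ⬝ᵥ v) ≤ v ⬝ᵥ (symPart D A B *ᵥ v) := by
  rw [dotProduct_symPart_mulVec]
  linarith [hlo v, transpose_mulVec_dotProduct_self_le A v, dotProduct_self_nonneg (Bᵀ *ᵥ v)]

lemma two_mul_frobInner_velB_le (hr : 0 ≤ r) (hN : 0 ≤ N) {A B : Matrix ι ι ℝ}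
    {J : Matrix μ ι ℝ} {K : Matrix ν ι ℝ}
    (hA : ∀ x, (A *ᵥ x) ⬝ᵥ (A *ᵥ x) ≤ (2 * r) ^ 2 * (x ⬝ᵥ x))
    (hB : frobInner B B ≤ (2 * N) ^ 2) (hJK : frobInner J J + frobInner K K ≤ N ^ 2)
    (hP : ∀ v, -(r * N / 10) * (v ⬝ᵥ v) ≤ v ⬝ᵥ (symPart D A B *ᵥ v)) :
    2 * frobInner B (velB D A B J K) ≤ 5 * (r * N) * N ^ 2 := by
  have hexpand : frobInner B (velB D A B J K)
      = frobInner B (skewPart A B * A) - frobInner B (symPart D A B * B)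
        - 1 / 2 * (frobInner B (A * (Kᵀ * K)) - frobInner B (A * (Jᵀ * J))
          + (frobInner (B * Kᵀ) (B * Kᵀ) + frobInner (B * Jᵀ) (B * Jᵀ))) := by
    simp only [velB, frobInner_sub_right, frobInner_add_right, frobInner_smul_right,
      Matrix.mul_add, Matrix.mul_sub, frobInner_mul_left_eq_mul_transpose, transpose_transpose,
      Matrix.mul_assoc]
  have hmixK := abs_le.1 (abs_frobInner_mul_gram_le K (by positivity) (by positivity) hA hB)
  have hmixJ := abs_le.1 (abs_frobInner_mul_gram_le J (by positivity) (by positivity) hA hB)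
  have hmix : 2 * r * (2 * N) * frobInner K K + 2 * r * (2 * N) * frobInner J J
      ≤ 4 * r * N * N ^ 2 := by
    have := mul_le_mul_of_nonneg_left hJK (by positivity : 0 ≤ 4 * r * N)
    linarith
  have hsym : -(r * N / 10) * (2 * N) ^ 2 ≤ frobInner B (symPart D A B * B) := by
    have : r * N / 10 * frobInner B B ≤ r * N / 10 * (2 * N) ^ 2 := by gcongr
    linarith [le_frobInner_mul_of_forall hP B]
  rw [hexpand]
  linarith [frobInner_skewPart_mul_nonpos A B, frobInner_self_nonneg (B * Kᵀ),
    frobInner_self_nonneg (B * Jᵀ), hmixK.1, hmixJ.2]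

lemma deriv_symPart_eq_of_mulVec_eq_smul (hD : Dᵀ = D) {A B : Matrix ι ι ℝ} (J : Matrix μ ι ℝ)
    (K : Matrix ν ι ℝ) {v a b : ι → ℝ} {c : ℝ} (ha : Aᵀ *ᵥ v = a) (hb : Bᵀ *ᵥ v = b)
    (hv : symPart D A B *ᵥ v = c • v) :
    -(2 * (a ⬝ᵥ ((velA D A B J K)ᵀ *ᵥ v))) + 2 * (b ⬝ᵥ ((velB D A B J K)ᵀ *ᵥ v))
      = -(2 * c * (a ⬝ᵥ a + b ⬝ᵥ b)) + 2 * ((B *ᵥ a) ⬝ᵥ (B *ᵥ a))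
        - 2 * ((A *ᵥ b) ⬝ᵥ (A *ᵥ b)) + ((K *ᵥ a) ⬝ᵥ (K *ᵥ a) + (J *ᵥ a) ⬝ᵥ (J *ᵥ a))
        - ((K *ᵥ b) ⬝ᵥ (K *ᵥ b) + (J *ᵥ b) ⬝ᵥ (J *ᵥ b)) := by
  rw [transpose_mulVec_dotProduct_velA hD A B J K v ha hb,
    transpose_mulVec_dotProduct_velB hD A B J K v ha hb, hv]
  simp only [dotProduct_smul, smul_eq_mul]
  rw [mulVec_dotProduct A a v, ha, mulVec_dotProduct B b v, hb,
    dotProduct_comm (K *ᵥ b) (K *ᵥ a), dotProduct_comm (J *ᵥ b) (J *ᵥ a),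
    dotProduct_comm (B *ᵥ a) (A *ᵥ b)]
  ring

lemma deriv_symPart_pos (hs : ScaleSeparation lam r N) (hD : Dᵀ = D)
    (hlo : ∀ v, lam * (v ⬝ᵥ v) ≤ v ⬝ᵥ (D *ᵥ v)) {A B : Matrix ι ι ℝ} {J : Matrix μ ι ℝ}
    {K : Matrix ν ι ℝ} (hA : ∀ x, (A *ᵥ x) ⬝ᵥ (A *ᵥ x) ≤ (2 * r) ^ 2 * (x ⬝ᵥ x))
    (hB : frobInner B B ≤ (2 * N) ^ 2) (hJK : frobInner J J + frobInner K K ≤ N ^ 2)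
    (hP : ∀ v, -(r * N / 10) * (v ⬝ᵥ v) ≤ v ⬝ᵥ (symPart D A B *ᵥ v)) {v : ι → ℝ}
    (hv : v ⬝ᵥ v = 1) (hmin : v ⬝ᵥ (symPart D A B *ᵥ v) = -(r * N / 10) * (v ⬝ᵥ v)) :
    0 < -(2 * ((Aᵀ *ᵥ v) ⬝ᵥ ((velA D A B J K)ᵀ *ᵥ v)))
        + 2 * ((Bᵀ *ᵥ v) ⬝ᵥ ((velB D A B J K)ᵀ *ᵥ v)) := by
  have hr := hs.r_pos
  have hN := hs.N_pos
  have heig := mulVec_eq_smul_of_rayleigh_eq (transpose_symPart hD A B) hP hmin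
  rw [deriv_symPart_eq_of_mulVec_eq_smul hD J K rfl rfl heig]
  rw [dotProduct_symPart_mulVec, hv] at hmin
  set a := Aᵀ *ᵥ v
  set b := Bᵀ *ᵥ v with hb
  have hbb := dotProduct_self_nonneg b
  have hbN : b ⬝ᵥ b ≤ (2 * N) ^ 2 := by
    have := transpose_mulVec_dotProduct_self_le B v
    rw [hv, ← hb] at this
    linarith
  have haa : lam ≤ a ⬝ᵥ a := by
    have hrN : 0 < r * N := by positivity
    have := hlo v
    rw [hv] at this
    linarith
  have hgain : 40 * (r * N) ^ 2 ≤ 2 * (r * N / 10) * (a ⬝ᵥ a) := by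
    have := mul_le_mul_of_nonneg_left (hs.mul_le.trans haa) (by positivity : 0 ≤ r * N / 5)
    linarith
  have hAb : (A *ᵥ b) ⬝ᵥ (A *ᵥ b) ≤ 16 * (r * N) ^ 2 := by
    have := mul_le_mul_of_nonneg_left hbN (sq_nonneg (2 * r))
    linarith [hA b]
  have hJKb : (K *ᵥ b) ⬝ᵥ (K *ᵥ b) + (J *ᵥ b) ⬝ᵥ (J *ᵥ b) ≤ 4 * (r * N) ^ 2 := by
    have h4 : N ^ 2 * (2 * N) ^ 2 ≤ 4 * (r * N) ^ 2 := by
      have : N ^ 2 ≤ r ^ 2 := by gcongr; linarith [hs.N_le]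
      have := mul_le_mul_of_nonneg_right this (sq_nonneg (2 * N))
      linarith
    have := mul_le_mul hJK hbN hbb (sq_nonneg N)
    linarith [mulVec_dotProduct_self_le J b, mulVec_dotProduct_self_le K b]
  have hpos : 0 < (r * N) ^ 2 := by positivity
  have hbgain : 0 ≤ 2 * (r * N / 10) * (b ⬝ᵥ b) := by positivity
  linarith [dotProduct_self_nonneg (B *ᵥ a), dotProduct_self_nonneg (K *ᵥ a),
    dotProduct_self_nonneg (J *ᵥ a)]

lemma small_bounds_of_barrier_nonneg (hs : ScaleSeparation lam r N)
    (hup : ∀ v, v ⬝ᵥ (D *ᵥ v) ≤ r ^ 2 * (v ⬝ᵥ v)) {t T : ℝ} (hT : 0 < T)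
    (ht : t ≤ T) {A B : Matrix ι ι ℝ} (hB : 0 ≤ N ^ 2 * (2 + 2 / T * t) - frobInner B B)
    (hP : ∀ v, v ⬝ᵥ v = 1 →
      0 ≤ v ⬝ᵥ (symPart D A B *ᵥ v) - -(r * N / 10) * (v ⬝ᵥ v)) :
    frobInner B B ≤ (2 * N) ^ 2 ∧
      (∀ v, -(r * N / 10) * (v ⬝ᵥ v) ≤ v ⬝ᵥ (symPart D A B *ᵥ v)) ∧
      ∀ x, (A *ᵥ x) ⬝ᵥ (A *ᵥ x) ≤ (2 * r) ^ 2 * (x ⬝ᵥ x) := by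
  have hB' : frobInner B B ≤ (2 * N) ^ 2 := by
    have hle : 2 / T * t ≤ 2 := by
      rw [div_mul_eq_mul_div, div_le_iff₀ hT]
      linarith
    linarith [mul_le_mul_of_nonneg_left hle (sq_nonneg N)]
  have hPall := forall_le_of_forall_unit hP
  exact ⟨hB', hPall, mulVec_dotProduct_self_le_of_transpose (by positivity)
    (transpose_mulVec_dotProduct_self_le_of_symPart hs hup hB' hPall)⟩

/-- The gradient flow on the symmetrized variables `A = (U + V) / 2` and `B = (U - V) / 2`, with
remaining blocks `J` and `K` of squared Frobenius norm at most `N ^ 2` in total. -/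
structure IsSymmetrizedFlow (D : Matrix ι ι ℝ) (N : ℝ) (A B : ℝ → Matrix ι ι ℝ)
    (J : ℝ → Matrix μ ι ℝ) (K : ℝ → Matrix ν ι ℝ) : Prop where
  deriv_A : ∀ t ∈ Ici (0 : ℝ),
    HasMatrixDerivWithinAt A (velA D (A t) (B t) (J t) (K t)) (Ici 0) t
  deriv_B : ∀ t ∈ Ici (0 : ℝ),
    HasMatrixDerivWithinAt B (velB D (A t) (B t) (J t) (K t)) (Ici 0) t
  rest_le : ∀ t ∈ Ici (0 : ℝ), frobInner (J t) (J t) + frobInner (K t) (K t) ≤ N ^ 2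

lemma continuousOn_quadraticForm (D : Matrix ι ι ℝ) {s : Set (ℝ × (ι → ℝ))} :
    ContinuousOn (fun p => p.2 ⬝ᵥ (D *ᵥ p.2)) s := by
  simp only [dotProduct, mulVec]
  fun_prop

lemma continuousOn_dotProduct_self {s : Set (ℝ × (ι → ℝ))} :
    ContinuousOn (fun p => p.2 ⬝ᵥ p.2) s := by
  simp only [dotProduct]
  fun_prop

namespace IsSymmetrizedFlow

variable {A B : ℝ → Matrix ι ι ℝ} {J : ℝ → Matrix μ ι ℝ} {K : ℝ → Matrix ν ι ℝ} {T : ℝ}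

lemma continuousOn_symPart (hf : IsSymmetrizedFlow D N A B J K) :
    ContinuousOn (fun p : ℝ × (ι → ℝ) => p.2 ⬝ᵥ (symPart D (A p.1) (B p.1) *ᵥ p.2))
      (Ici 0 ×ˢ univ) := by
  simp only [dotProduct_symPart_mulVec]
  have hA := continuousOn_mulVec_dotProduct_self fun t ht => (hf.deriv_A t ht).transpose
  have hB := continuousOn_mulVec_dotProduct_self fun t ht => (hf.deriv_B t ht).transpose
  exact ((continuousOn_quadraticForm D).sub hA).add hB

lemma hasDerivWithinAt_symPart (hf : IsSymmetrizedFlow D N A B J K) {t : ℝ} (ht : 0 ≤ t)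
    (v : ι → ℝ) :
    HasDerivWithinAt (fun t => v ⬝ᵥ (symPart D (A t) (B t) *ᵥ v))
      (-(2 * (((A t)ᵀ *ᵥ v) ⬝ᵥ ((velA D (A t) (B t) (J t) (K t))ᵀ *ᵥ v)))
        + 2 * (((B t)ᵀ *ᵥ v) ⬝ᵥ ((velB D (A t) (B t) (J t) (K t))ᵀ *ᵥ v))) (Ici 0) t := by
  simp only [dotProduct_symPart_mulVec]
  exact (((hf.deriv_A t ht).transpose.mulVec_dotProduct_self v).const_sub _).add
    ((hf.deriv_B t ht).transpose.mulVec_dotProduct_self v)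

lemma hasDerivWithinAt_barrier (hf : IsSymmetrizedFlow D N A B J K) (T : ℝ) {t : ℝ} (ht : 0 ≤ t) :
    HasDerivWithinAt (fun t => N ^ 2 * (2 + 2 / T * t) - frobInner (B t) (B t))
      (N ^ 2 * (2 / T) - 2 * frobInner (B t) (velB D (A t) (B t) (J t) (K t))) (Ici 0) t := by
  have hlin : HasDerivAt (fun t => N ^ 2 * (2 + 2 / T * t)) (N ^ 2 * (2 / T)) t := by
    simpa using (((hasDerivAt_id t).const_mul (2 / T)).const_add 2).const_mul (N ^ 2)
  exact hlin.hasDerivWithinAt.sub (hf.deriv_B t ht).frobInner_self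

lemma small_bounds [Nonempty ι] (hf : IsSymmetrizedFlow D N A B J K)
    (hs : ScaleSeparation lam r N) (hD : Dᵀ = D) (hlo : ∀ v, lam * (v ⬝ᵥ v) ≤ v ⬝ᵥ (D *ᵥ v))
    (hup : ∀ v, v ⬝ᵥ (D *ᵥ v) ≤ r ^ 2 * (v ⬝ᵥ v)) (hT : 0 < T) (hNT : r * N * T ≤ 1 / 5)
    (hA₀ : frobInner (A 0) (A 0) ≤ N ^ 2) (hB₀ : frobInner (B 0) (B 0) ≤ N ^ 2) :
    ∀ t ∈ Icc 0 T, frobInner (B t) (B t) ≤ (2 * N) ^ 2 ∧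
      ∀ x, (A t *ᵥ x) ⬝ᵥ (A t *ᵥ x) ≤ (2 * r) ^ 2 * (x ⬝ᵥ x) := by
  classical
  obtain ⟨i₀⟩ := ‹Nonempty ι›
  have hunit : (Pi.single i₀ (1 : ℝ) : ι → ℝ) ⬝ᵥ Pi.single i₀ 1 = 1 := by simp
  have hr := hs.r_pos
  have hN := hs.N_pos
  have hbounds := fun t ht hB => small_bounds_of_barrier_nonneg (A := A t) (B := B t) hs hup hT
    (t := t) ht hB
  -- The barriers: `‖B‖²` stays below a line growing from `2 N²` to `4 N²`, and the least eigenvalue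
  -- of the symmetric part of the residual stays above `-r N / 10`.
  have hpos := forall_pos_of_barrier (a := 0) (b := T) isCompact_dotProduct_self_eq_one
    (φ := fun (i : Bool) t v => cond i
      (v ⬝ᵥ (symPart D (A t) (B t) *ᵥ v) - -(r * N / 10) * (v ⬝ᵥ v))
      (N ^ 2 * (2 + 2 / T * t) - frobInner (B t) (B t))) ?_ ?_ ?_
  · intro t ht
    obtain ⟨hB, -, hA⟩ := hbounds t ht.2 (hpos t ht false _ hunit).le fun v hv =>
      (hpos t ht true v hv).le
    exact ⟨hB, hA⟩
  · rintro (_ | _)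
    · exact ContinuousOn.comp (fun t ht => (hf.hasDerivWithinAt_barrier T ht).continuousWithinAt)
        continuousOn_fst fun p hp => hp.1.1
    · exact (hf.continuousOn_symPart.mono
        (prod_mono Icc_subset_Ici_self (subset_univ _))).sub
          (continuousOn_const.mul continuousOn_dotProduct_self)
  · rintro (_ | _) v (hv : v ⬝ᵥ v = 1)
    · simp only [cond_false, mul_zero, add_zero]
      linarith [sq_pos_of_pos hN]
    · have hrN : 0 < r * N := by positivity
      have h := sub_mul_le_dotProduct_symPart_mulVec hlo (A 0) (B 0) v
      simp only [cond_true]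
      rw [hv] at h ⊢
      linarith [hs.sq_N_le, hs.lam_pos]
  · rintro t ht hnn (_ | _) v (hv : v ⬝ᵥ v = 1) hz
    all_goals obtain ⟨hB, hP, hA⟩ := hbounds t ht.2 (hnn false v hv) fun w hw => hnn true w hw
    · refine ⟨_, ?_, (hf.hasDerivWithinAt_barrier T ht.1).mono Icc_subset_Ici_self⟩
      have hT' : 5 * (r * N) < 2 / T := by
        rw [lt_div_iff₀ hT]
        linarith
      have := mul_lt_mul_of_pos_right hT' (sq_pos_of_pos hN)
      linarith [two_mul_frobInner_velB_le hr.le hN.le hA hB (hf.rest_le t ht.1) hP]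
    · exact ⟨_, deriv_symPart_pos hs hD hlo hA hB (hf.rest_le t ht.1) hP hv (sub_eq_zero.1 hz),
        ((hf.hasDerivWithinAt_symPart ht.1 v).mono Icc_subset_Ici_self).sub_const _⟩

end IsSymmetrizedFlow

end Growth

section Logistic

/-- The solution of the logistic equation `y' = lam y - 2 y ^ 2` that serves as a lower bound for
the smallest eigenvalue of `A Aᵀ`. -/
def logistic (lam s t : ℝ) : ℝ := (2 / lam + 2 * Real.exp (-lam * t) / s ^ 2)⁻¹

variable {lam s t : ℝ}

lemma logistic_pos (hlam : 0 < lam) (hs : 0 < s) (t : ℝ) : 0 < logistic lam s t := by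
  unfold logistic
  positivity

lemma hasDerivAt_logistic (hlam : 0 < lam) (hs : 0 < s) (t : ℝ) :
    HasDerivAt (logistic lam s) (lam * logistic lam s t - 2 * logistic lam s t ^ 2) t := by
  have hden : HasDerivAt (fun τ => 2 / lam + 2 * Real.exp (-lam * τ) / s ^ 2)
      (2 * (Real.exp (-lam * t) * (-lam)) / s ^ 2) t := by
    have hlin : HasDerivAt (fun τ => -lam * τ) (-lam) t := by
      simpa using (hasDerivAt_id t).const_mul (-lam)
    exact ((hlin.exp.const_mul 2).div_const _).const_add _
  have hpos : 0 < 2 / lam + 2 * Real.exp (-lam * t) / s ^ 2 := by positivity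
  have hinv : HasDerivAt (logistic lam s) _ t := hden.inv hpos.ne'
  convert hinv using 1
  unfold logistic
  have := Real.exp_pos (-lam * t)
  field_simp
  ring

lemma sq_half_le_logistic (hlam : 0 < lam) (hs : 0 < s) (hsl : s ^ 2 ≤ lam) (ht : 0 ≤ t) :
    (s / 2) ^ 2 ≤ logistic lam s t := by
  have hexp : Real.exp (-lam * t) ≤ 1 :=
    Real.exp_le_one_iff.2 (by linarith [mul_nonneg hlam.le ht])
  unfold logistic
  rw [le_inv_comm₀ (by positivity) (by positivity)]
  calc 2 / lam + 2 * Real.exp (-lam * t) / s ^ 2 ≤ 2 / s ^ 2 + 2 * 1 / s ^ 2 := by gcongr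
    _ = ((s / 2) ^ 2)⁻¹ := by
        field_simp
        ring

lemma logistic_zero_lt (hlam : 0 < lam) (hs : 0 < s) : logistic lam s 0 < s ^ 2 := by
  unfold logistic
  rw [inv_lt_comm₀ (by positivity) (by positivity)]
  calc (s ^ 2)⁻¹ < 2 / lam + (s ^ 2)⁻¹ + (s ^ 2)⁻¹ := by
        have h : 0 < 2 / lam := by positivity
        have : 0 < (s ^ 2)⁻¹ := by positivity
        linarith
    _ = 2 / lam + 2 * Real.exp (-lam * 0) / s ^ 2 := by
        rw [mul_zero, Real.exp_zero]
        ring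

lemma div_four_le_logistic (hlam : 0 < lam) (hs : 0 < s)
    (ht : Real.log (lam / s ^ 2) / lam ≤ t) : lam / 4 ≤ logistic lam s t := by
  have hexp : Real.exp (-lam * t) ≤ s ^ 2 / lam := by
    rw [div_le_iff₀ hlam] at ht
    calc Real.exp (-lam * t) ≤ Real.exp (-Real.log (lam / s ^ 2)) :=
          Real.exp_le_exp.2 (by linarith)
      _ = s ^ 2 / lam := by
          rw [Real.exp_neg, Real.exp_log (by positivity), inv_div]
  unfold logistic
  rw [le_inv_comm₀ (by positivity) (by positivity)]
  calc 2 / lam + 2 * Real.exp (-lam * t) / s ^ 2 ≤ 2 / lam + 2 * (s ^ 2 / lam) / s ^ 2 := by gcongr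
    _ = (lam / 4)⁻¹ := by
        field_simp
        ring

end Logistic

section GramGrowth

variable {ι μ ν : Type*} [Fintype ι] [Fintype μ] [Fintype ν]
  {D : Matrix ι ι ℝ} {lam r N s : ℝ}

lemma mulVec_transpose_mulVec_eq_smul {κ : Type*} [Fintype κ] {A : Matrix ι κ ℝ} {c : ℝ}
    {v : ι → ℝ} (hmin : ∀ w, c * (w ⬝ᵥ w) ≤ (Aᵀ *ᵥ w) ⬝ᵥ (Aᵀ *ᵥ w))
    (hv : (Aᵀ *ᵥ v) ⬝ᵥ (Aᵀ *ᵥ v) = c * (v ⬝ᵥ v)) : A *ᵥ (Aᵀ *ᵥ v) = c • v := by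
  have hform : ∀ w, w ⬝ᵥ ((A * Aᵀ) *ᵥ w) = (Aᵀ *ᵥ w) ⬝ᵥ (Aᵀ *ᵥ w) := fun w => by
    rw [mulVec_dotProduct, transpose_transpose, mulVec_mulVec]
  rw [mulVec_mulVec]
  refine mulVec_eq_smul_of_rayleigh_eq (by rw [transpose_mul, transpose_transpose]) ?_ ?_
  · simpa only [hform] using hmin
  · rw [hform, hv]

lemma abs_mulVec_dotProduct_mulVec_le (L : Matrix μ ι ℝ) {a b : ι → ℝ} {α β : ℝ} (hα : 0 ≤ α)
    (hβ : 0 ≤ β) (ha : a ⬝ᵥ a ≤ α ^ 2) (hb : b ⬝ᵥ b ≤ β ^ 2) :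
    |(L *ᵥ a) ⬝ᵥ (L *ᵥ b)| ≤ frobInner L L * (α * β) := by
  have hL := frobInner_self_nonneg L
  have hLa := (mulVec_dotProduct_self_le L a).trans (mul_le_mul_of_nonneg_left ha hL)
  have hLb := (mulVec_dotProduct_self_le L b).trans (mul_le_mul_of_nonneg_left hb hL)
  refine abs_le_of_sq_le_sq ((sq_dotProduct_le _ _).trans ?_) (by positivity)
  calc _ ≤ (frobInner L L * α ^ 2) * (frobInner L L * β ^ 2) :=
        mul_le_mul hLa hLb (dotProduct_self_nonneg _) (by positivity)
    _ = _ := by ring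

lemma le_two_mul_dotProduct_velA (hr : 0 ≤ r) (hN : 0 ≤ N) (hD : Dᵀ = D)
    (hlo : ∀ v, lam * (v ⬝ᵥ v) ≤ v ⬝ᵥ (D *ᵥ v)) {A B : Matrix ι ι ℝ} {J : Matrix μ ι ℝ}
    {K : Matrix ν ι ℝ} (hA : ∀ x, (A *ᵥ x) ⬝ᵥ (A *ᵥ x) ≤ (2 * r) ^ 2 * (x ⬝ᵥ x))
    (hB : frobInner B B ≤ (2 * N) ^ 2) (hJK : frobInner J J + frobInner K K ≤ N ^ 2)
    {v : ι → ℝ} (hv : v ⬝ᵥ v = 1) {x : ℝ} (hx : 0 ≤ x)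
    (hgram : (Aᵀ *ᵥ v) ⬝ᵥ (Aᵀ *ᵥ v) = x ^ 2) (heig : A *ᵥ (Aᵀ *ᵥ v) = x ^ 2 • v) :
    2 * x ^ 2 * (lam - x ^ 2) - (16 * (r * N ^ 2 * x) + 9 * (N ^ 2 * x ^ 2) + 2 * (N ^ 3 * x))
      ≤ 2 * ((Aᵀ *ᵥ v) ⬝ᵥ ((velA D A B J K)ᵀ *ᵥ v)) := by
  have hPv := dotProduct_symPart_mulVec D A B v
  rw [transpose_mulVec_dotProduct_velA hD A B J K v rfl rfl, heig, smul_dotProduct, smul_eq_mul,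
    hPv, hgram]
  have hBv := transpose_mulVec_dotProduct_self_le B v
  have hDv := hlo v
  rw [hv] at hBv hDv
  set a := Aᵀ *ᵥ v
  set b := Bᵀ *ᵥ v
  have hbN : b ⬝ᵥ b ≤ (2 * N) ^ 2 := by linarith
  have hBa : (B *ᵥ a) ⬝ᵥ (B *ᵥ a) ≤ (2 * N * x) ^ 2 := by
    have hle := mulVec_dotProduct_self_le B a
    rw [hgram] at hle
    linarith [mul_le_mul_of_nonneg_right hB (sq_nonneg x)]
  have hAb : (A *ᵥ b) ⬝ᵥ (A *ᵥ b) ≤ (2 * r * (2 * N)) ^ 2 := by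
    linarith [hA b, mul_le_mul_of_nonneg_left hbN (sq_nonneg (2 * r))]
  have hmix := (abs_le.1 (abs_dotProduct_le (by positivity) (by positivity) hBa hAb)).1
  have hKa := mulVec_dotProduct_self_le K a
  have hJa := mulVec_dotProduct_self_le J a
  rw [hgram] at hKa hJa
  have hKab := (abs_le.1 (abs_mulVec_dotProduct_mulVec_le K hx (by positivity) hgram.le hbN)).2
  have hJab := (abs_le.1 (abs_mulVec_dotProduct_mulVec_le J hx (by positivity) hgram.le hbN)).1
  have hJKx := mul_le_mul_of_nonneg_right hJK (sq_nonneg x)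
  have hJKxN := mul_le_mul_of_nonneg_right hJK (by positivity : 0 ≤ x * (2 * N))
  have hmain := mul_le_mul_of_nonneg_left hDv (sq_nonneg x)
  have hbb := mul_nonneg (sq_nonneg x) (dotProduct_self_nonneg b)
  linarith

lemma mixed_terms_lt (hs : ScaleSeparation lam r N) {x : ℝ} (hx : 0 < x)
    (hx' : 100 * (r * N ^ 2) ≤ lam * x) :
    16 * (r * N ^ 2 * x) + 9 * (N ^ 2 * x ^ 2) + 2 * (N ^ 3 * x) < lam * x ^ 2 := by
  have hN := hs.N_pos
  have hNx : N ^ 2 * x ^ 2 ≤ lam / 1000 * x ^ 2 := by gcongr; exact hs.sq_N_le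
  have hrNx : r * N ^ 2 * x ≤ lam / 100 * x ^ 2 := by
    linarith [mul_le_mul_of_nonneg_right hx' hx.le]
  have hN3 : N ^ 3 * x ≤ r * N ^ 2 * x := by
    have hle : N ≤ r := by linarith [hs.N_le]
    linarith [mul_le_mul_of_nonneg_right hle (by positivity : 0 ≤ N ^ 2 * x)]
  linarith [mul_pos hs.lam_pos (pow_pos hx 2)]

lemma logistic_rate_lt_deriv_gram (hs : ScaleSeparation lam r N) (hD : Dᵀ = D)
    (hlo : ∀ v, lam * (v ⬝ᵥ v) ≤ v ⬝ᵥ (D *ᵥ v)) {A B : Matrix ι ι ℝ} {J : Matrix μ ι ℝ}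
    {K : Matrix ν ι ℝ} (hA : ∀ x, (A *ᵥ x) ⬝ᵥ (A *ᵥ x) ≤ (2 * r) ^ 2 * (x ⬝ᵥ x))
    (hB : frobInner B B ≤ (2 * N) ^ 2) (hJK : frobInner J J + frobInner K K ≤ N ^ 2)
    {v : ι → ℝ} (hv : v ⬝ᵥ v = 1) {y : ℝ} (hy : 0 < y)
    (hy' : 100 * (r * N ^ 2) ≤ lam * √y)
    (hmin : ∀ w, y * (w ⬝ᵥ w) ≤ (Aᵀ *ᵥ w) ⬝ᵥ (Aᵀ *ᵥ w))
    (hgram : (Aᵀ *ᵥ v) ⬝ᵥ (Aᵀ *ᵥ v) = y) :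
    lam * y - 2 * y ^ 2 < 2 * ((Aᵀ *ᵥ v) ⬝ᵥ ((velA D A B J K)ᵀ *ᵥ v)) := by
  have heig := mulVec_transpose_mulVec_eq_smul hmin (by rw [hgram, hv, mul_one])
  have hsq := Real.sq_sqrt hy.le
  have hle := le_two_mul_dotProduct_velA hs.r_pos.le hs.N_pos.le hD hlo hA hB hJK hv
    (Real.sqrt_nonneg y) (hgram.trans hsq.symm) (heig.trans (by rw [hsq]))
  have hlt := mixed_terms_lt hs (Real.sqrt_pos.2 hy) hy'
  rw [hsq] at hle hlt
  linarith

lemma IsSymmetrizedFlow.logistic_le {A B : ℝ → Matrix ι ι ℝ} {J : ℝ → Matrix μ ι ℝ}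
    {K : ℝ → Matrix ν ι ℝ} (hf : IsSymmetrizedFlow D N A B J K) (hs : ScaleSeparation lam r N)
    (hD : Dᵀ = D) (hlo : ∀ v, lam * (v ⬝ᵥ v) ≤ v ⬝ᵥ (D *ᵥ v)) (hs₀ : 0 < s) (hsl : s ^ 2 ≤ lam)
    (hrs : 200 * (r * N ^ 2) ≤ lam * s)
    (hA₀ : ∀ v, s ^ 2 * (v ⬝ᵥ v) ≤ ((A 0)ᵀ *ᵥ v) ⬝ᵥ ((A 0)ᵀ *ᵥ v)) {T : ℝ}
    (hbounds : ∀ t ∈ Icc 0 T, frobInner (B t) (B t) ≤ (2 * N) ^ 2 ∧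
      ∀ x, (A t *ᵥ x) ⬝ᵥ (A t *ᵥ x) ≤ (2 * r) ^ 2 * (x ⬝ᵥ x)) :
    ∀ t ∈ Icc 0 T, ∀ v, logistic lam s t * (v ⬝ᵥ v) ≤ ((A t)ᵀ *ᵥ v) ⬝ᵥ ((A t)ᵀ *ᵥ v) := by
  have hlam := hs.lam_pos
  have hext : ∀ t, (∀ v, v ⬝ᵥ v = 1 →
      0 ≤ ((A t)ᵀ *ᵥ v) ⬝ᵥ ((A t)ᵀ *ᵥ v) - logistic lam s t * (v ⬝ᵥ v)) →
      ∀ v, logistic lam s t * (v ⬝ᵥ v) ≤ ((A t)ᵀ *ᵥ v) ⬝ᵥ ((A t)ᵀ *ᵥ v) := by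
    simp only [mulVec_dotProduct (A _)ᵀ, mulVec_mulVec]
    exact fun t h => forall_le_of_forall_unit h
  have hpos := forall_pos_of_barrier (a := 0) (b := T) isCompact_dotProduct_self_eq_one
    (φ := fun (_ : Unit) t v =>
      ((A t)ᵀ *ᵥ v) ⬝ᵥ ((A t)ᵀ *ᵥ v) - logistic lam s t * (v ⬝ᵥ v)) ?_ ?_ ?_
  · exact fun t ht => hext t fun v hv => (hpos t ht () v hv).le
  · have hgram := continuousOn_mulVec_dotProduct_self fun t ht => (hf.deriv_A t ht).transpose
    have hlog : Continuous (logistic lam s) :=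
      continuous_iff_continuousAt.2 fun t => (hasDerivAt_logistic hlam hs₀ t).continuousAt
    exact fun _ => (hgram.mono (prod_mono Icc_subset_Ici_self (subset_univ _))).sub
      ((hlog.comp continuous_fst).continuousOn.mul continuousOn_dotProduct_self)
  · rintro - v (hv : v ⬝ᵥ v = 1)
    have h := hA₀ v
    rw [hv] at h ⊢
    linarith [logistic_zero_lt hlam hs₀]
  · rintro t ht hnn - v (hv : v ⬝ᵥ v = 1) hz
    have hsqrt : s / 2 ≤ √(logistic lam s t) :=
      Real.le_sqrt_of_sq_le (sq_half_le_logistic hlam hs₀ hsl ht.1)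
    refine ⟨_, sub_pos.2 ?_, (((hf.deriv_A t ht.1).transpose.mulVec_dotProduct_self v).sub
      (((hasDerivAt_logistic hlam hs₀ t).hasDerivWithinAt).mul_const (v ⬝ᵥ v))).mono
        Icc_subset_Ici_self⟩
    rw [hv, mul_one] at hz ⊢
    exact logistic_rate_lt_deriv_gram hs hD hlo (hbounds t ht).2 (hbounds t ht).1
      (hf.rest_le t ht.1) hv (logistic_pos hlam hs₀ t)
      (by linarith [mul_le_mul_of_nonneg_left hsqrt hlam.le]) (hext t fun w hw => hnn () w hw)
      (sub_eq_zero.1 hz)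

end GramGrowth

section Block

variable {ι μ ν : Type*} [Fintype ι] [Fintype μ] [Fintype ν]

/-- The velocity of the factor `U` of a gradient flow with target `D`, second factor `V`, and
components `K` of the second factor orthogonal to the singular subspace. -/
def factorVel (D U V : Matrix ι ι ℝ) (K : Matrix ν ι ℝ) : Matrix ι ι ℝ :=
  (D - U * Vᵀ) * V - U * (Kᵀ * K)

/-- The gradient flow written in the singular bases of the target: `U` and `V` are the components
of the factors in the singular subspaces and `J` and `K` the orthogonal components. -/
structure IsBlockFlow (D : Matrix ι ι ℝ) (U V : ℝ → Matrix ι ι ℝ) (J : ℝ → Matrix μ ι ℝ)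
    (K : ℝ → Matrix ν ι ℝ) : Prop where
  deriv_U : ∀ t ∈ Ici (0 : ℝ), HasMatrixDerivWithinAt U (factorVel D (U t) (V t) (K t)) (Ici 0) t
  deriv_V : ∀ t ∈ Ici (0 : ℝ), HasMatrixDerivWithinAt V (factorVel Dᵀ (V t) (U t) (J t)) (Ici 0) t
  deriv_J : ∀ t ∈ Ici (0 : ℝ),
    HasMatrixDerivWithinAt J (-(J t * ((V t)ᵀ * V t + (K t)ᵀ * K t))) (Ici 0) t
  deriv_K : ∀ t ∈ Ici (0 : ℝ),
    HasMatrixDerivWithinAt K (-(K t * ((U t)ᵀ * U t + (J t)ᵀ * J t))) (Ici 0) t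

lemma IsBlockFlow.swap {D : Matrix ι ι ℝ} {U V : ℝ → Matrix ι ι ℝ} {J : ℝ → Matrix μ ι ℝ}
    {K : ℝ → Matrix ν ι ℝ} (h : IsBlockFlow D U V J K) : IsBlockFlow Dᵀ V U K J :=
  ⟨h.deriv_V, by simpa only [transpose_transpose] using h.deriv_U, h.deriv_K, h.deriv_J⟩

/-- The objective in block form. -/
def blockLoss (D U V : Matrix ι ι ℝ) (J : Matrix μ ι ℝ) (K : Matrix ν ι ℝ) : ℝ :=
  (1 / 2) * (frobInner (D - U * Vᵀ) (D - U * Vᵀ) + frobInner (U * Kᵀ) (U * Kᵀ)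
    + frobInner (J * Vᵀ) (J * Vᵀ) + frobInner (J * Kᵀ) (J * Kᵀ))

/-- The squared norm of the gradient of `blockLoss`. -/
def blockGradSq (D U V : Matrix ι ι ℝ) (J : Matrix μ ι ℝ) (K : Matrix ν ι ℝ) : ℝ :=
  frobInner (factorVel D U V K) (factorVel D U V K)
    + frobInner (factorVel Dᵀ V U J) (factorVel Dᵀ V U J)
    + frobInner (J * (Vᵀ * V + Kᵀ * K)) (J * (Vᵀ * V + Kᵀ * K))
    + frobInner (K * (Uᵀ * U + Jᵀ * J)) (K * (Uᵀ * U + Jᵀ * J))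

lemma blockGradSq_nonneg (D U V : Matrix ι ι ℝ) (J : Matrix μ ι ℝ) (K : Matrix ν ι ℝ) :
    0 ≤ blockGradSq D U V J K :=
  add_nonneg (add_nonneg (add_nonneg (frobInner_self_nonneg _) (frobInner_self_nonneg _))
    (frobInner_self_nonneg _)) (frobInner_self_nonneg _)

lemma frobInner_mul_transpose_self_comm (X : Matrix μ ι ℝ) (Y : Matrix ν ι ℝ) :
    frobInner (Y * Xᵀ) (Y * Xᵀ) = frobInner (X * Yᵀ) (X * Yᵀ) := by
  rw [← frobInner_transpose, transpose_mul, transpose_transpose]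

lemma blockLoss_transpose (D U V : Matrix ι ι ℝ) (J : Matrix μ ι ℝ) (K : Matrix ν ι ℝ) :
    blockLoss Dᵀ V U K J = blockLoss D U V J K := by
  have hres : Dᵀ - V * Uᵀ = (D - U * Vᵀ)ᵀ := by
    rw [transpose_sub, transpose_mul, transpose_transpose]
  rw [blockLoss, blockLoss, hres, frobInner_transpose, frobInner_mul_transpose_self_comm J V,
    frobInner_mul_transpose_self_comm U K, frobInner_mul_transpose_self_comm J K]
  ring

lemma frobInner_residual_le (D U V : Matrix ι ι ℝ) (J : Matrix μ ι ℝ) (K : Matrix ν ι ℝ) :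
    frobInner (D - U * Vᵀ) (D - U * Vᵀ) ≤ 2 * blockLoss D U V J K := by
  rw [blockLoss]
  linarith [frobInner_self_nonneg (U * Kᵀ), frobInner_self_nonneg (J * Vᵀ),
    frobInner_self_nonneg (J * Kᵀ)]

lemma frobInner_mul_transpose_eq_left (M : Matrix μ ν ℝ) (X : Matrix μ ι ℝ) (Y : Matrix ν ι ℝ) :
    frobInner M (X * Yᵀ) = frobInner (M * Y) X :=
  (frobInner_mul_left_eq_mul_transpose M Y X).symm

lemma frobInner_mul_transpose_eq_right (M : Matrix μ ν ℝ) (X : Matrix μ ι ℝ) (Y : Matrix ν ι ℝ) :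
    frobInner M (X * Yᵀ) = frobInner (Mᵀ * X) Y := by
  rw [← frobInner_transpose, transpose_mul, transpose_transpose, frobInner_mul_transpose_eq_left]

lemma hasDerivWithinAt_blockLoss (D : Matrix ι ι ℝ) {U V : ℝ → Matrix ι ι ℝ}
    {J : ℝ → Matrix μ ι ℝ} {K : ℝ → Matrix ν ι ℝ} {U' V' : Matrix ι ι ℝ} {J' : Matrix μ ι ℝ}
    {K' : Matrix ν ι ℝ} {s : Set ℝ} {t : ℝ} (hU : HasMatrixDerivWithinAt U U' s t)
    (hV : HasMatrixDerivWithinAt V V' s t) (hJ : HasMatrixDerivWithinAt J J' s t)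
    (hK : HasMatrixDerivWithinAt K K' s t) :
    HasDerivWithinAt (fun τ => blockLoss D (U τ) (V τ) (J τ) (K τ))
      (-frobInner (factorVel D (U t) (V t) (K t)) U'
        - frobInner (factorVel Dᵀ (V t) (U t) (J t)) V'
        + frobInner (J t * ((V t)ᵀ * V t + (K t)ᵀ * K t)) J'
        + frobInner (K t * ((U t)ᵀ * U t + (J t)ᵀ * J t)) K') s t := by
  have hres := ((HasMatrixDerivWithinAt.const D).sub (hU.mul hV.transpose)).frobInner_self
  refine ((((hres.add (hU.mul hK.transpose).frobInner_self).add
    (hJ.mul hV.transpose).frobInner_self).add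
    (hJ.mul hK.transpose).frobInner_self).const_mul (1 / 2)).congr_deriv ?_
  rw [zero_sub, frobInner_neg_right]
  simp only [frobInner_add_right, frobInner_mul_transpose_eq_left _ U',
    frobInner_mul_transpose_eq_left _ J', frobInner_mul_transpose_eq_right _ _ V',
    frobInner_mul_transpose_eq_right _ _ K', factorVel, frobInner_add_left, frobInner_sub_left,
    Matrix.mul_add, Matrix.sub_mul, transpose_sub, transpose_mul, transpose_transpose,
    Matrix.mul_assoc]
  ring

lemma frobInner_mul_gram_add_gram (J : Matrix μ ι ℝ) (V : Matrix ι ι ℝ) (K : Matrix ν ι ℝ) :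
    frobInner J (J * (Vᵀ * V + Kᵀ * K))
      = frobInner (J * Vᵀ) (J * Vᵀ) + frobInner (J * Kᵀ) (J * Kᵀ) := by
  rw [Matrix.mul_add, frobInner_add_right, frobInner_mul_left_eq_mul_transpose,
    frobInner_mul_left_eq_mul_transpose J Kᵀ, transpose_transpose, transpose_transpose,
    Matrix.mul_assoc, Matrix.mul_assoc]

lemma dotProduct_mulVec_eq_zero_of_transpose_eq_neg {W : Matrix ι ι ℝ} (hW : Wᵀ = -W)
    (z : ι → ℝ) : z ⬝ᵥ (W *ᵥ z) = 0 := by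
  have hneg : z ⬝ᵥ (W *ᵥ z) = z ⬝ᵥ (Wᵀ *ᵥ z) := by rw [← mulVec_dotProduct, dotProduct_comm]
  rw [hW, neg_mulVec, dotProduct_neg] at hneg
  linarith

namespace IsBlockFlow

variable {D : Matrix ι ι ℝ} {U V : ℝ → Matrix ι ι ℝ} {J : ℝ → Matrix μ ι ℝ}
  {K : ℝ → Matrix ν ι ℝ} {t : ℝ}

lemma hasDerivWithinAt_blockLoss (h : IsBlockFlow D U V J K) (ht : 0 ≤ t) :
    HasDerivWithinAt (fun τ => blockLoss D (U τ) (V τ) (J τ) (K τ))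
      (-blockGradSq D (U t) (V t) (J t) (K t)) (Ici 0) t := by
  refine (MatrixFactorization.hasDerivWithinAt_blockLoss D (h.deriv_U t ht) (h.deriv_V t ht)
    (h.deriv_J t ht) (h.deriv_K t ht)).congr_deriv ?_
  rw [blockGradSq, frobInner_neg_right, frobInner_neg_right]
  ring

lemma blockLoss_antitoneOn (h : IsBlockFlow D U V J K) :
    AntitoneOn (fun t => blockLoss D (U t) (V t) (J t) (K t)) (Ici 0) :=
  antitoneOn_of_hasDerivWithinAt_nonpos (convex_Ici 0)
    (fun _ ht => (h.hasDerivWithinAt_blockLoss ht).continuousWithinAt)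
    (fun _ ht => (h.hasDerivWithinAt_blockLoss (interior_subset ht)).mono interior_subset)
    fun _ _ => neg_nonpos.2 (blockGradSq_nonneg _ _ _ _ _)

lemma frobInner_J_le (h : IsBlockFlow D U V J K) (ht : 0 ≤ t) :
    frobInner (J t) (J t) ≤ frobInner (J 0) (J 0) :=
  le_of_hasDerivWithinAt_nonpos ht
    (fun τ hτ => (h.deriv_J τ hτ.1).frobInner_self.mono Icc_subset_Ici_self) fun τ _ => by
      rw [frobInner_neg_right, frobInner_mul_gram_add_gram]
      linarith [frobInner_self_nonneg (J τ * (V τ)ᵀ), frobInner_self_nonneg (J τ * (K τ)ᵀ)]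

lemma frobInner_K_le (h : IsBlockFlow D U V J K) (ht : 0 ≤ t) :
    frobInner (K t) (K t) ≤ frobInner (K 0) (K 0) :=
  h.swap.frobInner_J_le ht

lemma hasDerivWithinAt_gram_diff (h : IsBlockFlow D U V J K) (z : ι → ℝ) (ht : 0 ≤ t) :
    HasDerivWithinAt (fun τ => (U τ *ᵥ z) ⬝ᵥ (U τ *ᵥ z) + (J τ *ᵥ z) ⬝ᵥ (J τ *ᵥ z)
      - (V τ *ᵥ z) ⬝ᵥ (V τ *ᵥ z) - (K τ *ᵥ z) ⬝ᵥ (K τ *ᵥ z)) 0 (Ici 0) t := by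
  refine (((((h.deriv_U t ht).mulVec_dotProduct_self z).add
    ((h.deriv_J t ht).mulVec_dotProduct_self z)).sub
    ((h.deriv_V t ht).mulVec_dotProduct_self z)).sub
    ((h.deriv_K t ht).mulVec_dotProduct_self z)).congr_deriv ?_
  have hskew := dotProduct_mulVec_eq_zero_of_transpose_eq_neg
    (W := (U t)ᵀ * factorVel D (U t) (V t) (K t)
      + (J t)ᵀ * (-(J t * ((V t)ᵀ * V t + (K t)ᵀ * K t)))
      - (V t)ᵀ * factorVel Dᵀ (V t) (U t) (J t)
      - (K t)ᵀ * (-(K t * ((U t)ᵀ * U t + (J t)ᵀ * J t)))) (by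
        simp only [factorVel, transpose_add, transpose_sub, transpose_mul, transpose_neg,
          transpose_transpose, Matrix.mul_add, Matrix.mul_sub, Matrix.sub_mul, Matrix.mul_neg,
          Matrix.mul_assoc]
        abel) z
  rw [sub_mulVec, sub_mulVec, add_mulVec, dotProduct_sub, dotProduct_sub, dotProduct_add,
    ← mulVec_mulVec, ← mulVec_mulVec, ← mulVec_mulVec, ← mulVec_mulVec] at hskew
  simp only [mulVec_dotProduct (U t), mulVec_dotProduct (V t), mulVec_dotProduct (J t),
    mulVec_dotProduct (K t)]
  linarith

lemma gram_diff_eq (h : IsBlockFlow D U V J K) (z : ι → ℝ) (ht : 0 ≤ t) :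
    (U t *ᵥ z) ⬝ᵥ (U t *ᵥ z) + (J t *ᵥ z) ⬝ᵥ (J t *ᵥ z) - (V t *ᵥ z) ⬝ᵥ (V t *ᵥ z)
        - (K t *ᵥ z) ⬝ᵥ (K t *ᵥ z)
      = (U 0 *ᵥ z) ⬝ᵥ (U 0 *ᵥ z) + (J 0 *ᵥ z) ⬝ᵥ (J 0 *ᵥ z) - (V 0 *ᵥ z) ⬝ᵥ (V 0 *ᵥ z)
        - (K 0 *ᵥ z) ⬝ᵥ (K 0 *ᵥ z) := by
  have hle := le_of_hasDerivWithinAt_nonpos ht (fun τ hτ =>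
    (h.hasDerivWithinAt_gram_diff z hτ.1).mono Icc_subset_Ici_self) fun _ _ => le_rfl
  have hge := le_of_hasDerivWithinAt_nonpos ht (fun τ hτ =>
    (h.swap.hasDerivWithinAt_gram_diff z hτ.1).mono Icc_subset_Ici_self) fun _ _ => le_rfl
  linarith

lemma mulVec_dotProduct_self_le_add (h : IsBlockFlow D U V J K) {c : ℝ}
    (hinit : frobInner (U 0) (U 0) + frobInner (V 0) (V 0) + frobInner (J 0) (J 0)
      + frobInner (K 0) (K 0) ≤ c) (ht : 0 ≤ t) (z : ι → ℝ) :
    (V t *ᵥ z) ⬝ᵥ (V t *ᵥ z) ≤ (U t *ᵥ z) ⬝ᵥ (U t *ᵥ z) + c * (z ⬝ᵥ z) := by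
  have hz := dotProduct_self_nonneg z
  have hJ := (mulVec_dotProduct_self_le (J t) z).trans
    (mul_le_mul_of_nonneg_right (h.frobInner_J_le ht) hz)
  linarith [h.gram_diff_eq z ht, mulVec_dotProduct_self_le (V 0) z,
    mulVec_dotProduct_self_le (K 0) z, mul_le_mul_of_nonneg_right hinit hz,
    mul_nonneg (frobInner_self_nonneg (U 0)) hz, dotProduct_self_nonneg (U 0 *ᵥ z),
    dotProduct_self_nonneg (J 0 *ᵥ z), dotProduct_self_nonneg (K t *ᵥ z)]

end IsBlockFlow

end Block

section Conditioning

variable {ι μ ν : Type*} [Fintype ι] [Fintype μ] [Fintype ν]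

lemma mul_dotProduct_le_of_mul_self_le {x y : ι → ℝ} {c : ℝ} (hc : 0 ≤ c)
    (h : c * (x ⬝ᵥ x) ≤ x ⬝ᵥ y) : c * (x ⬝ᵥ y) ≤ y ⬝ᵥ y := by
  have hsq := dotProduct_self_nonneg (y - c • x)
  simp only [sub_dotProduct, dotProduct_sub, smul_dotProduct, dotProduct_smul, smul_eq_mul,
    dotProduct_comm y x] at hsq
  linarith [mul_le_mul_of_nonneg_left h hc]

lemma mul_frobInner_mul_le_of_forall {E : Matrix ι ι ℝ} (hE : Eᵀ = E) {c : ℝ} (hc : 0 ≤ c)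
    (h : ∀ x, c * (x ⬝ᵥ x) ≤ x ⬝ᵥ (E *ᵥ x)) (J : Matrix μ ι ℝ) :
    c * frobInner J (J * E) ≤ frobInner (J * E) (J * E) := by
  simp only [frobInner_eq_sum_dotProduct, Finset.mul_sum, mul_apply_eq_transpose_mulVec, hE]
  exact Finset.sum_le_sum fun i _ => mul_dotProduct_le_of_mul_self_le hc (h (J i))

lemma half_frobInner_sub_le (X Y : Matrix μ ν ℝ) :
    (1 / 2) * frobInner X X - frobInner Y Y ≤ frobInner (X - Y) (X - Y) := by
  have h := frobInner_self_nonneg (X - (2 : ℝ) • Y)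
  simp only [frobInner_sub_left, frobInner_sub_right, frobInner_smul_left,
    frobInner_smul_right] at h ⊢
  linarith [frobInner_comm X Y]

lemma le_frobInner_factorVel_self {D U V : Matrix ι ι ℝ} {K : Matrix ν ι ℝ} {c : ℝ}
    (hV : ∀ x, c * (x ⬝ᵥ x) ≤ (Vᵀ *ᵥ x) ⬝ᵥ (Vᵀ *ᵥ x)) (hK : frobInner K K ≤ c / 2) :
    c / 2 * frobInner (D - U * Vᵀ) (D - U * Vᵀ) - c / 2 * frobInner (U * Kᵀ) (U * Kᵀ)
      ≤ frobInner (factorVel D U V K) (factorVel D U V K) := by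
  have hUK : frobInner (U * (Kᵀ * K)) (U * (Kᵀ * K)) ≤ frobInner (U * Kᵀ) (U * Kᵀ) * (c / 2) := by
    rw [← Matrix.mul_assoc]
    exact (frobInner_mul_self_le _ _).trans
      (mul_le_mul_of_nonneg_left hK (frobInner_self_nonneg _))
  have hR := le_frobInner_mul_self_of_forall hV (D - U * Vᵀ)
  have := half_frobInner_sub_le ((D - U * Vᵀ) * V) (U * (Kᵀ * K))
  rw [factorVel]
  linarith

lemma le_frobInner_mul_gram_add_gram_self {V : Matrix ι ι ℝ} {c : ℝ} (hc : 0 < c)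
    (hV : ∀ x, c * (x ⬝ᵥ x) ≤ (Vᵀ *ᵥ x) ⬝ᵥ (Vᵀ *ᵥ x)) (J : Matrix μ ι ℝ) (K : Matrix ν ι ℝ) :
    c * (frobInner (J * Vᵀ) (J * Vᵀ) + frobInner (J * Kᵀ) (J * Kᵀ))
      ≤ frobInner (J * (Vᵀ * V + Kᵀ * K)) (J * (Vᵀ * V + Kᵀ * K)) := by
  rw [← frobInner_mul_gram_add_gram]
  refine mul_frobInner_mul_le_of_forall (by simp) hc.le (fun x => ?_) J
  have hgram := le_mulVec_dotProduct_self_of_transpose hc hV x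
  rw [mulVec_dotProduct] at hgram
  have hK : 0 ≤ x ⬝ᵥ (Kᵀ *ᵥ (K *ᵥ x)) := by
    rw [← mulVec_dotProduct]
    exact dotProduct_self_nonneg _
  rw [add_mulVec, ← mulVec_mulVec, ← mulVec_mulVec, dotProduct_add]
  linarith

lemma mul_blockLoss_le_blockGradSq {D U V : Matrix ι ι ℝ} {J : Matrix μ ι ℝ} {K : Matrix ν ι ℝ}
    {c : ℝ} (hc : 0 < c) (hU : ∀ x, c * (x ⬝ᵥ x) ≤ (Uᵀ *ᵥ x) ⬝ᵥ (Uᵀ *ᵥ x))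
    (hV : ∀ x, c * (x ⬝ᵥ x) ≤ (Vᵀ *ᵥ x) ⬝ᵥ (Vᵀ *ᵥ x)) (hJ : frobInner J J ≤ c / 2)
    (hK : frobInner K K ≤ c / 2) : c * blockLoss D U V J K ≤ blockGradSq D U V J K := by
  have hres := mul_nonneg hc.le (frobInner_self_nonneg (D - U * Vᵀ))
  have hUvel := le_frobInner_factorVel_self (D := D) (U := U) hV hK
  have hVvel := le_frobInner_factorVel_self (D := Dᵀ) (U := V) hU hJ
  have hresT := frobInner_transpose (D - U * Vᵀ) (D - U * Vᵀ)
  rw [transpose_sub, transpose_mul, transpose_transpose] at hresT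
  have hJvel := le_frobInner_mul_gram_add_gram_self hc hV J K
  have hKvel := le_frobInner_mul_gram_add_gram_self hc hU K J
  rw [frobInner_mul_transpose_self_comm U K, frobInner_mul_transpose_self_comm J K] at hKvel
  rw [frobInner_mul_transpose_self_comm J V, hresT] at hVvel
  have hJK := mul_nonneg hc.le (frobInner_self_nonneg (J * Kᵀ))
  rw [blockLoss, blockGradSq]
  linarith

lemma exists_unit_forall_le_mulVec_dotProduct_self [Nonempty ι] (A : Matrix μ ι ℝ) :
    ∃ v : ι → ℝ, v ⬝ᵥ v = 1 ∧
      ∀ x, ((A *ᵥ v) ⬝ᵥ (A *ᵥ v)) * (x ⬝ᵥ x) ≤ (A *ᵥ x) ⬝ᵥ (A *ᵥ x) := by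
  classical
  obtain ⟨i₀⟩ := ‹Nonempty ι›
  have hcont : Continuous fun x : ι → ℝ => (A *ᵥ x) ⬝ᵥ (A *ᵥ x) := by
    simp only [dotProduct, mulVec]
    fun_prop
  obtain ⟨v, hv, hvmin⟩ := (isCompact_dotProduct_self_eq_one (ι := ι)).exists_isMinOn
    ⟨Pi.single i₀ 1, by simp⟩ hcont.continuousOn
  refine ⟨v, hv, fun x => sub_nonneg.1 (nonneg_of_forall_unit
    (q := fun x => (A *ᵥ x) ⬝ᵥ (A *ᵥ x) - ((A *ᵥ v) ⬝ᵥ (A *ᵥ v)) * (x ⬝ᵥ x))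
    (fun c x => ?_) (fun w hw => ?_) x)⟩
  · simp only [mulVec_smul, smul_dotProduct, dotProduct_smul, smul_eq_mul]
    ring
  · rw [hw, mul_one, sub_nonneg]
    exact hvmin hw

-- At a minimizer `v` of `‖Uᵀ v‖²`, with value `α`, one has `U Uᵀ v = α v`, so balance bounds
-- `‖V Uᵀ v‖²` by `α² + λ α / 8`; but `v · V Uᵀ v` is at least `3 λ / 4`.
lemma le_transpose_mulVec_of_residual {D U V : Matrix ι ι ℝ} {lam : ℝ} (hlam : 0 < lam)
    (hlo : ∀ v, lam * (v ⬝ᵥ v) ≤ v ⬝ᵥ (D *ᵥ v))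
    (hR : frobInner (D - U * Vᵀ) (D - U * Vᵀ) ≤ (lam / 4) ^ 2)
    (hbal : ∀ z, (V *ᵥ z) ⬝ᵥ (V *ᵥ z) ≤ (U *ᵥ z) ⬝ᵥ (U *ᵥ z) + lam / 8 * (z ⬝ᵥ z)) (x : ι → ℝ) :
    lam / 8 * (x ⬝ᵥ x) ≤ (Uᵀ *ᵥ x) ⬝ᵥ (Uᵀ *ᵥ x) := by
  rcases isEmpty_or_nonempty ι with hemp | hne
  · simp [dotProduct]
  obtain ⟨v, hv, hmin⟩ := exists_unit_forall_le_mulVec_dotProduct_self Uᵀ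
  have hgram := mulVec_transpose_mulVec_eq_smul hmin (by rw [hv, mul_one])
  set α := (Uᵀ *ᵥ v) ⬝ᵥ (Uᵀ *ᵥ v) with hα
  suffices hge : lam / 8 ≤ α from
    (mul_le_mul_of_nonneg_right hge (dotProduct_self_nonneg x)).trans (hmin x)
  have hVle : (V *ᵥ (Uᵀ *ᵥ v)) ⬝ᵥ (V *ᵥ (Uᵀ *ᵥ v)) ≤ α ^ 2 + lam / 8 * α := by
    have := hbal (Uᵀ *ᵥ v)
    rw [hgram, ← hα, smul_dotProduct, dotProduct_smul, hv, smul_eq_mul, smul_eq_mul] at this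
    linarith
  have hcs := sq_dotProduct_le v (V *ᵥ (Uᵀ *ᵥ v))
  rw [hv, one_mul] at hcs
  have hres : |v ⬝ᵥ ((D - U * Vᵀ) *ᵥ v)| ≤ 1 * (lam / 4) := by
    refine abs_dotProduct_le zero_le_one (by positivity) (by rw [hv, one_pow]) ?_
    have := mulVec_dotProduct_self_le (D - U * Vᵀ) v
    rw [hv] at this
    linarith
  have hpair : v ⬝ᵥ (V *ᵥ (Uᵀ *ᵥ v)) = v ⬝ᵥ (D *ᵥ v) - v ⬝ᵥ ((D - U * Vᵀ) *ᵥ v) := by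
    rw [dotProduct_comm, mulVec_dotProduct, mulVec_dotProduct, transpose_transpose, sub_mulVec,
      dotProduct_sub, ← mulVec_mulVec]
    ring
  have hlow : 3 / 4 * lam ≤ v ⬝ᵥ (V *ᵥ (Uᵀ *ᵥ v)) := by
    have := hlo v
    rw [hv] at this
    linarith [(abs_le.1 hres).2]
  by_contra! hlt
  nlinarith [dotProduct_self_nonneg (Uᵀ *ᵥ v)]

lemma velA_half_add_half_sub {D : Matrix ι ι ℝ} (hD : Dᵀ = D) (U V : Matrix ι ι ℝ)
    (J : Matrix μ ι ℝ) (K : Matrix ν ι ℝ) :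
    velA D ((1 / 2 : ℝ) • (U + V)) ((1 / 2 : ℝ) • (U - V)) J K
      = (1 / 2 : ℝ) • (factorVel D U V K + factorVel Dᵀ V U J) := by
  simp only [velA, symPart, skewPart, factorVel, transpose_add, transpose_sub, transpose_smul,
    hD, Matrix.mul_add, Matrix.mul_sub, Matrix.add_mul, Matrix.sub_mul, Matrix.smul_mul,
    Matrix.mul_smul, smul_add, smul_sub, Matrix.mul_assoc]
  module

lemma velB_half_add_half_sub {D : Matrix ι ι ℝ} (hD : Dᵀ = D) (U V : Matrix ι ι ℝ)
    (J : Matrix μ ι ℝ) (K : Matrix ν ι ℝ) :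
    velB D ((1 / 2 : ℝ) • (U + V)) ((1 / 2 : ℝ) • (U - V)) J K
      = (1 / 2 : ℝ) • (factorVel D U V K - factorVel Dᵀ V U J) := by
  simp only [velB, symPart, skewPart, factorVel, transpose_add, transpose_sub, transpose_smul,
    hD, Matrix.mul_add, Matrix.mul_sub, Matrix.add_mul, Matrix.sub_mul, Matrix.smul_mul,
    Matrix.mul_smul, smul_add, smul_sub, Matrix.mul_assoc]
  module

lemma frobInner_half_add_le (U V : Matrix μ ν ℝ) :
    frobInner ((1 / 2 : ℝ) • (U + V)) ((1 / 2 : ℝ) • (U + V)) ≤ frobInner U U + frobInner V V := by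
  have hdiff := frobInner_self_nonneg (U - V)
  have hU := frobInner_self_nonneg U
  have hV := frobInner_self_nonneg V
  simp only [frobInner_smul_left, frobInner_smul_right, frobInner_add_left, frobInner_add_right,
    frobInner_sub_left, frobInner_sub_right] at hdiff ⊢
  linarith [frobInner_comm U V]

lemma frobInner_half_sub_le (U V : Matrix μ ν ℝ) :
    frobInner ((1 / 2 : ℝ) • (U - V)) ((1 / 2 : ℝ) • (U - V)) ≤ frobInner U U + frobInner V V := by
  simpa only [sub_eq_add_neg, frobInner_neg_left, frobInner_neg_right, neg_neg] using
    frobInner_half_add_le U (-V)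

lemma le_add_dotProduct_self (a b : ι → ℝ) :
    3 / 4 * (a ⬝ᵥ a) - 3 * (b ⬝ᵥ b) ≤ (a + b) ⬝ᵥ (a + b) := by
  have h := dotProduct_self_nonneg (a + (4 : ℝ) • b)
  simp only [add_dotProduct, dotProduct_add, smul_dotProduct, dotProduct_smul, smul_eq_mul] at h ⊢
  linarith [dotProduct_comm a b]

lemma le_sub_dotProduct_self (a b : ι → ℝ) :
    3 / 4 * (a ⬝ᵥ a) - 3 * (b ⬝ᵥ b) ≤ (a - b) ⬝ᵥ (a - b) := by
  simpa [sub_eq_add_neg] using le_add_dotProduct_self a (-b)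

end Conditioning

section Convergence

variable {ι μ ν : Type*} [Fintype ι] [Fintype μ] [Fintype ν]

/-- A small initialization `(U, V, J, K)` of the flow in block form: its total norm is at most `N`
and the least singular value of `(U + V) / 2` is at least `s`, on the scales required by the
target, whose singular values lie between `lam` and `r ^ 2`. -/
structure IsSmallStart (lam r N s : ℝ) (U V : Matrix ι ι ℝ) (J : Matrix μ ι ℝ) (K : Matrix ν ι ℝ) :
    Prop where
  r_pos : 0 < r
  s_pos : 0 < s
  s_le : s ≤ N
  lam_le : lam ≤ r ^ 2
  mul_le : 200 * (r * N ^ 2) ≤ lam * s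
  norm_le : frobInner U U + frobInner V V + frobInner J J + frobInner K K ≤ N ^ 2
  le_half_add : ∀ v, s ^ 2 * (v ⬝ᵥ v)
    ≤ (((1 / 2 : ℝ) • (U + V))ᵀ *ᵥ v) ⬝ᵥ (((1 / 2 : ℝ) • (U + V))ᵀ *ᵥ v)

namespace IsSmallStart

variable {lam r N s : ℝ} {U V : Matrix ι ι ℝ} {J : Matrix μ ι ℝ} {K : Matrix ν ι ℝ}

lemma N_pos (h : IsSmallStart lam r N s U V J K) : 0 < N := h.s_pos.trans_le h.s_le

lemma scaleSeparation (h : IsSmallStart lam r N s U V J K) : ScaleSeparation lam r N := by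
  have hr := h.r_pos
  have hN := h.N_pos
  have hlam : 0 < lam :=
    pos_of_mul_pos_left (lt_of_lt_of_le (by positivity) h.mul_le) h.s_pos.le
  refine ⟨hr, hN, h.lam_le, le_of_mul_le_mul_right ?_ hN⟩
  linarith [h.mul_le, mul_le_mul_of_nonneg_left h.s_le hlam.le]

lemma sq_s_lt (h : IsSmallStart lam r N s U V J K) : s ^ 2 < lam := by
  have hsN : s ^ 2 ≤ N ^ 2 := pow_le_pow_left₀ h.s_pos.le h.s_le 2
  linarith [h.scaleSeparation.sq_N_le, h.scaleSeparation.lam_pos]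

lemma frobInner_J_add_K_le (h : IsSmallStart lam r N s U V J K) :
    frobInner J J + frobInner K K ≤ N ^ 2 := by
  linarith [h.norm_le, frobInner_self_nonneg U, frobInner_self_nonneg V]

lemma frobInner_U_add_V_le (h : IsSmallStart lam r N s U V J K) :
    frobInner U U + frobInner V V ≤ N ^ 2 := by
  linarith [h.norm_le, frobInner_self_nonneg J, frobInner_self_nonneg K]

end IsSmallStart

/-- The time by which all singular values of the two factors have grown to the order of the square
root of `lam`, when they start from the scale `s`. -/
def alignmentTime (lam s : ℝ) : ℝ := Real.log (lam / s ^ 2) / lam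

/-- The time by which a loss that is at most `L` at the alignment time has decayed to
`lam ^ 2 / 32`. -/
def convergenceTime (lam s L : ℝ) : ℝ :=
  alignmentTime lam s + 8 / lam * Real.log (32 * L / lam ^ 2)

lemma alignmentTime_pos {lam s : ℝ} (hs : 0 < s) (hsl : s ^ 2 < lam) : 0 < alignmentTime lam s :=
  div_pos (Real.log_pos ((one_lt_div (by positivity)).2 hsl)) (lt_of_le_of_lt (sq_nonneg s) hsl)

lemma alignmentTime_le_convergenceTime {lam s L : ℝ} (hlam : 0 < lam) (hL : lam ^ 2 / 32 ≤ L) :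
    alignmentTime lam s ≤ convergenceTime lam s L := by
  have hlog : 0 ≤ Real.log (32 * L / lam ^ 2) :=
    Real.log_nonneg ((one_le_div (by positivity)).2 (by linarith))
  exact le_add_of_nonneg_right (by positivity)

lemma exp_convergenceTime_sub_alignmentTime {lam s L : ℝ} (hlam : 0 < lam) (hL : 0 < L) :
    Real.exp (-(lam / 8) * (convergenceTime lam s L - alignmentTime lam s))
      = lam ^ 2 / 32 / L := by
  have hexp : -(lam / 8) * (convergenceTime lam s L - alignmentTime lam s)
      = -Real.log (32 * L / lam ^ 2) := by
    rw [convergenceTime]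
    field_simp
    ring
  rw [hexp, Real.exp_neg, Real.exp_log (by positivity), inv_div, div_div]

namespace IsBlockFlow

variable {D : Matrix ι ι ℝ} {U V : ℝ → Matrix ι ι ℝ} {J : ℝ → Matrix μ ι ℝ}
  {K : ℝ → Matrix ν ι ℝ} {lam r N s T : ℝ}

lemma isSymmetrizedFlow (h : IsBlockFlow D U V J K) (hD : Dᵀ = D)
    (hJK : frobInner (J 0) (J 0) + frobInner (K 0) (K 0) ≤ N ^ 2) :
    IsSymmetrizedFlow D N (fun t => (1 / 2 : ℝ) • (U t + V t))
      (fun t => (1 / 2 : ℝ) • (U t - V t)) J K where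
  deriv_A t ht := by
    rw [velA_half_add_half_sub hD]
    exact ((h.deriv_U t ht).add (h.deriv_V t ht)).const_smul (1 / 2)
  deriv_B t ht := by
    rw [velB_half_add_half_sub hD]
    exact ((h.deriv_U t ht).sub (h.deriv_V t ht)).const_smul (1 / 2)
  rest_le t ht := (add_le_add (h.frobInner_J_le ht) (h.frobInner_K_le ht)).trans hJK

lemma blockLoss_le_mul_exp (h : IsBlockFlow D U V J K) {c a b : ℝ} (hc : 0 < c) (ha : 0 ≤ a)
    (hab : a ≤ b) (hJK : frobInner (J 0) (J 0) + frobInner (K 0) (K 0) ≤ c / 2)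
    (hcond : ∀ t ∈ Icc a b, ∀ x, c * (x ⬝ᵥ x) ≤ ((U t)ᵀ *ᵥ x) ⬝ᵥ ((U t)ᵀ *ᵥ x) ∧
      c * (x ⬝ᵥ x) ≤ ((V t)ᵀ *ᵥ x) ⬝ᵥ ((V t)ᵀ *ᵥ x)) :
    blockLoss D (U b) (V b) (J b) (K b)
      ≤ blockLoss D (U a) (V a) (J a) (K a) * Real.exp (-c * (b - a)) := by
  refine le_mul_exp_of_hasDerivWithinAt_le (g := fun t => blockLoss D (U t) (V t) (J t) (K t)) hab
    (fun t ht => (h.hasDerivWithinAt_blockLoss (ha.trans ht.1)).mono fun x hx => ha.trans hx.1)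
    fun t ht => ?_
  have hJ := h.frobInner_J_le (ha.trans ht.1)
  have hK := h.frobInner_K_le (ha.trans ht.1)
  linarith [mul_blockLoss_le_blockGradSq (D := D) hc (fun x => (hcond t ht x).1)
    (fun x => (hcond t ht x).2) (hJ.trans (by linarith [frobInner_self_nonneg (K 0)]))
    (hK.trans (by linarith [frobInner_self_nonneg (J 0)]))]

lemma well_conditioned [Nonempty ι] (h : IsBlockFlow D U V J K) (hD : Dᵀ = D)
    (hlo : ∀ v, lam * (v ⬝ᵥ v) ≤ v ⬝ᵥ (D *ᵥ v)) (hup : ∀ v, v ⬝ᵥ (D *ᵥ v) ≤ r ^ 2 * (v ⬝ᵥ v))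
    (hinit : IsSmallStart lam r N s (U 0) (V 0) (J 0) (K 0)) (hNT : r * N * T ≤ 1 / 5) :
    ∀ t ∈ Icc (alignmentTime lam s) T, ∀ x,
      lam / 8 * (x ⬝ᵥ x) ≤ ((U t)ᵀ *ᵥ x) ⬝ᵥ ((U t)ᵀ *ᵥ x) ∧
      lam / 8 * (x ⬝ᵥ x) ≤ ((V t)ᵀ *ᵥ x) ⬝ᵥ ((V t)ᵀ *ᵥ x) := by
  intro t ht x
  have hs := hinit.scaleSeparation
  have hpos := alignmentTime_pos hinit.s_pos hinit.sq_s_lt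
  have htT : t ∈ Icc 0 T := ⟨hpos.le.trans ht.1, ht.2⟩
  have hflow := h.isSymmetrizedFlow hD hinit.frobInner_J_add_K_le
  have hbounds := hflow.small_bounds hs hD hlo hup (hpos.trans_le (ht.1.trans ht.2)) hNT
    ((frobInner_half_add_le _ _).trans hinit.frobInner_U_add_V_le)
    ((frobInner_half_sub_le _ _).trans hinit.frobInner_U_add_V_le)
  have hA := hflow.logistic_le hs hD hlo hinit.s_pos hinit.sq_s_lt.le hinit.mul_le
    hinit.le_half_add hbounds t htT x
  have hB := transpose_mulVec_dotProduct_self_le ((1 / 2 : ℝ) • (U t - V t)) x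
  have hx := dotProduct_self_nonneg x
  have hBN := mul_le_mul_of_nonneg_right (hbounds t htT).1 hx
  have hN := mul_le_mul_of_nonneg_right hs.sq_N_le hx
  have hlog := mul_le_mul_of_nonneg_right (div_four_le_logistic hs.lam_pos hinit.s_pos ht.1) hx
  have hlam := mul_nonneg hs.lam_pos.le hx
  have hUt : U t = (1 / 2 : ℝ) • (U t + V t) + (1 / 2 : ℝ) • (U t - V t) := by module
  have hVt : V t = (1 / 2 : ℝ) • (U t + V t) - (1 / 2 : ℝ) • (U t - V t) := by module
  constructor
  · rw [hUt, transpose_add, add_mulVec]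
    refine le_trans ?_ (le_add_dotProduct_self _ _)
    linarith
  · rw [hVt, transpose_sub, sub_mulVec]
    refine le_trans ?_ (le_sub_dotProduct_self _ _)
    linarith

lemma well_conditioned_of_blockLoss_le (h : IsBlockFlow D U V J K) (hD : Dᵀ = D)
    (hlo : ∀ v, lam * (v ⬝ᵥ v) ≤ v ⬝ᵥ (D *ᵥ v)) (hlam : 0 < lam)
    (hinit : frobInner (U 0) (U 0) + frobInner (V 0) (V 0) + frobInner (J 0) (J 0)
      + frobInner (K 0) (K 0) ≤ lam / 8) {t : ℝ} (ht : 0 ≤ t)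
    (hloss : blockLoss D (U t) (V t) (J t) (K t) ≤ lam ^ 2 / 32) (x : ι → ℝ) :
    lam / 8 * (x ⬝ᵥ x) ≤ ((U t)ᵀ *ᵥ x) ⬝ᵥ ((U t)ᵀ *ᵥ x) ∧
      lam / 8 * (x ⬝ᵥ x) ≤ ((V t)ᵀ *ᵥ x) ⬝ᵥ ((V t)ᵀ *ᵥ x) := by
  have hres := frobInner_residual_le D (U t) (V t) (J t) (K t)
  have hres' := frobInner_residual_le Dᵀ (V t) (U t) (K t) (J t)
  rw [blockLoss_transpose] at hres'
  exact ⟨le_transpose_mulVec_of_residual hlam hlo (by linarith)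
      (h.mulVec_dotProduct_self_le_add hinit ht) x,
    le_transpose_mulVec_of_residual (D := Dᵀ) hlam (by rwa [hD]) (by linarith)
      (h.swap.mulVec_dotProduct_self_le_add (by linarith) ht) x⟩

lemma blockLoss_convergenceTime_le [Nonempty ι] (h : IsBlockFlow D U V J K) (hD : Dᵀ = D)
    (hlo : ∀ v, lam * (v ⬝ᵥ v) ≤ v ⬝ᵥ (D *ᵥ v)) (hup : ∀ v, v ⬝ᵥ (D *ᵥ v) ≤ r ^ 2 * (v ⬝ᵥ v))
    (hinit : IsSmallStart lam r N s (U 0) (V 0) (J 0) (K 0)) {L : ℝ}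
    (hloss : blockLoss D (U 0) (V 0) (J 0) (K 0) ≤ L) (hL : lam ^ 2 / 32 ≤ L)
    (hT : convergenceTime lam s L = T) (hNT : r * N * T ≤ 1 / 5) :
    blockLoss D (U T) (V T) (J T) (K T) ≤ lam ^ 2 / 32 := by
  have hs := hinit.scaleSeparation
  have hlam := hs.lam_pos
  have hpos := alignmentTime_pos hinit.s_pos hinit.sq_s_lt
  have hLpos : 0 < L := lt_of_lt_of_le (by positivity) hL
  have hdecay := h.blockLoss_le_mul_exp (c := lam / 8) (by positivity) hpos.le
    ((alignmentTime_le_convergenceTime hlam hL).trans_eq hT)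
    (hinit.frobInner_J_add_K_le.trans (by linarith [hs.sq_N_le]))
    (h.well_conditioned hD hlo hup hinit hNT)
  have hstart := (h.blockLoss_antitoneOn self_mem_Ici hpos.le hpos.le).trans hloss
  rw [← hT, exp_convergenceTime_sub_alignmentTime hlam hLpos, hT] at hdecay
  calc _ ≤ _ := hdecay
    _ ≤ L * (lam ^ 2 / 32 / L) := mul_le_mul_of_nonneg_right hstart (by positivity)
    _ = lam ^ 2 / 32 := by field_simp

theorem blockLoss_le [Nonempty ι] (h : IsBlockFlow D U V J K) (hD : Dᵀ = D)
    (hlo : ∀ v, lam * (v ⬝ᵥ v) ≤ v ⬝ᵥ (D *ᵥ v)) (hup : ∀ v, v ⬝ᵥ (D *ᵥ v) ≤ r ^ 2 * (v ⬝ᵥ v))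
    (hinit : IsSmallStart lam r N s (U 0) (V 0) (J 0) (K 0)) {L : ℝ}
    (hloss : blockLoss D (U 0) (V 0) (J 0) (K 0) ≤ L) (hL : lam ^ 2 / 32 ≤ L)
    (hT : convergenceTime lam s L = T) (hNT : r * N * T ≤ 1 / 5) {t : ℝ} (ht : T ≤ t) :
    blockLoss D (U t) (V t) (J t) (K t) ≤ lam ^ 2 / 32 * Real.exp (-(lam / 8) * (t - T)) := by
  have hs := hinit.scaleSeparation
  have hlam := hs.lam_pos
  have hT₀ : 0 ≤ T := (alignmentTime_pos hinit.s_pos hinit.sq_s_lt).le.trans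
    ((alignmentTime_le_convergenceTime hlam hL).trans_eq hT)
  have hstage := h.blockLoss_convergenceTime_le hD hlo hup hinit hloss hL hT hNT
  refine (h.blockLoss_le_mul_exp (c := lam / 8) (by positivity) hT₀ ht
    (hinit.frobInner_J_add_K_le.trans (by linarith [hs.sq_N_le])) fun τ hτ =>
      h.well_conditioned_of_blockLoss_le hD hlo hlam
        (hinit.norm_le.trans (by linarith [hs.sq_N_le])) (hT₀.trans hτ.1)
        ((h.blockLoss_antitoneOn hT₀ (hT₀.trans hτ.1) hτ.1).trans hstage)).trans ?_
  exact mul_le_mul_of_nonneg_right hstage (Real.exp_nonneg _)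

end IsBlockFlow

end Convergence

section SVD

variable {m n d : ℕ}

lemma singularValues_toEuclideanLin_pos_iff (S : Matrix (Fin m) (Fin n) ℝ) {j : ℕ} :
    0 < (toEuclideanLin S).singularValues j ↔ j < S.rank := by
  rw [LinearMap.singularValues_pos_iff_lt_finrank_range,
    Matrix.rank_eq_finrank_range_toLin S (PiLp.basisFun 2 ℝ _) (PiLp.basisFun 2 ℝ _)]
  rfl

lemma sigma_pos {S : Matrix (Fin m) (Fin n) ℝ} (hd : 0 < d) (hS : S.rank = d) : 0 < sigma S d :=
  (singularValues_toEuclideanLin_pos_iff S).2 (by omega)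

lemma sigma_le_sigma_one (S : Matrix (Fin m) (Fin n) ℝ) (d : ℕ) : sigma S d ≤ sigma S 1 :=
  LinearMap.singularValues_antitone _ (by omega)

lemma inner_eq_dotProduct (x y : EuclideanSpace ℝ (Fin n)) :
    inner ℝ x y = x.ofLp ⬝ᵥ y.ofLp := by
  rw [EuclideanSpace.inner_eq_star_dotProduct, dotProduct_comm, star_trivial]

lemma exists_orthogonal_gram_eq_diagonal (S : Matrix (Fin m) (Fin n) ℝ) :
    ∃ Q : Matrix (Fin n) (Fin n) ℝ, Qᵀ * Q = 1 ∧
      (S * Q)ᵀ * (S * Q) = diagonal fun j : Fin n => (toEuclideanLin S).singularValues j ^ 2 := by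
  have hn : Module.finrank ℝ (EuclideanSpace ℝ (Fin n)) = n := finrank_euclideanSpace_fin
  have hT := (toEuclideanLin S).isSymmetric_adjoint_comp_self
  let b := hT.eigenvectorBasis hn
  have horth := orthonormal_iff_ite.1 b.orthonormal
  have hgram : ∀ i j, inner ℝ (toEuclideanLin S (b i)) (toEuclideanLin S (b j))
      = if i = j then (toEuclideanLin S).singularValues i ^ 2 else 0 := by
    intro i j
    rw [← LinearMap.adjoint_inner_left, ← LinearMap.comp_apply,
      hT.apply_eigenvectorBasis hn i, inner_smul_left, horth i j,
      LinearMap.sq_singularValues_fin _ hn i, mul_ite, mul_one, mul_zero]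
    rfl
  refine ⟨of fun i j => b j i, ?_, ?_⟩
  · ext i j
    rw [one_apply, ← horth i j, inner_eq_dotProduct]
    rfl
  · ext i j
    rw [diagonal_apply, ← hgram i j, inner_eq_dotProduct]
    rfl

lemma mul_diagonal_inv_transpose_mul_self {S : Matrix (Fin m) (Fin d) ℝ} {σ : Fin d → ℝ}
    (hσ : ∀ i, σ i ≠ 0) (hS : Sᵀ * S = diagonal fun i => σ i ^ 2) :
    (S * diagonal fun i => (σ i)⁻¹)ᵀ * (S * diagonal fun i => (σ i)⁻¹) = 1 := by
  rw [transpose_mul, diagonal_transpose, Matrix.mul_assoc, ← Matrix.mul_assoc Sᵀ, hS,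
    diagonal_mul_diagonal, diagonal_mul_diagonal, ← diagonal_one]
  congr 1
  ext i
  have := hσ i
  field_simp

lemma mul_submatrix_mul_transpose {Q : Matrix (Fin n) (Fin n) ℝ} (hQ : Q * Qᵀ = 1)
    (S : Matrix (Fin m) (Fin n) ℝ) {e : Fin d → Fin n} (he : Function.Injective e)
    (hzero : ∀ j ∉ range e, ∀ a, (S * Q) a j = 0) :
    S * Q.submatrix id e * (Q.submatrix id e)ᵀ = S := by
  ext a b
  calc _ = ∑ j, (S * Q) a j * Qᵀ j b :=
        Fintype.sum_of_injective e he _ _ (fun j hj => by rw [hzero j hj, zero_mul]) fun _ => rfl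
    _ = (S * (Q * Qᵀ)) a b := by rw [← Matrix.mul_assoc, Matrix.mul_apply]
    _ = S a b := by rw [hQ, Matrix.mul_one]

theorem exists_thin_svd {S : Matrix (Fin m) (Fin n) ℝ} (hS : S.rank = d) :
    ∃ (Φ : Matrix (Fin m) (Fin d) ℝ) (Ψ : Matrix (Fin n) (Fin d) ℝ) (σ : Fin d → ℝ),
      Φᵀ * Φ = 1 ∧ Ψᵀ * Ψ = 1 ∧ S = Φ * diagonal σ * Ψᵀ ∧
        ∀ i, sigma S d ≤ σ i ∧ σ i ≤ sigma S 1 := by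
  obtain ⟨Q, hQ, hgram⟩ := exists_orthogonal_gram_eq_diagonal S
  let e : Fin d → Fin n := Fin.castLE (hS ▸ S.rank_le_width)
  have he : Function.Injective e := Fin.castLE_injective _
  let σ : Fin d → ℝ := fun i => (toEuclideanLin S).singularValues i
  have hσ : ∀ i, σ i ≠ 0 := fun i =>
    ((singularValues_toEuclideanLin_pos_iff S).2 (hS ▸ i.2)).ne'
  have hzero : ∀ j ∉ range e, ∀ a, (S * Q) a j = 0 := by
    intro j hj a
    have hrank : ¬ (j : ℕ) < S.rank := fun h => hj ⟨⟨j, hS ▸ h⟩, rfl⟩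
    have hτ : (toEuclideanLin S).singularValues j = 0 :=
      ((LinearMap.singularValues_nonneg _ _).eq_or_lt'.resolve_right fun h =>
        hrank ((singularValues_toEuclideanLin_pos_iff S).1 h))
    have hcol := congr_fun₂ hgram j j
    rw [diagonal_apply_eq, hτ, zero_pow two_ne_zero] at hcol
    exact congr_fun (dotProduct_self_eq_zero.1 hcol) a
  refine ⟨S * Q.submatrix id e * diagonal fun i => (σ i)⁻¹, Q.submatrix id e, σ,
    mul_diagonal_inv_transpose_mul_self hσ ?_, ?_, ?_, fun i =>
      ⟨LinearMap.singularValues_antitone _ (by omega), LinearMap.singularValues_antitone _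
        (Nat.zero_le _)⟩⟩
  · have hsub := congr_arg (fun M => M.submatrix e e) hgram
    exact hsub.trans (submatrix_diagonal _ e he)
  · exact (congr_arg (fun M => M.submatrix e e) hQ).trans (submatrix_one e he)
  · rw [Matrix.mul_assoc (S * _), diagonal_mul_diagonal,
      funext fun i => inv_mul_cancel₀ (hσ i), diagonal_one, Matrix.mul_one,
      mul_submatrix_mul_transpose (mul_eq_one_comm.1 hQ) S he hzero]

end SVD

section SingularBasis

lemma frobInner_mul_of_transpose_mul_self_eq_one {α β γ : Type*} [Fintype α] [Fintype β]
    [Fintype γ] [DecidableEq β] {Φ : Matrix α β ℝ} (hΦ : Φᵀ * Φ = 1) (X Y : Matrix β γ ℝ) :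
    frobInner (Φ * X) (Φ * Y) = frobInner X Y := by
  rw [frobInner_mul_left_eq_transpose_mul, ← Matrix.mul_assoc, hΦ, Matrix.one_mul]

lemma IsGradientFlow.isBlockFlow {m n d : ℕ} {Φ : Matrix (Fin m) (Fin d) ℝ}
    {Ψ : Matrix (Fin n) (Fin d) ℝ} {D : Matrix (Fin d) (Fin d) ℝ} (hΦ : Φᵀ * Φ = 1)
    (hΨ : Ψᵀ * Ψ = 1) {U₀ : Matrix (Fin m) (Fin d) ℝ} {V₀ : Matrix (Fin n) (Fin d) ℝ}
    {U : ℝ → Matrix (Fin m) (Fin d) ℝ} {V : ℝ → Matrix (Fin n) (Fin d) ℝ}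
    (h : IsGradientFlow (Φ * D * Ψᵀ) U₀ V₀ U V) :
    IsBlockFlow D (fun t => Φᵀ * U t) (fun t => Ψᵀ * V t) (fun t => U t - Φ * (Φᵀ * U t))
      (fun t => V t - Ψ * (Ψᵀ * V t)) := by
  have hU : ∀ t ∈ Ici (0 : ℝ), HasMatrixDerivWithinAt U ((Φ * D * Ψᵀ - U t * (V t)ᵀ) * V t)
    (Ici 0) t := h.deriv_U
  have hV : ∀ t ∈ Ici (0 : ℝ), HasMatrixDerivWithinAt V ((Φ * D * Ψᵀ - U t * (V t)ᵀ)ᵀ * U t)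
    (Ici 0) t := h.deriv_V
  have hΦX : ∀ X : Matrix (Fin d) (Fin d) ℝ, Φᵀ * (Φ * X) = X := fun X => by
    rw [← Matrix.mul_assoc, hΦ, Matrix.one_mul]
  have hΨX : ∀ X : Matrix (Fin d) (Fin d) ℝ, Ψᵀ * (Ψ * X) = X := fun X => by
    rw [← Matrix.mul_assoc, hΨ, Matrix.one_mul]
  refine ⟨fun t ht => ?_, fun t ht => ?_, fun t ht => ?_, fun t ht => ?_⟩
  · convert (hU t ht).const_mul Φᵀ using 1
    simp only [factorVel, Matrix.mul_sub, Matrix.sub_mul, Matrix.mul_assoc, transpose_sub,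
      transpose_mul, transpose_transpose, hΦX, hΨX]
    abel
  · convert (hV t ht).const_mul Ψᵀ using 1
    simp only [factorVel, Matrix.mul_sub, Matrix.sub_mul, Matrix.mul_assoc, transpose_sub,
      transpose_mul, transpose_transpose, hΦX, hΨX]
    abel
  · convert (hU t ht).sub (((hU t ht).const_mul Φᵀ).const_mul Φ) using 1
    simp only [Matrix.mul_sub, Matrix.sub_mul, Matrix.mul_assoc, transpose_sub, transpose_mul,
      transpose_transpose, hΦX, hΨX, Matrix.mul_add]
    abel
  · convert (hV t ht).sub (((hV t ht).const_mul Ψᵀ).const_mul Ψ) using 1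
    simp only [Matrix.mul_sub, Matrix.sub_mul, Matrix.mul_assoc, transpose_sub, transpose_mul,
      transpose_transpose, hΦX, hΨX, Matrix.mul_add]
    abel

end SingularBasis

section GlobalExistence

variable {E : Type*} [NormedAddCommGroup E]

lemma exists_isIntegralCurveOn_Icc_of_lipschitzWith [NormedSpace ℝ E] [CompleteSpace E]
    {G : E → E} {C : NNReal} (hlip : LipschitzWith C G) {L : ℝ} (hbound : ∀ x, ‖G x‖ ≤ L)
    (x₀ : E) {T : ℝ} (hT : 0 ≤ T) :
    ∃ α : ℝ → E, α 0 = x₀ ∧ IsIntegralCurveOn α (fun _ => G) (Icc 0 T) := by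
  have hL : 0 ≤ L := (norm_nonneg _).trans (hbound x₀)
  refine IsPicardLindelof.exists_eq_forall_mem_Icc_hasDerivWithinAt₀ (t₀ := ⟨0, left_mem_Icc.2 hT⟩)
    (a := (L * T).toNNReal) (L := L.toNNReal) (.of_time_independent
      (fun x _ => (hbound x).trans (Real.le_coe_toNNReal L)) hlip.lipschitzOnWith ?_)
  rw [Real.coe_toNNReal _ hL, Real.coe_toNNReal _ (by positivity), sub_zero, sub_self,
    max_eq_left hT, NNReal.coe_zero, sub_zero]

variable [InnerProductSpace ℝ E]

lemma norm_sq_le_of_isIntegralCurveOn {G : E → E} {c : ℝ} (hgrow : ∀ x, inner ℝ x (G x) ≤ c)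
    {α : ℝ → E} {T : ℝ} (hα : IsIntegralCurveOn α (fun _ => G) (Icc 0 T)) {t : ℝ}
    (ht : t ∈ Icc 0 T) : ‖α t‖ ^ 2 ≤ ‖α 0‖ ^ 2 + 2 * c * t := by
  have hder : ∀ s ∈ Icc 0 t, HasDerivWithinAt (fun s => ‖α s‖ ^ 2 - 2 * c * s)
      (2 * inner ℝ (α s) (G (α s)) - 2 * c * 1) (Icc 0 t) s := fun s hs =>
    (hα.mono (Icc_subset_Icc_right ht.2) s hs).norm_sq.sub
      ((hasDerivWithinAt_id s _).const_mul (2 * c))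
  have hmono := le_of_hasDerivWithinAt_nonpos ht.1 hder fun s _ => by linarith [hgrow (α s)]
  linarith

variable [FiniteDimensional ℝ E]

lemma exists_hasCompactSupport_eq_smul {F : E → E} (hF : ContDiff ℝ 1 F) (ρ : ℝ) :
    ∃ G : E → E, ContDiff ℝ 1 G ∧ HasCompactSupport G ∧ (∀ x, ‖x‖ ≤ ρ → G x = F x) ∧
      ∀ x, ∃ a ∈ Icc (0 : ℝ) 1, G x = a • F x := by
  let χ : ContDiffBump (0 : E) := ⟨max ρ 1, max ρ 1 + 1, by positivity, lt_add_one _⟩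
  refine ⟨fun x => χ x • F x, χ.contDiff.smul hF, χ.hasCompactSupport.smul_right, fun x hx => ?_,
    fun x => ⟨χ x, ⟨χ.nonneg, χ.le_one⟩, rfl⟩⟩
  simp only [χ.one_of_mem_closedBall (mem_closedBall_zero_iff.2 (hx.trans (le_max_left ρ 1))),
    one_smul]

-- The cut-off field inherits the growth condition, so its solution stays where the fields agree.
lemma exists_isIntegralCurveOn_Icc {F : E → E} (hF : ContDiff ℝ 1 F) {c : ℝ}
    (hgrow : ∀ x, inner ℝ x (F x) ≤ c) (x₀ : E) {T : ℝ} (hT : 0 ≤ T) :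
    ∃ α : ℝ → E, α 0 = x₀ ∧ IsIntegralCurveOn α (fun _ => F) (Icc 0 T) := by
  have : CompleteSpace E := FiniteDimensional.complete ℝ E
  have hc : 0 ≤ c := by simpa only [inner_zero_left] using hgrow 0
  obtain ⟨G, hG, hsupp, heq, hsmul⟩ :=
    exists_hasCompactSupport_eq_smul hF √(‖x₀‖ ^ 2 + 2 * c * T)
  have hGgrow : ∀ x, inner ℝ x (G x) ≤ c := fun x => by
    obtain ⟨a, ha, hGx⟩ := hsmul x
    rw [hGx, inner_smul_right]
    calc a * inner ℝ x (F x) ≤ a * c := mul_le_mul_of_nonneg_left (hgrow x) ha.1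
      _ ≤ c := mul_le_of_le_one_left hc ha.2
  obtain ⟨C, hlip⟩ := hG.lipschitzWith_of_hasCompactSupport hsupp one_ne_zero
  obtain ⟨L, hbound⟩ := hG.continuous.bounded_above_of_compact_support hsupp
  obtain ⟨α, hα₀, hα⟩ := exists_isIntegralCurveOn_Icc_of_lipschitzWith hlip hbound x₀ hT
  refine ⟨α, hα₀, fun t ht => ?_⟩
  have hnorm : ‖α t‖ ≤ √(‖x₀‖ ^ 2 + 2 * c * T) := by
    refine Real.le_sqrt_of_sq_le ((norm_sq_le_of_isIntegralCurveOn hGgrow hα ht).trans ?_)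
    rw [hα₀]
    have := ht.2
    gcongr
  change HasDerivWithinAt α (F (α t)) _ t
  rw [← heq _ hnorm]
  exact hα t ht

lemma eqOn_Icc_of_isIntegralCurveOn {F : E → E} (hF : ContDiff ℝ 1 F) {α β : ℝ → E} {T : ℝ}
    (hinit : α 0 = β 0) (hα : IsIntegralCurveOn α (fun _ => F) (Icc 0 T))
    (hβ : IsIntegralCurveOn β (fun _ => F) (Icc 0 T)) : EqOn α β (Icc 0 T) := by
  obtain ⟨A, hA⟩ := isCompact_Icc.exists_bound_of_continuousOn hα.continuousOn
  obtain ⟨B, hB⟩ := isCompact_Icc.exists_bound_of_continuousOn hβ.continuousOn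
  obtain ⟨G, hG, hsupp, heq, -⟩ := exists_hasCompactSupport_eq_smul hF (max A B)
  obtain ⟨C, hlip⟩ := hG.lipschitzWith_of_hasCompactSupport hsupp one_ne_zero
  refine ODE_solution_unique_of_mem_Icc_right (v := fun _ => G) (s := fun _ => univ)
    (fun _ _ => hlip.lipschitzOnWith) hα.continuousOn (fun t ht => ?_) (fun _ _ => mem_univ _)
    hβ.continuousOn (fun t ht => ?_) (fun _ _ => mem_univ _) hinit
  · have htT := Ico_subset_Icc_self ht
    rw [heq _ ((hA t htT).trans (le_max_left A B))]
    exact (hα t htT).mono_of_mem_nhdsWithin (Icc_mem_nhdsGE_of_mem ht)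
  · have htT := Ico_subset_Icc_self ht
    rw [heq _ ((hB t htT).trans (le_max_right A B))]
    exact (hβ t htT).mono_of_mem_nhdsWithin (Icc_mem_nhdsGE_of_mem ht)

theorem exists_isIntegralCurveOn_Ici {F : E → E} (hF : ContDiff ℝ 1 F) {c : ℝ}
    (hgrow : ∀ x, inner ℝ x (F x) ≤ c) (x₀ : E) :
    ∃ α : ℝ → E, α 0 = x₀ ∧ IsIntegralCurveOn α (fun _ => F) (Ici 0) := by
  choose β hβ₀ hβ using fun k : ℕ =>
    exists_isIntegralCurveOn_Icc hF hgrow x₀ (T := k) k.cast_nonneg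
  have hagree : ∀ {t : ℝ} {k : ℕ}, 0 ≤ t → t < k → β (⌊t⌋₊ + 1) t = β k t := fun {t k} ht htk =>
    eqOn_Icc_of_isIntegralCurveOn hF ((hβ₀ _).trans (hβ₀ k).symm)
      ((hβ _).mono (Icc_subset_Icc_right (by exact_mod_cast (Nat.lt_floor_add_one t).le)))
      ((hβ k).mono (Icc_subset_Icc_right htk.le)) (right_mem_Icc.2 ht)
  refine ⟨fun t => β (⌊t⌋₊ + 1) t, hβ₀ _, fun t ht => ?_⟩
  have htk : t < (⌊t⌋₊ + 1 : ℕ) := by exact_mod_cast Nat.lt_floor_add_one t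
  refine ((hβ (⌊t⌋₊ + 1) t ⟨ht, htk.le⟩).mono_of_mem_nhdsWithin ?_).congr_of_eventuallyEq ?_ rfl
  · rw [← Ici_inter_Iic]
    exact inter_mem self_mem_nhdsWithin (mem_nhdsWithin_of_mem_nhds (Iic_mem_nhds htk))
  · filter_upwards [self_mem_nhdsWithin, mem_nhdsWithin_of_mem_nhds (Iio_mem_nhds htk)]
      with s hs hsk
    exact hagree hs hsk

end GlobalExistence

section GradientFlowExistence

variable {m n d : ℕ}

/-- The pair of matrices encoded in a vector of entries. -/
def matrixPair (x : EuclideanSpace ℝ ((Fin m × Fin d) ⊕ (Fin n × Fin d))) :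
    Matrix (Fin m) (Fin d) ℝ × Matrix (Fin n) (Fin d) ℝ :=
  (of fun i k => x (Sum.inl (i, k)), of fun j k => x (Sum.inr (j, k)))

/-- The vector of entries of a pair of matrices, inverse to `matrixPair`. -/
def pairEntries (U : Matrix (Fin m) (Fin d) ℝ) (V : Matrix (Fin n) (Fin d) ℝ) :
    EuclideanSpace ℝ ((Fin m × Fin d) ⊕ (Fin n × Fin d)) :=
  WithLp.toLp 2 (Sum.elim (fun p => U p.1 p.2) fun p => V p.1 p.2)

lemma inner_pairEntries (x : EuclideanSpace ℝ ((Fin m × Fin d) ⊕ (Fin n × Fin d)))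
    (U : Matrix (Fin m) (Fin d) ℝ) (V : Matrix (Fin n) (Fin d) ℝ) :
    inner ℝ x (pairEntries U V)
      = frobInner (matrixPair x).1 U + frobInner (matrixPair x).2 V := by
  rw [EuclideanSpace.inner_eq_star_dotProduct, star_trivial, dotProduct_comm, dotProduct,
    Fintype.sum_sum_type, Fintype.sum_prod_type, Fintype.sum_prod_type]
  rfl

lemma frobInner_gradient_le (S : Matrix (Fin m) (Fin n) ℝ) (U : Matrix (Fin m) (Fin d) ℝ)
    (V : Matrix (Fin n) (Fin d) ℝ) :
    frobInner U ((S - U * Vᵀ) * V) + frobInner V ((S - U * Vᵀ)ᵀ * U)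
      ≤ (1 / 2) * frobInner S S := by
  have hU : frobInner U ((S - U * Vᵀ) * V) = frobInner (U * Vᵀ) (S - U * Vᵀ) := by
    rw [frobInner_comm, frobInner_mul_left_eq_mul_transpose, frobInner_comm]
  have hV : frobInner V ((S - U * Vᵀ)ᵀ * U) = frobInner (U * Vᵀ) (S - U * Vᵀ) := by
    rw [frobInner_comm, frobInner_mul_left_eq_mul_transpose, ← frobInner_transpose,
      transpose_transpose, frobInner_comm, transpose_mul, transpose_transpose]
  have hsq := frobInner_self_nonneg (S - (2 : ℝ) • (U * Vᵀ))
  rw [hU, hV]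
  simp only [frobInner_sub_left, frobInner_sub_right, frobInner_smul_left,
    frobInner_smul_right] at hsq ⊢
  linarith [frobInner_comm S (U * Vᵀ)]

theorem exists_isGradientFlow (S : Matrix (Fin m) (Fin n) ℝ)
    (U₀ : Matrix (Fin m) (Fin d) ℝ) (V₀ : Matrix (Fin n) (Fin d) ℝ) :
    ∃ U V, IsGradientFlow S U₀ V₀ U V := by
  let F : EuclideanSpace ℝ ((Fin m × Fin d) ⊕ (Fin n × Fin d)) →
      EuclideanSpace ℝ ((Fin m × Fin d) ⊕ (Fin n × Fin d)) := fun x =>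
    pairEntries ((S - (matrixPair x).1 * (matrixPair x).2ᵀ) * (matrixPair x).2)
      ((S - (matrixPair x).1 * (matrixPair x).2ᵀ)ᵀ * (matrixPair x).1)
  have hsmooth : ContDiff ℝ 1 F := by
    rw [contDiff_euclidean]
    rintro (⟨i, k⟩ | ⟨j, k⟩)
    · simp only [F, pairEntries, matrixPair, Sum.elim_inl, Matrix.mul_apply, Matrix.sub_apply,
        transpose_apply, of_apply]
      fun_prop
    · simp only [F, pairEntries, matrixPair, Sum.elim_inr, Matrix.mul_apply, Matrix.sub_apply,
        transpose_apply, of_apply]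
      fun_prop
  have hgrow : ∀ x, inner ℝ x (F x) ≤ (1 / 2) * frobInner S S := fun x =>
    (inner_pairEntries x _ _).trans_le (frobInner_gradient_le S _ _)
  obtain ⟨α, hα₀, hα⟩ := exists_isIntegralCurveOn_Ici hsmooth hgrow (pairEntries U₀ V₀)
  have hderiv : ∀ t ∈ Ici (0 : ℝ), ∀ q, HasDerivWithinAt (fun τ => α τ q) (F (α t) q) (Ici 0) t :=
    fun t ht q => (EuclideanSpace.proj (𝕜 := ℝ) q).hasFDerivAt
      |>.comp_hasDerivWithinAt t (hα t ht)
  refine ⟨fun t => (matrixPair (α t)).1, fun t => (matrixPair (α t)).2, ?_, ?_,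
    fun t ht i k => hderiv t ht (Sum.inl (i, k)), fun t ht j k => hderiv t ht (Sum.inr (j, k))⟩
  · rw [hα₀]
    rfl
  · rw [hα₀]
    rfl

end GradientFlowExistence

section Reduction

section Pythagoras

variable {α β γ : Type*} [Fintype α] [Fintype β] [Fintype γ] [DecidableEq β]

lemma frobInner_self_eq_add {Φ : Matrix α β ℝ} (hΦ : Φᵀ * Φ = 1) (X : Matrix α γ ℝ) :
    frobInner X X = frobInner (Φᵀ * X) (Φᵀ * X)
      + frobInner (X - Φ * (Φᵀ * X)) (X - Φ * (Φᵀ * X)) := by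
  have hcross : frobInner X (Φ * (Φᵀ * X)) = frobInner (Φᵀ * X) (Φᵀ * X) := by
    rw [frobInner_comm, frobInner_mul_left_eq_transpose_mul]
  simp only [frobInner_sub_left, frobInner_sub_right]
  rw [frobInner_comm (Φ * (Φᵀ * X)) X, hcross,
    frobInner_mul_of_transpose_mul_self_eq_one hΦ (Φᵀ * X) (Φᵀ * X)]
  ring

lemma frobInner_self_eq_add_right {Ψ : Matrix γ β ℝ} (hΨ : Ψᵀ * Ψ = 1) (X : Matrix α γ ℝ) :
    frobInner X X = frobInner (X * Ψ) (X * Ψ)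
      + frobInner (X - X * Ψ * Ψᵀ) (X - X * Ψ * Ψᵀ) := by
  have h := frobInner_self_eq_add hΨ Xᵀ
  rw [frobInner_transpose] at h
  rw [h, ← frobInner_transpose (X * Ψ), ← frobInner_transpose (X - X * Ψ * Ψᵀ)]
  simp only [transpose_mul, transpose_sub, transpose_transpose]

end Pythagoras

variable {m n d : ℕ} {Φ : Matrix (Fin m) (Fin d) ℝ} {Ψ : Matrix (Fin n) (Fin d) ℝ}

lemma objective_eq_half_frobInner (S : Matrix (Fin m) (Fin n) ℝ) (U : Matrix (Fin m) (Fin d) ℝ)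
    (V : Matrix (Fin n) (Fin d) ℝ) :
    objective S U V = (1 / 2) * frobInner (U * Vᵀ - S) (U * Vᵀ - S) := by
  simp only [objective, frobInner, sq]

lemma objective_eq_blockLoss {D : Matrix (Fin d) (Fin d) ℝ} (hΦ : Φᵀ * Φ = 1) (hΨ : Ψᵀ * Ψ = 1)
    (U : Matrix (Fin m) (Fin d) ℝ) (V : Matrix (Fin n) (Fin d) ℝ) :
    objective (Φ * D * Ψᵀ) U V
      = blockLoss D (Φᵀ * U) (Ψᵀ * V) (U - Φ * (Φᵀ * U)) (V - Ψ * (Ψᵀ * V)) := by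
  have hΦ' : ∀ {γ : Type} (X : Matrix (Fin d) γ ℝ), Φᵀ * (Φ * X) = X := fun X => by
    rw [← Matrix.mul_assoc, hΦ, Matrix.one_mul]
  have hΨ' : ∀ {γ : Type} (X : Matrix (Fin d) γ ℝ), Ψᵀ * (Ψ * X) = X := fun X => by
    rw [← Matrix.mul_assoc, hΨ, Matrix.one_mul]
  rw [objective_eq_half_frobInner, blockLoss]
  set Z := U * Vᵀ - Φ * D * Ψᵀ with hZ
  rw [frobInner_self_eq_add hΦ Z, frobInner_self_eq_add_right hΨ (Φᵀ * Z),
    frobInner_self_eq_add_right hΨ (Z - Φ * (Φᵀ * Z))]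
  have hdiag : Φᵀ * Z * Ψ = -(D - Φᵀ * U * (Ψᵀ * V)ᵀ) := by
    simp only [hZ, Matrix.mul_sub, Matrix.sub_mul, Matrix.mul_assoc, transpose_mul,
      transpose_transpose, hΦ', hΨ, Matrix.mul_one, neg_sub]
  have hupper : Φᵀ * Z - Φᵀ * Z * Ψ * Ψᵀ = Φᵀ * U * (V - Ψ * (Ψᵀ * V))ᵀ := by
    simp only [hZ, Matrix.mul_sub, Matrix.sub_mul, Matrix.mul_assoc, transpose_mul, transpose_sub,
      transpose_transpose, hΦ', hΨ', sub_sub_sub_cancel_right]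
  have hlower : (Z - Φ * (Φᵀ * Z)) * Ψ = (U - Φ * (Φᵀ * U)) * (Ψᵀ * V)ᵀ := by
    simp only [hZ, Matrix.mul_sub, Matrix.sub_mul, Matrix.mul_assoc, transpose_mul,
      transpose_transpose, hΦ', sub_sub_sub_cancel_right]
  have hcorner : Z - Φ * (Φᵀ * Z) - (Z - Φ * (Φᵀ * Z)) * Ψ * Ψᵀ
      = (U - Φ * (Φᵀ * U)) * (V - Ψ * (Ψᵀ * V))ᵀ := by
    simp only [hZ, Matrix.mul_sub, Matrix.sub_mul, Matrix.mul_assoc, transpose_mul, transpose_sub,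
      transpose_transpose, hΦ', sub_sub_sub_cancel_right]
  rw [hupper, hdiag, hcorner, hlower, frobInner_neg_left, frobInner_neg_right]
  ring

lemma frobInner_diagonal_self (σ : Fin d → ℝ) :
    frobInner (diagonal σ) (diagonal σ) = ∑ i, σ i ^ 2 := by
  rw [frobInner_eq_trace, diagonal_transpose, diagonal_mul_diagonal, trace_diagonal]
  simp only [sq]

lemma frobInner_self_le_of_thin_svd {σ : Fin d → ℝ} (hΦ : Φᵀ * Φ = 1) (hΨ : Ψᵀ * Ψ = 1) {Λ : ℝ}
    (hσ : ∀ i, σ i ^ 2 ≤ Λ ^ 2) :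
    frobInner (Φ * diagonal σ * Ψᵀ) (Φ * diagonal σ * Ψᵀ) ≤ d * Λ ^ 2 := by
  rw [Matrix.mul_assoc, frobInner_mul_of_transpose_mul_self_eq_one hΦ, ← frobInner_transpose,
    transpose_mul, transpose_transpose, frobInner_mul_of_transpose_mul_self_eq_one hΨ,
    frobInner_transpose, frobInner_diagonal_self]
  simpa using Finset.sum_le_sum fun i (_ : i ∈ Finset.univ) => hσ i

lemma objective_le_add (S : Matrix (Fin m) (Fin n) ℝ) (U : Matrix (Fin m) (Fin d) ℝ)
    (V : Matrix (Fin n) (Fin d) ℝ) :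
    objective S U V ≤ frobInner S S + frobInner U U * frobInner V V := by
  have hprod := frobInner_mul_self_le U Vᵀ
  have hsq := frobInner_self_nonneg (U * Vᵀ + S)
  rw [frobInner_transpose] at hprod
  rw [objective_eq_half_frobInner]
  simp only [frobInner_add_left, frobInner_add_right, frobInner_sub_left,
    frobInner_sub_right] at hsq ⊢
  linarith

lemma objective_le_of_isSmallStart {σ : Fin d → ℝ} (hΦ : Φᵀ * Φ = 1) (hΨ : Ψᵀ * Ψ = 1)
    (hd : 0 < d) {lam r N s : ℝ} (hσ : ∀ i, 0 ≤ σ i ∧ σ i ≤ r ^ 2)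
    {U : Matrix (Fin m) (Fin d) ℝ} {V : Matrix (Fin n) (Fin d) ℝ}
    (hinit : IsSmallStart lam r N s (Φᵀ * U) (Ψᵀ * V) (U - Φ * (Φᵀ * U)) (V - Ψ * (Ψᵀ * V))) :
    objective (Φ * diagonal σ * Ψᵀ) U V ≤ 2 * d * (r ^ 2) ^ 2 := by
  have hd₁ : (1 : ℝ) ≤ d := by exact_mod_cast hd
  have hN := hinit.norm_le
  have hscale := hinit.scaleSeparation
  have hNr : N ^ 2 ≤ r ^ 2 := by
    linarith [hscale.sq_N_le, hscale.lam_pos, hscale.lam_le]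
  have hU := frobInner_self_eq_add hΦ U
  have hV := frobInner_self_eq_add hΨ V
  have hUV : frobInner U U * frobInner V V ≤ r ^ 2 * r ^ 2 :=
    mul_le_mul (by linarith [frobInner_self_nonneg V]) (by linarith [frobInner_self_nonneg U])
      (frobInner_self_nonneg V) (sq_nonneg r)
  have hS := frobInner_self_le_of_thin_svd hΦ hΨ
    (fun i => pow_le_pow_left₀ (hσ i).1 (hσ i).2 2)
  nlinarith [objective_le_add (Φ * diagonal σ * Ψᵀ) U V, sq_nonneg (r ^ 2)]

lemma dotProduct_diagonal_mulVec (σ v : Fin d → ℝ) :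
    v ⬝ᵥ (diagonal σ *ᵥ v) = ∑ i, σ i * (v i * v i) := by
  simp only [dotProduct, mulVec_diagonal]
  exact Finset.sum_congr rfl fun i _ => by ring

lemma exp_le_div_of_posLog_le {lam δ t : ℝ} (hlam : 0 < lam) (hδ : 0 < δ)
    (ht : 8 / lam * Real.posLog (lam ^ 2 / δ) ≤ t) : Real.exp (-(lam / 8) * t) ≤ δ / lam ^ 2 := by
  have hlog : Real.log (lam ^ 2 / δ) ≤ lam / 8 * t :=
    calc Real.log (lam ^ 2 / δ) ≤ Real.posLog (lam ^ 2 / δ) := le_max_right _ _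
      _ = lam / 8 * (8 / lam * Real.posLog (lam ^ 2 / δ)) := by field_simp
      _ ≤ lam / 8 * t := by gcongr
  calc Real.exp (-(lam / 8) * t) ≤ Real.exp (-Real.log (lam ^ 2 / δ)) :=
        Real.exp_le_exp.2 (by linarith)
    _ = δ / lam ^ 2 := by rw [Real.exp_neg, Real.exp_log (by positivity), inv_div]

theorem reachesBy_of_isSmallStart {σ : Fin d → ℝ} (hΦ : Φᵀ * Φ = 1) (hΨ : Ψᵀ * Ψ = 1) (hd : 0 < d)
    {lam r N s δ T : ℝ} (hσ : ∀ i, lam ≤ σ i ∧ σ i ≤ r ^ 2) (hδ : 0 < δ)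
    (hT : convergenceTime lam s (2 * d * (r ^ 2) ^ 2) = T) (hNT : r * N * T ≤ 1 / 5)
    {U₀ : Matrix (Fin m) (Fin d) ℝ} {V₀ : Matrix (Fin n) (Fin d) ℝ}
    (hinit : IsSmallStart lam r N s (Φᵀ * U₀) (Ψᵀ * V₀) (U₀ - Φ * (Φᵀ * U₀)) (V₀ - Ψ * (Ψᵀ * V₀))) :
    ReachesBy (Φ * diagonal σ * Ψᵀ) δ (T + 8 / lam * Real.posLog (lam ^ 2 / δ)) U₀ V₀ := by
  refine ⟨exists_isGradientFlow _ U₀ V₀, fun U V hflow t ht => ?_⟩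
  have : Nonempty (Fin d) := ⟨⟨0, hd⟩⟩
  have hscale := hinit.scaleSeparation
  have hlam := hscale.lam_pos
  have hL : lam ^ 2 / 32 ≤ 2 * d * (r ^ 2) ^ 2 := by
    have hd₁ : (1 : ℝ) ≤ d := by exact_mod_cast hd
    have := pow_le_pow_left₀ hlam.le hscale.lam_le 2
    nlinarith
  have hloss : objective (Φ * diagonal σ * Ψᵀ) U₀ V₀ ≤ 2 * d * (r ^ 2) ^ 2 :=
    objective_le_of_isSmallStart hΦ hΨ hd (fun i => ⟨hlam.le.trans (hσ i).1, (hσ i).2⟩) hinit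
  have hdecay := (hflow.isBlockFlow hΦ hΨ).blockLoss_le (lam := lam) (r := r) (N := N) (s := s)
    (diagonal_transpose σ)
    (fun v => by
      rw [dotProduct_diagonal_mulVec, dotProduct, Finset.mul_sum]
      gcongr with i
      exacts [mul_self_nonneg _, (hσ i).1])
    (fun v => by
      rw [dotProduct_diagonal_mulVec, dotProduct, Finset.mul_sum]
      gcongr with i
      exacts [mul_self_nonneg _, (hσ i).2])
    (by rwa [hflow.init_U, hflow.init_V])
    (by rwa [← objective_eq_blockLoss hΦ hΨ, hflow.init_U, hflow.init_V]) hL hT hNT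
    (t := t) ((le_add_of_nonneg_right (mul_nonneg (by positivity) Real.posLog_nonneg)).trans ht)
  rw [objective_eq_blockLoss hΦ hΨ]
  calc _ ≤ lam ^ 2 / 32 * Real.exp (-(lam / 8) * (t - T)) := hdecay
    _ ≤ lam ^ 2 / 32 * (δ / lam ^ 2) := by
        gcongr
        exact exp_le_div_of_posLog_le hlam hδ (by linarith)
    _ = δ / 32 := by field_simp
    _ ≤ δ := by linarith

end Reduction

section Gaussian

open scoped NNReal ENNReal

/-- The law of a vector of independent centered Gaussians of variance `v`. -/
def gaussianVec (ι : Type*) [Fintype ι] (v : ℝ≥0) : Measure (ι → ℝ) :=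
  Measure.pi fun _ => gaussianReal 0 v

instance (ι : Type*) [Fintype ι] (v : ℝ≥0) : IsProbabilityMeasure (gaussianVec ι v) := by
  unfold gaussianVec
  infer_instance

instance (m d : ℕ) (ε : ℝ) : IsProbabilityMeasure (gaussianEntries m d ε) := by
  unfold gaussianEntries
  infer_instance

instance (m n d : ℕ) (ε : ℝ) : IsProbabilityMeasure (initLaw m n d ε) := by
  unfold initLaw
  infer_instance

lemma gaussianEntries_eq (m d : ℕ) (ε : ℝ) :
    gaussianEntries m d ε = Measure.pi fun _ => gaussianVec (Fin d) (ε ^ 2).toNNReal := rfl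

section CharacteristicFunctions

lemma charFunDual_gaussianReal (v : ℝ≥0) (L : StrongDual ℝ ℝ) :
    charFunDual (gaussianReal 0 v) L = Complex.exp (-((v / 2 * L 1 ^ 2 : ℝ) : ℂ)) := by
  have hL : (L : ℝ → ℝ) = fun x => L 1 * x := by
    ext x
    rw [mul_comm, ← smul_eq_mul, ← map_smul, smul_eq_mul, mul_one]
  rw [charFunDual_eq_charFun_map_one, hL, gaussianReal_map_const_mul, charFun_gaussianReal]
  congr 1
  push_cast
  simp only [mul_zero, zero_mul, zero_sub, one_pow, mul_one]
  ring

variable {ι : Type*} [Fintype ι]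

lemma charFunDual_gaussianVec [DecidableEq ι] (v : ℝ≥0) (L : StrongDual ℝ (ι → ℝ)) :
    charFunDual (gaussianVec ι v) L
      = Complex.exp (-((v / 2 * ∑ k, L (Pi.single k 1) ^ 2 : ℝ) : ℂ)) := by
  simp only [gaussianVec, charFunDual_pi, charFunDual_gaussianReal]
  rw [← Complex.exp_sum, Finset.sum_neg_distrib, ← Complex.ofReal_sum, ← Finset.mul_sum]
  rfl

lemma charFunDual_gaussianEntries (m d : ℕ) (ε : ℝ) (L : StrongDual ℝ (Fin m → Fin d → ℝ)) :
    charFunDual (gaussianEntries m d ε) L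
      = Complex.exp (-((ε ^ 2 / 2 * ∑ i, ∑ k, L (Pi.single i (Pi.single k 1)) ^ 2 : ℝ) : ℂ)) := by
  simp only [gaussianEntries_eq, charFunDual_pi, charFunDual_gaussianVec]
  rw [← Complex.exp_sum, Finset.sum_neg_distrib, ← Complex.ofReal_sum, ← Finset.mul_sum,
    Real.coe_toNNReal _ (sq_nonneg ε)]
  rfl

lemma map_dotProduct_gaussianVec (v : ℝ≥0) (a : ι → ℝ) :
    (gaussianVec ι v).map (· ⬝ᵥ a) = gaussianReal 0 (v * (a ⬝ᵥ a).toNNReal) := by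
  classical
  let L : StrongDual ℝ (ι → ℝ) := LinearMap.toContinuousLinearMap
    { toFun := (· ⬝ᵥ a)
      map_add' := fun x y => add_dotProduct x y a
      map_smul' := fun c x => smul_dotProduct c x a }
  change (gaussianVec ι v).map L = _
  have := Measure.isProbabilityMeasure_map (μ := gaussianVec ι v)
    L.continuous.measurable.aemeasurable
  refine Measure.ext_of_charFun (funext fun t => ?_)
  have hsum : ∑ k, (t • L) (Pi.single k 1) ^ 2 = t ^ 2 * (a ⬝ᵥ a) := by
    rw [dotProduct, Finset.mul_sum]
    refine Finset.sum_congr rfl fun k _ => ?_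
    change (t * (Pi.single k 1 ⬝ᵥ a)) ^ 2 = _
    rw [single_one_dotProduct]
    ring
  rw [charFun_map_eq_charFunDual_smul, charFunDual_gaussianVec, charFun_gaussianReal, hsum]
  congr 1
  push_cast
  rw [Real.coe_toNNReal _ (dotProduct_self_nonneg a)]
  ring

end CharacteristicFunctions

section Rotation

/-- Left multiplication by `Φᵀ`, as a map on the arrays of entries on which `gaussianEntries` is
defined. -/
def mulTransposeCLM {m d l : ℕ} (Φ : Matrix (Fin m) (Fin l) ℝ) :
    (Fin m → Fin d → ℝ) →L[ℝ] (Fin l → Fin d → ℝ) :=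
  LinearMap.toContinuousLinearMap
    { toFun := fun U => Φᵀ * of U
      map_add' := fun U V => Matrix.mul_add Φᵀ (of U) (of V)
      map_smul' := fun c U => Matrix.mul_smul Φᵀ c (of U) }

lemma mulTransposeCLM_apply {m d l : ℕ} (Φ : Matrix (Fin m) (Fin l) ℝ) (U : Fin m → Fin d → ℝ) :
    mulTransposeCLM Φ U = Φᵀ * of U := rfl

lemma mulTransposeCLM_single {m d l : ℕ} (Φ : Matrix (Fin m) (Fin l) ℝ) (i : Fin m) (k : Fin d) :
    mulTransposeCLM Φ (Pi.single i (Pi.single k 1))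
      = ∑ j, Φ i j • (Pi.single j (Pi.single k 1) : Fin l → Fin d → ℝ) := by
  rw [mulTransposeCLM_apply]
  ext j k'
  rw [Matrix.mul_apply, Finset.sum_apply, Finset.sum_apply,
    Finset.sum_eq_single i (fun b _ hb => by simp [Pi.single_eq_of_ne hb]) (by simp),
    Finset.sum_eq_single j (fun b _ hb => by simp [Pi.single_eq_of_ne' hb]) (by simp)]
  simp

lemma sum_sq_comp_mulTransposeCLM {m d l : ℕ} {Φ : Matrix (Fin m) (Fin l) ℝ} (hΦ : Φᵀ * Φ = 1)
    (L : StrongDual ℝ (Fin l → Fin d → ℝ)) :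
    ∑ i, ∑ k, (L.comp (mulTransposeCLM Φ)) (Pi.single i (Pi.single k 1)) ^ 2
      = ∑ j, ∑ k, L (Pi.single j (Pi.single k 1)) ^ 2 := by
  let X : Matrix (Fin l) (Fin d) ℝ := of fun j k => L (Pi.single j (Pi.single k 1))
  have hcomp : ∀ i k, (L.comp (mulTransposeCLM Φ)) (Pi.single i (Pi.single k 1)) = (Φ * X) i k :=
    fun i k => by
      rw [ContinuousLinearMap.comp_apply, mulTransposeCLM_single, map_sum, Matrix.mul_apply]
      simp only [map_smul, smul_eq_mul, X, of_apply]
  have hnorm := frobInner_mul_of_transpose_mul_self_eq_one hΦ X X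
  simp only [frobInner, ← sq] at hnorm
  simp only [hcomp]
  exact hnorm

theorem map_mulTransposeCLM_gaussianEntries {m d l : ℕ} {Φ : Matrix (Fin m) (Fin l) ℝ}
    (hΦ : Φᵀ * Φ = 1) (ε : ℝ) :
    (gaussianEntries m d ε).map (mulTransposeCLM Φ) = gaussianEntries l d ε := by
  have := Measure.isProbabilityMeasure_map (μ := gaussianEntries m d ε)
    (mulTransposeCLM Φ).continuous.measurable.aemeasurable
  refine Measure.ext_of_charFunDual (funext fun L => ?_)
  rw [charFunDual_map, charFunDual_gaussianEntries, charFunDual_gaussianEntries,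
    sum_sq_comp_mulTransposeCLM hΦ]

theorem map_add_initLaw {m n d : ℕ} {Φ : Matrix (Fin m) (Fin d) ℝ} {Ψ : Matrix (Fin n) (Fin d) ℝ}
    (hΦ : Φᵀ * Φ = 1) (hΨ : Ψᵀ * Ψ = 1) (ε : ℝ) :
    (initLaw m n d ε).map ((mulTransposeCLM Φ).coprod (mulTransposeCLM Ψ))
      = gaussianEntries d d (√2 * ε) := by
  have := Measure.isProbabilityMeasure_map (μ := initLaw m n d ε)
    ((mulTransposeCLM Φ).coprod (mulTransposeCLM (d := d) Ψ)).continuous.measurable.aemeasurable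
  refine Measure.ext_of_charFunDual (funext fun L => ?_)
  rw [initLaw, charFunDual_map, charFunDual_prod, ContinuousLinearMap.comp_assoc,
    ContinuousLinearMap.comp_assoc, ContinuousLinearMap.coprod_comp_inl,
    ContinuousLinearMap.coprod_comp_inr, charFunDual_gaussianEntries, charFunDual_gaussianEntries,
    charFunDual_gaussianEntries, sum_sq_comp_mulTransposeCLM hΦ, sum_sq_comp_mulTransposeCLM hΨ,
    ← Complex.exp_add, mul_pow, Real.sq_sqrt zero_le_two]
  congr 1
  push_cast
  ring

end Rotation

section AntiConcentration

lemma gaussianPDF_zero_le {v : ℝ≥0} {ε : ℝ} (hε : 0 < ε) (hv : (v : ℝ) = ε ^ 2) (x : ℝ) :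
    gaussianPDF 0 v x ≤ ENNReal.ofReal (1 / (2 * ε)) := by
  refine ENNReal.ofReal_le_ofReal ?_
  have hsqrt : 2 * ε ≤ √(2 * Real.pi * v) := by
    refine Real.le_sqrt_of_sq_le ?_
    rw [hv]
    nlinarith [Real.pi_gt_three, pow_pos hε 2]
  have hexp : Real.exp (-(x - 0) ^ 2 / (2 * v)) ≤ 1 :=
    Real.exp_le_one_iff.2 (div_nonpos_of_nonpos_of_nonneg (neg_nonpos.2 (sq_nonneg _))
      (by positivity))
  calc gaussianPDFReal 0 v x ≤ (2 * ε)⁻¹ * 1 := by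
        unfold gaussianPDFReal
        gcongr
    _ = 1 / (2 * ε) := by rw [mul_one, one_div]

lemma gaussianReal_Icc_le {v : ℝ≥0} {b ε : ℝ} (hε : 0 < ε) (hv : (v : ℝ) = ε ^ 2) :
    gaussianReal 0 v (Icc (-b) b) ≤ ENNReal.ofReal (b / ε) := by
  have hv₀ : v ≠ 0 := fun h => (pow_pos hε 2).ne (by rw [← hv, h, NNReal.coe_zero])
  rw [gaussianReal_apply _ hv₀]
  calc ∫⁻ x in Icc (-b) b, gaussianPDF 0 v x
      ≤ ∫⁻ _ in Icc (-b) b, ENNReal.ofReal (1 / (2 * ε)) :=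
        lintegral_mono (gaussianPDF_zero_le hε hv)
    _ = ENNReal.ofReal (b / ε) := by
      rw [setLIntegral_const, Real.volume_Icc, ← ENNReal.ofReal_mul (by positivity)]
      congr 1
      field_simp
      ring

lemma gaussianVec_abs_dotProduct_le {ι : Type*} [Fintype ι] {v : ℝ≥0} {ε : ℝ} (hε : 0 < ε)
    (hv : (v : ℝ) = ε ^ 2) {a : ι → ℝ} (ha : a ⬝ᵥ a = 1) (b : ℝ) :
    gaussianVec ι v {x | |x ⬝ᵥ a| ≤ b} ≤ ENNReal.ofReal (b / ε) := by
  have hmap := map_dotProduct_gaussianVec v a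
  rw [ha, Real.toNNReal_one, mul_one] at hmap
  have hIcc := gaussianReal_Icc_le (b := b) hε hv
  rw [← hmap, Measure.map_apply (by unfold dotProduct; fun_prop) measurableSet_Icc] at hIcc
  exact (measure_mono fun x hx => abs_le.1 hx).trans hIcc

end AntiConcentration

section SecondMoment

lemma lintegral_sq_gaussianReal (v : ℝ≥0) :
    ∫⁻ x, ENNReal.ofReal (x ^ 2) ∂(gaussianReal 0 v) = v := by
  have hvar := evariance_eq_lintegral_ofReal (X := id) (μ := gaussianReal 0 v)
  rw [← IsGaussian.memLp_two_id.ofReal_variance_eq, variance_id_gaussianReal] at hvar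
  simpa only [id_eq, integral_id_gaussianReal, sub_zero, ENNReal.ofReal_coe_nnreal] using hvar.symm

lemma lintegral_dotProduct_self_gaussianVec (d : ℕ) (v : ℝ≥0) :
    ∫⁻ x, ENNReal.ofReal (x ⬝ᵥ x) ∂(gaussianVec (Fin d) v) = d * v := by
  have hsum : ∀ x : Fin d → ℝ, ENNReal.ofReal (x ⬝ᵥ x) = ∑ i, ENNReal.ofReal (x i ^ 2) := by
    intro x
    rw [← ENNReal.ofReal_sum_of_nonneg fun i _ => sq_nonneg _]
    simp only [dotProduct, sq]
  have hcoord : ∀ i, ∫⁻ x, ENNReal.ofReal (x i ^ 2) ∂(gaussianVec (Fin d) v) = v := fun i => by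
    rw [← lintegral_sq_gaussianReal v]
    exact (measurePreserving_eval (fun _ : Fin d => gaussianReal 0 v) i).lintegral_comp
      (f := fun y => ENNReal.ofReal (y ^ 2)) (by fun_prop)
  simp only [hsum]
  rw [lintegral_finsetSum _ fun i _ => by fun_prop]
  simp only [hcoord, Finset.sum_const, Finset.card_univ, Fintype.card_fin, nsmul_eq_mul]

lemma lintegral_frobInner_self_gaussianEntries (m d : ℕ) (ε : ℝ) :
    ∫⁻ U, ENNReal.ofReal (frobInner (of U) (of U)) ∂(gaussianEntries m d ε)
      = ENNReal.ofReal (m * d * ε ^ 2) := by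
  have hsum : ∀ U : Fin m → Fin d → ℝ, ENNReal.ofReal (frobInner (of U) (of U))
      = ∑ i, ENNReal.ofReal (U i ⬝ᵥ U i) := fun U =>
    ENNReal.ofReal_sum_of_nonneg fun i _ => dotProduct_self_nonneg (U i)
  have hrow : ∀ i, ∫⁻ U, ENNReal.ofReal (U i ⬝ᵥ U i) ∂(gaussianEntries m d ε)
      = d * ((ε ^ 2).toNNReal : ℝ≥0∞) := fun i => by
    rw [← lintegral_dotProduct_self_gaussianVec]
    exact (measurePreserving_eval (fun _ : Fin m => gaussianVec (Fin d) (ε ^ 2).toNNReal)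
      i).lintegral_comp (f := fun y => ENNReal.ofReal (y ⬝ᵥ y)) (by unfold dotProduct; fun_prop)
  simp only [hsum]
  rw [lintegral_finsetSum _ fun i _ => by unfold dotProduct; fun_prop]
  simp only [hrow, Finset.sum_const, Finset.card_univ, Fintype.card_fin, nsmul_eq_mul]
  rw [ENNReal.ofReal_mul (by positivity), ENNReal.ofReal_mul (by positivity), mul_assoc,
    ENNReal.ofReal_natCast, ENNReal.ofReal_natCast]
  rfl

lemma measurable_ofReal_frobInner_self (m d : ℕ) :
    Measurable fun U : Fin m → Fin d → ℝ => ENNReal.ofReal (frobInner (of U) (of U)) := by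
  simp only [frobInner, of_apply]
  fun_prop

lemma lintegral_frobInner_self_initLaw (m n d : ℕ) (ε : ℝ) :
    ∫⁻ z, ENNReal.ofReal (frobInner (of z.1) (of z.1) + frobInner (of z.2) (of z.2))
        ∂(initLaw m n d ε)
      = ENNReal.ofReal ((m + n) * d * ε ^ 2) := by
  have hfst := measurable_ofReal_frobInner_self m d
  have hsnd := measurable_ofReal_frobInner_self n d
  simp only [ENNReal.ofReal_add (frobInner_self_nonneg _) (frobInner_self_nonneg _)]
  refine (lintegral_add_left (hfst.comp measurable_fst) _).trans ?_
  simp only [Function.comp_def]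
  rw [initLaw, measurePreserving_fst.lintegral_comp hfst, measurePreserving_snd.lintegral_comp hsnd,
    lintegral_frobInner_self_gaussianEntries, lintegral_frobInner_self_gaussianEntries,
    ← ENNReal.ofReal_add (by positivity) (by positivity)]
  congr 1
  ring

theorem initLaw_norm_gt_le {m n d : ℕ} {ε N p : ℝ} (hN : 0 < N)
    (h : (m + n) * d * ε ^ 2 ≤ p * N ^ 2) :
    initLaw m n d ε {z | N ^ 2 < frobInner (of z.1) (of z.1) + frobInner (of z.2) (of z.2)}
      ≤ ENNReal.ofReal p := by
  have hmeas : Measurable fun z : (Fin m → Fin d → ℝ) × (Fin n → Fin d → ℝ) =>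
      ENNReal.ofReal (frobInner (of z.1) (of z.1) + frobInner (of z.2) (of z.2)) := by
    simp only [frobInner, of_apply]
    fun_prop
  have hN₂ : 0 < N ^ 2 := by positivity
  calc _ ≤ _ := measure_mono fun z hz => ENNReal.ofReal_le_ofReal (le_of_lt hz)
    _ ≤ _ := meas_ge_le_lintegral_div hmeas.aemeasurable (ENNReal.ofReal_pos.2 hN₂).ne'
          ENNReal.ofReal_ne_top
    _ ≤ ENNReal.ofReal p := by
        rw [lintegral_frobInner_self_initLaw, ← ENNReal.ofReal_div_of_pos hN₂]
        exact ENNReal.ofReal_le_ofReal ((div_le_iff₀ hN₂).2 h)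

end SecondMoment

end Gaussian

section SmallestSingularValue

open scoped NNReal ENNReal

section Householder

variable {ι : Type*} [Fintype ι] [DecidableEq ι]

/-- The reflection in the hyperplane orthogonal to `u`, which is the identity for `u = 0` because
of `2 / 0 = 0`. -/
def householder (u : ι → ℝ) : Matrix ι ι ℝ :=
  1 - (2 / (u ⬝ᵥ u)) • vecMulVec u u

lemma householder_transpose (u : ι → ℝ) : (householder u)ᵀ = householder u := by
  rw [householder, transpose_sub, transpose_one, transpose_smul, transpose_vecMulVec]

lemma householder_mul_self (u : ι → ℝ) : householder u * householder u = 1 := by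
  have hc : 2 / (u ⬝ᵥ u) * (2 / (u ⬝ᵥ u)) * (u ⬝ᵥ u) = 2 / (u ⬝ᵥ u) + 2 / (u ⬝ᵥ u) := by
    rcases eq_or_ne (u ⬝ᵥ u) 0 with hu | hu
    · simp [hu]
    · field_simp
      norm_num
  rw [householder, Matrix.sub_mul, Matrix.mul_sub, Matrix.mul_sub, Matrix.one_mul, Matrix.mul_one,
    Matrix.one_mul, Matrix.smul_mul, Matrix.mul_smul, vecMulVec_mul_vecMulVec, vecMulVec_smul,
    smul_smul, smul_smul, hc, add_smul]
  abel

lemma householder_sub_mulVec {x y : ι → ℝ} (h : x ⬝ᵥ x = y ⬝ᵥ y) :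
    householder (x - y) *ᵥ x = y := by
  have hnorm : (x - y) ⬝ᵥ (x - y) = 2 * ((x - y) ⬝ᵥ x) := by
    simp only [sub_dotProduct, dotProduct_sub, h, dotProduct_comm y x]
    ring
  rw [householder, Matrix.sub_mulVec, Matrix.one_mulVec, Matrix.smul_mulVec, vecMulVec_mulVec,
    op_smul_eq_smul, smul_smul]
  rcases eq_or_ne ((x - y) ⬝ᵥ (x - y)) 0 with h0 | h0
  · rw [dotProduct_self_eq_zero.1 h0, smul_zero, sub_zero, ← sub_eq_zero,
      dotProduct_self_eq_zero.1 h0]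
  · have hc : 2 / ((x - y) ⬝ᵥ (x - y)) * ((x - y) ⬝ᵥ x) = 1 := by
      rw [div_mul_eq_mul_div, ← hnorm, div_self h0]
    rw [hc, one_smul, sub_sub_cancel]

end Householder

section Preimages

variable {ι κ : Type*} [Fintype ι] [Fintype κ]

/-- The pairs `(G, g)` for which no vector of norm at most `ρ` is mapped to `g` by `G`. Its
probability controls the smallest singular value of a random `G`. -/
def noShortPreimage (ι : Type*) [Fintype ι] (ρ : ℝ) : Set ((ι → ι → ℝ) × (ι → ℝ)) :=
  {z | ∀ w : ι → ℝ, w ⬝ᵥ w ≤ ρ ^ 2 → of z.1 *ᵥ w ≠ z.2}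

lemma isOpen_noShortPreimage (ρ : ℝ) : IsOpen (noShortPreimage ι ρ) := by
  rw [isOpen_iff_eventually]
  intro z hz
  refine (isCompact_dotProduct_self_le (ρ ^ 2)).eventually_forall_of_forall_eventually
    (P := fun (z : (ι → ι → ℝ) × (ι → ℝ)) w => of z.1 *ᵥ w ≠ z.2) fun w hw => ?_
  have hcont : Continuous fun q : ((ι → ι → ℝ) × (ι → ℝ)) × (ι → ℝ) => of q.1.1 *ᵥ q.2 := by
    refine continuous_pi fun i => ?_
    simp only [mulVec, dotProduct, of_apply]
    fun_prop
  exact (isOpen_ne_fun hcont (by fun_prop)).mem_nhds (hz w hw)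

lemma measurableSet_noShortPreimage_section (ρ : ℝ) (g : ι → ℝ) :
    MeasurableSet {G | (G, g) ∈ noShortPreimage ι ρ} :=
  ((isOpen_noShortPreimage ρ).preimage (by fun_prop)).measurableSet

lemma exists_unit_mulVec_eq_zero (R : Matrix κ ι ℝ) (h : Fintype.card κ < Fintype.card ι) :
    ∃ w : ι → ℝ, w ⬝ᵥ w = 1 ∧ R *ᵥ w = 0 := by
  have hker : LinearMap.ker R.mulVecLin ≠ ⊥ := LinearMap.ker_ne_bot_of_finrank_lt (by simpa using h)
  obtain ⟨w, hw : R *ᵥ w = 0, hw₀⟩ := (Submodule.ne_bot_iff _).1 hker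
  exact ⟨_, inv_sqrt_smul_dotProduct_self hw₀, by rw [Matrix.mulVec_smul, hw, smul_zero]⟩

lemma abs_dotProduct_le_of_mem_noShortPreimage [DecidableEq ι] {ρ a : ℝ} (hρ : 0 < ρ) (ha : 0 ≤ a)
    {G : ι → ι → ℝ} {i : ι} {w : ι → ℝ} (hw : w ⬝ᵥ w = 1) (hrow : ∀ j ≠ i, G j ⬝ᵥ w = 0)
    (hG : (G, Pi.single i a) ∈ noShortPreimage ι ρ) : |G i ⬝ᵥ w| ≤ a / ρ := by
  by_contra! hlt
  have hpos : 0 < |G i ⬝ᵥ w| := (div_nonneg ha hρ.le).trans_lt hlt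
  refine hG ((a / (G i ⬝ᵥ w)) • w) ?_ ?_
  · rw [smul_dotProduct, dotProduct_smul, hw, smul_eq_mul, smul_eq_mul, mul_one, ← sq, sq_le_sq,
      abs_div, abs_of_nonneg ha, abs_of_pos hρ, div_le_iff₀ hpos]
    exact ((div_lt_iff₀' hρ).1 hlt).le
  · rw [Matrix.mulVec_smul]
    ext j
    change a / (G i ⬝ᵥ w) * (G j ⬝ᵥ w) = (Pi.single i a : ι → ℝ) j
    rcases eq_or_ne j i with rfl | hj
    · rw [Pi.single_eq_same, div_mul_cancel₀ _ (abs_pos.1 hpos)]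
    · rw [hrow j hj, mul_zero, Pi.single_eq_of_ne hj]

lemma exists_unit_transpose_mulVec_lt {G : Matrix κ ι ℝ} {s : ℝ}
    (h : ∃ v, (Gᵀ *ᵥ v) ⬝ᵥ (Gᵀ *ᵥ v) < s ^ 2 * (v ⬝ᵥ v)) :
    ∃ u, u ⬝ᵥ u = 1 ∧ (Gᵀ *ᵥ u) ⬝ᵥ (Gᵀ *ᵥ u) < s ^ 2 := by
  by_contra! hunit
  obtain ⟨v, hv⟩ := h
  refine hv.not_ge (sub_nonneg.1 (nonneg_of_forall_unit
    (q := fun v => (Gᵀ *ᵥ v) ⬝ᵥ (Gᵀ *ᵥ v) - s ^ 2 * (v ⬝ᵥ v)) (fun c x => ?_) (fun u hu => ?_) v))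
  · simp only [Matrix.mulVec_smul, smul_dotProduct, dotProduct_smul, smul_eq_mul]
    ring
  · rw [hu, mul_one]
    exact sub_nonneg.2 (hunit u hu)

lemma abs_dotProduct_le_half_of_transpose_mulVec {s : ℝ} (hs : 0 < s) {G : Matrix κ ι ℝ}
    {u : κ → ℝ} {w : ι → ℝ} (hu : (Gᵀ *ᵥ u) ⬝ᵥ (Gᵀ *ᵥ u) ≤ s ^ 2)
    (hw : w ⬝ᵥ w ≤ (1 / (2 * s)) ^ 2) : |(G *ᵥ w) ⬝ᵥ u| ≤ 1 / 2 := by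
  refine abs_le_of_sq_le_sq ?_ (by norm_num)
  calc ((G *ᵥ w) ⬝ᵥ u) ^ 2 = (w ⬝ᵥ (Gᵀ *ᵥ u)) ^ 2 := by rw [mulVec_dotProduct]
    _ ≤ w ⬝ᵥ w * ((Gᵀ *ᵥ u) ⬝ᵥ (Gᵀ *ᵥ u)) := sq_dotProduct_le _ _
    _ ≤ (1 / (2 * s)) ^ 2 * s ^ 2 :=
      mul_le_mul hw hu (dotProduct_self_nonneg _) (sq_nonneg _)
    _ = (1 / 2) ^ 2 := by field_simp

end Preimages

section GaussianMatrix

variable {d : ℕ} {ε ρ : ℝ}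

lemma gaussianEntries_noShortPreimage_single_le {a : ℝ} (hε : 0 < ε) (hρ : 0 < ρ) (ha : 0 ≤ a) :
    gaussianEntries (d + 1) (d + 1) ε
        {G | (G, Pi.single 0 a) ∈ noShortPreimage (Fin (d + 1)) ρ}
      ≤ ENNReal.ofReal (a / (ρ * ε)) := by
  have hmp := (measurePreserving_piFinSuccAbove
    (fun _ : Fin (d + 1) => gaussianVec (Fin (d + 1)) (ε ^ 2).toNNReal) 0).symm
  rw [gaussianEntries_eq, ← hmp.measure_preimage_equiv, Measure.prod_apply_symm
    (hmp.measurable (measurableSet_noShortPreimage_section ρ _))]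
  -- Condition on all rows but the first, and test the first one against a unit vector `w`
  -- orthogonal to the others.
  refine (lintegral_mono (g := fun _ => ENNReal.ofReal (a / (ρ * ε))) fun R => ?_).trans
    (by simp)
  obtain ⟨w, hw, hRw⟩ := exists_unit_mulVec_eq_zero (of R) (by simp)
  rw [← div_div]
  refine le_trans (measure_mono fun x hx => ?_) (gaussianVec_abs_dotProduct_le hε
    (Real.coe_toNNReal _ (sq_nonneg ε)) hw (a / ρ))
  refine abs_dotProduct_le_of_mem_noShortPreimage hρ ha hw (fun j hj => ?_) hx
  obtain ⟨k, rfl⟩ := Fin.exists_succ_eq.2 hj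
  exact congrFun hRw k

lemma gaussianEntries_noShortPreimage_le (hε : 0 < ε) (hρ : 0 < ρ) (g : Fin (d + 1) → ℝ) :
    gaussianEntries (d + 1) (d + 1) ε {G | (G, g) ∈ noShortPreimage (Fin (d + 1)) ρ}
      ≤ ENNReal.ofReal (√(g ⬝ᵥ g) / (ρ * ε)) := by
  let e : Fin (d + 1) → ℝ := Pi.single 0 √(g ⬝ᵥ g)
  let H := householder (g - e)
  have hHg : H *ᵥ g = e := householder_sub_mulVec <| by
    rw [single_dotProduct, show e 0 = √(g ⬝ᵥ g) from Pi.single_eq_same ..,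
      Real.mul_self_sqrt (dotProduct_self_nonneg g)]
  have hHt : Hᵀ = H := householder_transpose _
  have hHH : H * H = 1 := householder_mul_self _
  have hrot : mulTransposeCLM H ⁻¹' {G | (G, e) ∈ noShortPreimage (Fin (d + 1)) ρ}
      ⊇ {G | (G, g) ∈ noShortPreimage (Fin (d + 1)) ρ} := by
    intro G hG w hw (hGw : (Hᵀ * of G) *ᵥ w = e)
    refine hG w hw ?_
    calc of G *ᵥ w = H *ᵥ ((Hᵀ * of G) *ᵥ w) := by
          rw [hHt, Matrix.mulVec_mulVec, ← Matrix.mul_assoc, hHH, Matrix.one_mul]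
      _ = g := by rw [hGw, ← hHg, Matrix.mulVec_mulVec, hHH, Matrix.one_mulVec]
  calc _ ≤ _ := measure_mono hrot
    _ = gaussianEntries (d + 1) (d + 1) ε {G | (G, e) ∈ noShortPreimage (Fin (d + 1)) ρ} := by
      rw [← Measure.map_apply (mulTransposeCLM H).continuous.measurable
        (measurableSet_noShortPreimage_section ρ e),
        map_mulTransposeCLM_gaussianEntries (by rw [hHt, hHH])]
    _ ≤ _ := gaussianEntries_noShortPreimage_single_le hε hρ (Real.sqrt_nonneg _)

lemma sqrt_le_inv_mul_add {x r : ℝ} (hx : 0 ≤ x) (hr : 0 < r) :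
    √x ≤ 1 / (2 * r) * x + r / 2 := by
  have hsq : 1 / (2 * r) * x + r / 2 - √x = (√x - r) ^ 2 / (2 * r) := by
    rw [sub_sq, Real.sq_sqrt hx]
    field_simp
    ring
  exact sub_nonneg.1 (hsq ▸ by positivity)

lemma lintegral_sqrt_dotProduct_self_le (hd : 0 < d) :
    ∫⁻ g, ENNReal.ofReal √(g ⬝ᵥ g) ∂(gaussianVec (Fin d) 1) ≤ ENNReal.ofReal √d := by
  set r := √(d : ℝ)
  have hr₀ : 0 < r := Real.sqrt_pos.2 (Nat.cast_pos.2 hd)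
  have hrr : (d : ℝ) = r * r := (Real.mul_self_sqrt d.cast_nonneg).symm
  calc ∫⁻ g, ENNReal.ofReal √(g ⬝ᵥ g) ∂(gaussianVec (Fin d) 1)
      ≤ ∫⁻ g, (ENNReal.ofReal (1 / (2 * r)) * ENNReal.ofReal (g ⬝ᵥ g) + ENNReal.ofReal (r / 2))
          ∂(gaussianVec (Fin d) 1) := by
        refine lintegral_mono fun g => ?_
        have hg := dotProduct_self_nonneg g
        rw [← ENNReal.ofReal_mul (by positivity),
          ← ENNReal.ofReal_add (by positivity) (by positivity)]
        exact ENNReal.ofReal_le_ofReal (sqrt_le_inv_mul_add hg hr₀)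
    _ = ENNReal.ofReal (1 / (2 * r)) * ENNReal.ofReal (r * r) + ENNReal.ofReal (r / 2) := by
        rw [lintegral_add_right _ measurable_const,
          lintegral_const_mul _ (by unfold dotProduct; fun_prop),
          lintegral_dotProduct_self_gaussianVec, lintegral_const, measure_univ, mul_one,
          ENNReal.coe_one, mul_one, ← hrr, ENNReal.ofReal_natCast]
    _ = ENNReal.ofReal r := by
        rw [← ENNReal.ofReal_mul (by positivity),
          ← ENNReal.ofReal_add (by positivity) (by positivity)]
        congr 1
        field_simp
        ring

lemma prod_noShortPreimage_le (hε : 0 < ε) (hρ : 0 < ρ) (hd : 0 < d) :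
    ((gaussianEntries d d ε).prod (gaussianVec (Fin d) 1)) (noShortPreimage (Fin d) ρ)
      ≤ ENNReal.ofReal (√d / (ρ * ε)) := by
  obtain ⟨k, rfl⟩ := Nat.exists_eq_succ_of_ne_zero hd.ne'
  rw [Measure.prod_apply_symm (isOpen_noShortPreimage ρ).measurableSet]
  calc _ ≤ ∫⁻ g, ENNReal.ofReal (1 / (ρ * ε)) * ENNReal.ofReal √(g ⬝ᵥ g)
          ∂(gaussianVec (Fin (k + 1)) 1) := by
        refine lintegral_mono fun g => (gaussianEntries_noShortPreimage_le hε hρ g).trans_eq ?_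
        rw [← ENNReal.ofReal_mul (by positivity), one_div_mul_eq_div]
    _ ≤ ENNReal.ofReal (1 / (ρ * ε)) * ENNReal.ofReal √((k + 1 : ℕ) : ℝ) := by
        rw [lintegral_const_mul _ (by unfold dotProduct; fun_prop)]
        gcongr
        exact lintegral_sqrt_dotProduct_self_le hd
    _ = ENNReal.ofReal (√((k + 1 : ℕ) : ℝ) / (ρ * ε)) := by
        rw [← ENNReal.ofReal_mul (by positivity), one_div_mul_eq_div]

lemma half_le_gaussianVec_half_lt_abs_dotProduct {ι : Type*} [Fintype ι] {u : ι → ℝ}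
    (hu : u ⬝ᵥ u = 1) :
    ENNReal.ofReal (1 / 2) ≤ gaussianVec ι 1 {g | 1 / 2 < |g ⬝ᵥ u|} := by
  have hmeas : MeasurableSet {g : ι → ℝ | |g ⬝ᵥ u| ≤ 1 / 2} :=
    measurableSet_le (by unfold dotProduct; fun_prop) measurable_const
  have hcompl : {g : ι → ℝ | 1 / 2 < |g ⬝ᵥ u|} = {g | |g ⬝ᵥ u| ≤ 1 / 2}ᶜ := by
    ext g
    simp only [mem_compl_iff, mem_ofPred_eq, not_le]
  rw [hcompl, prob_compl_eq_one_sub hmeas]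
  refine ENNReal.le_sub_of_add_le_right (measure_ne_top _ _) ?_
  calc ENNReal.ofReal (1 / 2) + gaussianVec ι 1 {g : ι → ℝ | |g ⬝ᵥ u| ≤ 1 / 2}
      ≤ ENNReal.ofReal (1 / 2) + ENNReal.ofReal (1 / 2 / 1) := by
        gcongr
        exact gaussianVec_abs_dotProduct_le one_pos (by simp) hu (1 / 2)
    _ = 1 := by
      rw [← ENNReal.ofReal_add (by norm_num) (by norm_num)]
      norm_num

/- If `Gᵀ` shrinks some unit vector `u` below `s`, then `|g ⬝ᵥ u| > 1 / 2` forces every solution `w`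
of `G w = g` to have norm more than `1 / (2 s)`. For a Gaussian `g` independent of `G` this happens
with probability at least `1 / 2`, whereas such solutions are typically of norm `√d / ε`. -/
theorem gaussianEntries_transpose_mulVec_lt_le (hd : 0 < d) {s : ℝ} (hε : 0 < ε) (hs : 0 < s) :
    gaussianEntries d d ε {G | ∃ v, ((of G)ᵀ *ᵥ v) ⬝ᵥ ((of G)ᵀ *ᵥ v) < s ^ 2 * (v ⬝ᵥ v)}
      ≤ ENNReal.ofReal (4 * s * √d / ε) := by
  set E := noShortPreimage (Fin d) (1 / (2 * s))
  have hE : MeasurableSet E := (isOpen_noShortPreimage _).measurableSet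
  have hlarge : {G : Fin d → Fin d → ℝ |
        ∃ v, ((of G)ᵀ *ᵥ v) ⬝ᵥ ((of G)ᵀ *ᵥ v) < s ^ 2 * (v ⬝ᵥ v)}
      ⊆ {G | ENNReal.ofReal (1 / 2) ≤ gaussianVec (Fin d) 1 (Prod.mk G ⁻¹' E)} := by
    intro G hG
    obtain ⟨u, hu, hGu⟩ := exists_unit_transpose_mulVec_lt hG
    refine (half_le_gaussianVec_half_lt_abs_dotProduct hu).trans (measure_mono ?_)
    intro g hg w hw hGw
    exact hg.not_ge (hGw ▸ abs_dotProduct_le_half_of_transpose_mulVec hs hGu.le hw)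
  calc _ ≤ _ := measure_mono hlarge
    _ ≤ _ := meas_ge_le_lintegral_div (measurable_measure_prodMk_left hE).aemeasurable (by simp)
      ENNReal.ofReal_ne_top
    _ = ((gaussianEntries d d ε).prod (gaussianVec (Fin d) 1)) E / ENNReal.ofReal (1 / 2) := by
      rw [Measure.prod_apply hE]
    _ ≤ ENNReal.ofReal (√d / (1 / (2 * s) * ε)) / ENNReal.ofReal (1 / 2) := by
      gcongr
      exact prod_noShortPreimage_le hε (by positivity) hd
    _ = ENNReal.ofReal (4 * s * √d / ε) := by
      rw [← ENNReal.ofReal_div_of_pos (by norm_num)]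
      congr 1
      field_simp
      norm_num

end GaussianMatrix

end SmallestSingularValue

section InitialScale

/-- The size `ε √(d³ σ₁) M / σ_d` of the initialization relative to the smallest singular value
`lam = σ_d`, where `r = √σ₁` and `M = m + n`. -/
def initSize (lam r ε d M : ℝ) : ℝ :=
  ε * r * (d * √d) * M / lam

/-- A bound for the Frobenius norm of the initialization that fails with probability at most
`p / 2`. -/
def initBound (p ε d M : ℝ) : ℝ :=
  ε * √(2 * M * d / p)

/-- A lower bound for the smallest singular value of the aligned part of the initialization that
fails with probability at most `p / 2`. -/
def initGap (p ε d : ℝ) : ℝ :=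
  p * ε / (12 * √d)

/-- The relations between the failure probability `p`, the extreme singular values `lam = σ_d` and
`r ^ 2 = σ₁`, the standard deviation `ε` of the initialization, the rank `d` and `M = m + n` under
which random initializations are small enough. -/
structure SmallInitScale (p lam r ε d M : ℝ) : Prop where
  p_pos : 0 < p
  p_lt_one : p < 1
  lam_pos : 0 < lam
  r_pos : 0 < r
  lam_le : lam ≤ r ^ 2
  one_le_d : 1 ≤ d
  d_le : d ≤ M
  eps_pos : 0 < ε
  initSize_mul_le : initSize lam r ε d M * (1 + Real.log (M * (r ^ 2 / lam))) ≤ p ^ 4 / 10 ^ 6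

lemma mul_neg_log_le {x y : ℝ} (hx : 0 < x) (hy : 0 ≤ y) (hxy : x ≤ y ^ 2) :
    x * -Real.log x ≤ 2 * y := by
  set w := √x
  have hw : 0 < w := Real.sqrt_pos.2 hx
  have hwx : w ^ 2 = x := Real.sq_sqrt hx.le
  calc x * -Real.log x = 2 * w ^ 2 * Real.log w⁻¹ := by
        rw [← hwx, Real.log_pow, Real.log_inv]
        push_cast
        ring
    _ ≤ 2 * w ^ 2 * w⁻¹ := by
        gcongr
        exact Real.log_le_self (inv_pos.2 hw).le
    _ = 2 * w := by field_simp
    _ ≤ 2 * y := by linarith [(Real.sqrt_le_left hy).2 hxy]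

lemma log_144_le : Real.log 144 ≤ 8 * Real.log 2 :=
  (Real.log_le_log (by norm_num) (by norm_num : (144 : ℝ) ≤ 2 ^ 8)).trans_eq
    (by rw [Real.log_pow, Nat.cast_ofNat])

namespace SmallInitScale

variable {p lam r ε d M : ℝ}

section Positivity

variable (h : SmallInitScale p lam r ε d M)
include h

lemma d_pos : 0 < d := one_pos.trans_le h.one_le_d

lemma M_pos : 0 < M := h.d_pos.trans_le h.d_le

lemma sqrt_d_pos : 0 < √d := Real.sqrt_pos.2 h.d_pos

lemma initSize_pos : 0 < initSize lam r ε d M := by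
  have := h.eps_pos
  have := h.r_pos
  have := h.d_pos
  have := h.sqrt_d_pos
  have := h.M_pos
  have := h.lam_pos
  unfold initSize
  positivity

lemma initBound_pos : 0 < initBound p ε d M := by
  have := h.p_pos
  have := h.eps_pos
  have := h.d_pos
  have := h.M_pos
  unfold initBound
  positivity

lemma initGap_pos : 0 < initGap p ε d := by
  have := h.p_pos
  have := h.eps_pos
  have := h.sqrt_d_pos
  unfold initGap
  positivity

lemma neg_log_p_nonneg : 0 ≤ -Real.log p :=
  neg_nonneg.2 (Real.log_nonpos h.p_pos.le h.p_lt_one.le)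

lemma log_d_nonneg : 0 ≤ Real.log d := Real.log_nonneg h.one_le_d

lemma log_d_le_log_M : Real.log d ≤ Real.log M := Real.log_le_log h.d_pos h.d_le

lemma log_ratio_nonneg : 0 ≤ Real.log (r ^ 2 / lam) :=
  Real.log_nonneg ((one_le_div h.lam_pos).2 h.lam_le)

lemma log_M_mul_ratio : Real.log (M * (r ^ 2 / lam)) = Real.log M + Real.log (r ^ 2 / lam) :=
  Real.log_mul h.M_pos.ne' (div_pos (pow_pos h.r_pos 2) h.lam_pos).ne'

end Positivity

section Logarithms

variable (h : SmallInitScale p lam r ε d M)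
include h

lemma initSize_le : initSize lam r ε d M ≤ p ^ 4 / 10 ^ 6 := by
  have hlog : 1 ≤ 1 + Real.log (M * (r ^ 2 / lam)) := by
    linarith [h.log_M_mul_ratio, h.log_ratio_nonneg, h.log_d_nonneg, h.log_d_le_log_M]
  exact (le_mul_of_one_le_right h.initSize_pos.le hlog).trans h.initSize_mul_le

lemma neg_log_initSize_ge :
    4 * -Real.log p + 10 * Real.log 2 ≤ -Real.log (initSize lam r ε d M) := by
  have hsize : initSize lam r ε d M ≤ p ^ 4 / 2 ^ 10 := by
    have := pow_pos h.p_pos 4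
    linarith [h.initSize_le]
  have hlog := Real.log_le_log h.initSize_pos hsize
  rw [Real.log_div (pow_pos h.p_pos 4).ne' (by norm_num), Real.log_pow, Real.log_pow] at hlog
  push_cast at hlog
  linarith

lemma log_mul_div_sq_eq :
    Real.log (d * lam / ε ^ 2) = Real.log (r ^ 2 / lam) + 4 * Real.log d + 2 * Real.log M
      + 2 * -Real.log (initSize lam r ε d M) := by
  have hlam := h.lam_pos.ne'
  have hr := h.r_pos.ne'
  have hε := h.eps_pos.ne'
  have hd := h.d_pos.ne'
  have hD := h.sqrt_d_pos.ne'
  have hM := h.M_pos.ne'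
  have hsize : Real.log (initSize lam r ε d M) = Real.log ε + Real.log r
      + (Real.log d + Real.log d / 2) + Real.log M - Real.log lam := by
    rw [initSize, Real.log_div (by positivity) hlam, Real.log_mul (by positivity) hM,
      Real.log_mul (by positivity) (by positivity), Real.log_mul hε hr, Real.log_mul hd hD,
      Real.log_sqrt h.d_pos.le]
  rw [hsize, Real.log_div (by positivity) (by positivity), Real.log_mul hd hlam,
    Real.log_div (by positivity) hlam, Real.log_pow, Real.log_pow]
  push_cast
  ring

lemma log_div_initGap_sq_eq :
    Real.log (lam / initGap p ε d ^ 2)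
      = Real.log (d * lam / ε ^ 2) + Real.log 144 + 2 * -Real.log p := by
  have hp := h.p_pos
  have hε := h.eps_pos
  have hd := h.d_pos
  have hlam := h.lam_pos
  have hgap : lam / initGap p ε d ^ 2 = d * lam / ε ^ 2 * 144 / p ^ 2 := by
    rw [initGap, div_pow, mul_pow, mul_pow, Real.sq_sqrt hd.le]
    field_simp
    norm_num
  rw [hgap, Real.log_div (by positivity) (by positivity), Real.log_mul (by positivity)
    (by norm_num), Real.log_pow]
  push_cast
  ring

lemma log_initial_loss_eq :
    Real.log (32 * (2 * d * (r ^ 2) ^ 2) / lam ^ 2)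
      = 6 * Real.log 2 + Real.log d + 2 * Real.log (r ^ 2 / lam) := by
  have hr := h.r_pos
  have hd := h.d_pos
  have hlam := h.lam_pos
  have hprod : 32 * (2 * d * (r ^ 2) ^ 2) / lam ^ 2 = 2 ^ 6 * d * (r ^ 2 / lam) ^ 2 := by
    field_simp
    norm_num
  rw [hprod, Real.log_mul (by positivity) (by positivity), Real.log_mul (by norm_num) hd.ne',
    Real.log_pow, Real.log_pow]
  push_cast
  ring

lemma log_mul_div_sq_nonneg : 0 ≤ Real.log (d * lam / ε ^ 2) := by
  have hlog2 := Real.log_nonneg one_le_two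
  linarith [h.log_mul_div_sq_eq, h.neg_log_initSize_ge, h.neg_log_p_nonneg, h.log_d_nonneg,
    h.log_d_le_log_M, h.log_ratio_nonneg]

end Logarithms

section ConvergenceTime

variable (h : SmallInitScale p lam r ε d M)
include h

lemma mul_convergenceTime_eq :
    lam * convergenceTime lam (initGap p ε d) (2 * d * (r ^ 2) ^ 2)
      = Real.log (d * lam / ε ^ 2) + Real.log 144 + 48 * Real.log 2 + 2 * -Real.log p
        + 8 * Real.log d + 16 * Real.log (r ^ 2 / lam) := by
  have hlam := h.lam_pos.ne'
  rw [convergenceTime, alignmentTime, h.log_initial_loss_eq, h.log_div_initGap_sq_eq]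
  field_simp
  ring

lemma convergenceTime_nonneg :
    0 ≤ convergenceTime lam (initGap p ε d) (2 * d * (r ^ 2) ^ 2) := by
  refine nonneg_of_mul_nonneg_right ?_ h.lam_pos
  rw [h.mul_convergenceTime_eq]
  have hlog2 : 0 ≤ Real.log 2 := Real.log_nonneg one_le_two
  have hlog144 : 0 ≤ Real.log 144 := Real.log_nonneg (by norm_num)
  linarith [h.log_mul_div_sq_nonneg, h.neg_log_p_nonneg, h.log_d_nonneg, h.log_ratio_nonneg]

lemma mul_convergenceTime_le :
    lam * convergenceTime lam (initGap p ε d) (2 * d * (r ^ 2) ^ 2)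
      ≤ 24 * Real.log (d * lam / ε ^ 2) := by
  rw [h.mul_convergenceTime_eq]
  linarith [Real.log_nonneg one_le_two, log_144_le, h.log_mul_div_sq_eq, h.neg_log_initSize_ge,
    h.neg_log_p_nonneg, h.log_d_nonneg, h.log_d_le_log_M, h.log_ratio_nonneg]

lemma initSize_mul_neg_log_p_le : initSize lam r ε d M * -Real.log p ≤ p ^ 3 / 10 ^ 6 := by
  have hp := h.p_pos
  calc initSize lam r ε d M * -Real.log p ≤ p ^ 4 / 10 ^ 6 * p⁻¹ := by
        rw [← Real.log_inv]
        exact mul_le_mul h.initSize_le (Real.log_le_self (inv_pos.2 hp).le)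
          (by simpa using h.neg_log_p_nonneg) (by positivity)
    _ = p ^ 3 / 10 ^ 6 := by field_simp

lemma initSize_mul_convergenceTime_le :
    initSize lam r ε d M
      * (lam * convergenceTime lam (initGap p ε d) (2 * d * (r ^ 2) ^ 2)) ≤ p / 10 := by
  have hp := h.p_pos
  set x := initSize lam r ε d M with hx
  have hpow : ∀ k, k ≠ 0 → p ^ k ≤ p := fun k hk => pow_le_of_le_one hp.le h.p_lt_one.le hk
  have hlog : x * -Real.log x ≤ 2 * (p ^ 2 / 10 ^ 3) :=
    mul_neg_log_le h.initSize_pos (by positivity) (h.initSize_le.trans_eq (by ring))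
  calc x * (lam * convergenceTime lam (initGap p ε d) (2 * d * (r ^ 2) ^ 2))
      ≤ x * (56 * (1 + Real.log (M * (r ^ 2 / lam))) + 2 * -Real.log x + 2 * -Real.log p) := by
        refine mul_le_mul_of_nonneg_left ?_ h.initSize_pos.le
        rw [h.mul_convergenceTime_eq, h.log_mul_div_sq_eq, ← hx, h.log_M_mul_ratio]
        linarith [log_144_le, Real.log_two_lt_d9, h.log_d_nonneg, h.log_d_le_log_M,
          h.log_ratio_nonneg]
    _ = 56 * (x * (1 + Real.log (M * (r ^ 2 / lam)))) + 2 * (x * -Real.log x)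
          + 2 * (x * -Real.log p) := by ring
    _ ≤ 56 * (p ^ 4 / 10 ^ 6) + 2 * (2 * (p ^ 2 / 10 ^ 3)) + 2 * (p ^ 3 / 10 ^ 6) := by
        gcongr
        exacts [h.initSize_mul_le, h.initSize_mul_neg_log_p_le]
    _ ≤ p / 10 := by linarith [hpow 4 four_ne_zero, hpow 3 three_ne_zero, hpow 2 two_ne_zero]

end ConvergenceTime

section Inequalities

variable (h : SmallInitScale p lam r ε d M)
include h

lemma initBound_sq : initBound p ε d M ^ 2 = 2 / p * (M * d * ε ^ 2) := by
  have := h.p_pos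
  have := h.d_pos
  have := h.M_pos
  rw [initBound, mul_pow, Real.sq_sqrt (by positivity)]
  ring

lemma initGap_le_initBound : initGap p ε d ≤ initBound p ε d M := by
  have hε := h.eps_pos
  have hsqrt : 1 ≤ √d := Real.one_le_sqrt.2 h.one_le_d
  have hone : 1 ≤ √(2 * M * d / p) := by
    refine Real.one_le_sqrt.2 ((one_le_div h.p_pos).2 ?_)
    nlinarith [h.p_lt_one, h.one_le_d, h.d_le]
  calc initGap p ε d ≤ ε := by
        rw [initGap, div_le_iff₀ (by positivity)]
        nlinarith [h.p_lt_one]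
    _ ≤ initBound p ε d M := le_mul_of_one_le_right hε.le hone

lemma mul_initBound_sq_le : 200 * (r * initBound p ε d M ^ 2) ≤ lam * initGap p ε d := by
  have hp := h.p_pos
  have hlam := h.lam_pos
  have hε := h.eps_pos
  have hD := h.sqrt_d_pos
  have hp4 : p ^ 4 ≤ p ^ 2 := pow_le_pow_of_le_one hp.le h.p_lt_one.le (by norm_num)
  have hsize : 4800 / p ^ 2 * initSize lam r ε d M ≤ 1 := by
    rw [div_mul_eq_mul_div, div_le_one (by positivity)]
    linarith [h.initSize_le, sq_nonneg p]
  calc 200 * (r * initBound p ε d M ^ 2)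
      = lam * initGap p ε d * (4800 / p ^ 2 * initSize lam r ε d M) := by
        rw [h.initBound_sq, initGap, initSize]
        field_simp
        ring
    _ ≤ lam * initGap p ε d :=
        mul_le_of_le_one_right (mul_pos hlam h.initGap_pos).le hsize

lemma mul_initBound_le : r * initBound p ε d M ≤ 2 / p * (initSize lam r ε d M * lam) := by
  have hp := h.p_pos
  have hr := h.r_pos
  have hε := h.eps_pos
  have hlam := h.lam_pos
  have hM := h.M_pos
  have hsqrt : √(2 * M * d / p) ≤ 2 * M / p := by
    refine Real.sqrt_le_iff.2 ⟨by positivity, ?_⟩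
    rw [div_pow, div_le_div_iff₀ hp (by positivity)]
    have hdp : d * p ≤ 2 * M := by nlinarith [h.p_lt_one, h.one_le_d, h.d_le]
    have := mul_le_mul_of_nonneg_left hdp (show 0 ≤ 2 * M * p by positivity)
    linarith
  calc r * initBound p ε d M ≤ r * (ε * (2 * M / p)) := by
        unfold initBound
        gcongr
    _ = 2 / p * (ε * r * M) * 1 := by ring
    _ ≤ 2 / p * (ε * r * M) * (d * √d) := by
        gcongr
        exact one_le_mul_of_one_le_of_one_le h.one_le_d (Real.one_le_sqrt.2 h.one_le_d)
    _ = 2 / p * (initSize lam r ε d M * lam) := by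
        rw [initSize]
        field_simp

lemma mul_initBound_mul_convergenceTime_le :
    r * initBound p ε d M * convergenceTime lam (initGap p ε d) (2 * d * (r ^ 2) ^ 2)
      ≤ 1 / 5 := by
  have hp := h.p_pos
  set T := convergenceTime lam (initGap p ε d) (2 * d * (r ^ 2) ^ 2)
  calc r * initBound p ε d M * T ≤ 2 / p * (initSize lam r ε d M * lam) * T :=
        mul_le_mul_of_nonneg_right h.mul_initBound_le h.convergenceTime_nonneg
    _ = 2 / p * (initSize lam r ε d M * (lam * T)) := by ring
    _ ≤ 2 / p * (p / 10) := by
        gcongr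
        exact h.initSize_mul_convergenceTime_le
    _ = 1 / 5 := by
        field_simp
        norm_num

end Inequalities

end SmallInitScale

end InitialScale

section Initialization

variable {m n d : ℕ} {Φ : Matrix (Fin m) (Fin d) ℝ} {Ψ : Matrix (Fin n) (Fin d) ℝ} {p lam r ε : ℝ}

lemma initLaw_transpose_mulVec_lt_le (hd : 0 < d) (hΦ : Φᵀ * Φ = 1) (hΨ : Ψᵀ * Ψ = 1) {s : ℝ}
    (hε : 0 < ε) (hs : 0 < s) :
    initLaw m n d ε {z | ∃ v, ((Φᵀ * of z.1 + Ψᵀ * of z.2)ᵀ *ᵥ v)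
        ⬝ᵥ ((Φᵀ * of z.1 + Ψᵀ * of z.2)ᵀ *ᵥ v) < s ^ 2 * (v ⬝ᵥ v)}
      ≤ ENNReal.ofReal (4 * s * √d / (√2 * ε)) := by
  have hsum := gaussianEntries_transpose_mulVec_lt_le hd
    (mul_pos (Real.sqrt_pos.2 two_pos) hε) hs
  rw [← map_add_initLaw hΦ hΨ ε] at hsum
  exact (Measure.le_map_apply ((mulTransposeCLM Φ).coprod
    (mulTransposeCLM (d := d) Ψ)).continuous.measurable.aemeasurable _).trans hsum

namespace SmallInitScale

lemma isSmallStart (h : SmallInitScale p lam r ε d (m + n)) (hΦ : Φᵀ * Φ = 1) (hΨ : Ψᵀ * Ψ = 1)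
    {U : Matrix (Fin m) (Fin d) ℝ} {V : Matrix (Fin n) (Fin d) ℝ}
    (hnorm : frobInner U U + frobInner V V ≤ initBound p ε d (m + n) ^ 2)
    (hgap : ∀ v, (2 * initGap p ε d) ^ 2 * (v ⬝ᵥ v)
      ≤ ((Φᵀ * U + Ψᵀ * V)ᵀ *ᵥ v) ⬝ᵥ ((Φᵀ * U + Ψᵀ * V)ᵀ *ᵥ v)) :
    IsSmallStart lam r (initBound p ε d (m + n)) (initGap p ε d) (Φᵀ * U) (Ψᵀ * V)
      (U - Φ * (Φᵀ * U)) (V - Ψ * (Ψᵀ * V)) where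
  r_pos := h.r_pos
  s_pos := h.initGap_pos
  s_le := h.initGap_le_initBound
  lam_le := h.lam_le
  mul_le := h.mul_initBound_sq_le
  norm_le := by
    rw [frobInner_self_eq_add hΦ U, frobInner_self_eq_add hΨ V] at hnorm
    linarith
  le_half_add v := by
    rw [transpose_smul, Matrix.smul_mulVec, smul_dotProduct, dotProduct_smul, smul_eq_mul,
      smul_eq_mul]
    linarith [hgap v]

theorem initLaw_not_isSmallStart_le (h : SmallInitScale p lam r ε d (m + n)) (hΦ : Φᵀ * Φ = 1)
    (hΨ : Ψᵀ * Ψ = 1) :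
    initLaw m n d ε {z | ¬ IsSmallStart lam r (initBound p ε d (m + n)) (initGap p ε d)
        (Φᵀ * of z.1) (Ψᵀ * of z.2) (of z.1 - Φ * (Φᵀ * of z.1)) (of z.2 - Ψ * (Ψᵀ * of z.2))}
      ≤ ENNReal.ofReal p := by
  have hp := h.p_pos
  have hε := h.eps_pos
  have hlarge := initLaw_norm_gt_le (m := m) (n := n) (d := d) (ε := ε) (p := p / 2)
    h.initBound_pos (by
      rw [h.initBound_sq]
      exact (by field_simp : (m + n) * d * ε ^ 2 = p / 2 * (2 / p * ((m + n) * d * ε ^ 2))).le)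
  have hsingular := (initLaw_transpose_mulVec_lt_le (Nat.cast_pos.1 h.d_pos) hΦ hΨ hε
    (mul_pos two_pos h.initGap_pos)).trans (ENNReal.ofReal_le_ofReal (q := p / 2) ?_)
  · calc _ ≤ _ := measure_mono fun z hz => ?_
      _ ≤ _ := (measure_union_le _ _).trans (add_le_add hlarge hsingular)
      _ = ENNReal.ofReal p := by
        rw [← ENNReal.ofReal_add (by positivity) (by positivity), add_halves]
    by_contra hgood
    rw [mem_union, not_or] at hgood
    exact hz (h.isSmallStart hΦ hΨ (not_lt.1 hgood.1)
      fun v => not_lt.1 fun hv => hgood.2 ⟨v, hv⟩)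
  · have hD := h.sqrt_d_pos
    have hsqrt : (4 : ℝ) / 3 ≤ √2 := Real.le_sqrt_of_sq_le (by norm_num)
    calc 4 * (2 * initGap p ε d) * √d / (√2 * ε) = 2 * p / (3 * √2) := by
          rw [initGap]
          field_simp
          norm_num
      _ ≤ p / 2 := by
          rw [div_le_iff₀ (by positivity)]
          nlinarith

end SmallInitScale

end Initialization

section TimeBounds

lemma posLog_sq_div_le {lam δ : ℝ} (hlam : 0 < lam) (hδ : 0 < δ) (h : 1 ≤ lam ∨ δ ≤ lam ^ 2) :
    Real.posLog (lam ^ 2 / δ) ≤ Real.posLog (lam / δ) + Real.log lam := by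
  have hlog : Real.log (lam ^ 2 / δ) = Real.log (lam / δ) + Real.log lam := by
    rw [← Real.log_mul (by positivity) hlam.ne']
    congr 1
    ring
  have hle : Real.log (lam ^ 2 / δ) ≤ Real.posLog (lam / δ) + Real.log lam := by
    rw [hlog]
    exact add_le_add_left (le_max_right _ _) _
  refine max_le ?_ hle
  rcases h with h | h
  · exact add_nonneg Real.posLog_nonneg (Real.log_nonneg h)
  · exact (Real.log_nonneg ((one_le_div hδ).2 h)).trans hle

/-- The time from which on the loss is at most `δ`, provided that the initialization is small and
well conditioned in the sense of `IsSmallStart`. -/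
def reachTime (p lam r ε d δ : ℝ) : ℝ :=
  convergenceTime lam (initGap p ε d) (2 * d * (r ^ 2) ^ 2)
    + 8 / lam * Real.posLog (lam ^ 2 / δ)

namespace SmallInitScale

variable {p lam r ε d M δ : ℝ} (h : SmallInitScale p lam r ε d M)
include h

lemma reachTime_nonneg : 0 ≤ reachTime p lam r ε d δ :=
  add_nonneg h.convergenceTime_nonneg
    (mul_nonneg (div_pos (by norm_num) h.lam_pos).le Real.posLog_nonneg)

lemma mul_reachTime_le : lam * reachTime p lam r ε d δ
    ≤ 24 * Real.log (d * lam / ε ^ 2) + 8 * Real.posLog (lam ^ 2 / δ) := by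
  rw [reachTime, mul_add, ← mul_assoc, mul_div_cancel₀ _ h.lam_pos.ne']
  linarith [h.mul_convergenceTime_le]

lemma reachTime_le : reachTime p lam r ε d δ ≤ 64 * (1 / lam * Real.log (d * lam / ε ^ 2)
    + 1 / lam * Real.posLog (lam ^ 2 / δ)) := by
  rw [← mul_add, mul_left_comm, one_div, le_inv_mul_iff₀ h.lam_pos]
  have hpos : 0 ≤ Real.posLog (lam ^ 2 / δ) := Real.posLog_nonneg
  linarith [h.mul_reachTime_le (δ := δ), h.log_mul_div_sq_nonneg]

lemma reachTime_le_of_one_le_or_le (hδ : 0 < δ) (hlarge : 1 ≤ lam ∨ δ ≤ lam ^ 2) :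
    reachTime p lam r ε d δ ≤ 64 * (1 / lam * Real.log (d * lam / ε)
      + 1 / lam * Real.posLog (lam / δ)) := by
  rw [← mul_add, mul_left_comm, one_div, le_inv_mul_iff₀ h.lam_pos]
  have hlog : Real.log (d * lam / ε ^ 2)
      = 2 * Real.log (d * lam / ε) - Real.log d - Real.log lam := by
    have := h.d_pos.ne'
    have := h.lam_pos.ne'
    have := h.eps_pos.ne'
    rw [Real.log_div (by positivity) (by positivity), Real.log_div (by positivity) (by positivity),
      Real.log_mul (by positivity) (by positivity), Real.log_pow]
    push_cast
    ring
  have hnonneg : 0 ≤ Real.posLog (lam ^ 2 / δ) := Real.posLog_nonneg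
  have hnonneg' : 0 ≤ Real.posLog (lam / δ) := Real.posLog_nonneg
  linarith [h.mul_reachTime_le (δ := δ), posLog_sq_div_le h.lam_pos hδ hlarge,
    h.log_mul_div_sq_nonneg, h.log_d_nonneg]

end SmallInitScale

end TimeBounds

section Conclusion

variable {m n d : ℕ} {S : Matrix (Fin m) (Fin n) ℝ} {p ε δ : ℝ}

lemma smallInitScale_of_le (hd : 0 < d) (hS : S.rank = d) (hp : 0 < p) (hp₁ : p < 1) (hε : 0 < ε)
    (hle : ε ≤ p ^ 4 / 10 ^ 6 * (sigma S d / (√((d : ℝ) ^ 3 * sigma S 1) * ((m : ℝ) + n)))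
      / (1 + Real.log (((m : ℝ) + n) * (sigma S 1 / sigma S d)))) :
    SmallInitScale p (sigma S d) √(sigma S 1) ε d (m + n) := by
  have hlam := sigma_pos hd hS
  have hσ := sigma_le_sigma_one S d
  have hσ₁ := hlam.trans_le hσ
  have hd₁ : (1 : ℝ) ≤ d := Nat.one_le_cast.2 hd
  have hdM : (d : ℝ) ≤ m + n := by
    have := hS ▸ S.rank_le_height
    exact_mod_cast this.trans (m.le_add_right n)
  refine ⟨hp, hp₁, hlam, Real.sqrt_pos.2 hσ₁, (Real.sq_sqrt hσ₁.le).symm ▸ hσ, hd₁, hdM, hε, ?_⟩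
  rw [Real.sq_sqrt hσ₁.le]
  set M : ℝ := m + n
  have hM : 0 < M := by linarith
  have hlog : 0 ≤ Real.log (M * (sigma S 1 / sigma S d)) :=
    Real.log_nonneg (one_le_mul_of_one_le_of_one_le (hd₁.trans hdM) ((one_le_div hlam).2 hσ))
  have hsqrt : √((d : ℝ) ^ 3 * sigma S 1) = d * √d * √(sigma S 1) := by
    rw [Real.sqrt_mul (by positivity), pow_succ, Real.sqrt_mul (by positivity),
      Real.sqrt_sq (by positivity)]
  rw [hsqrt, le_div_iff₀ (by positivity), ← mul_div_assoc (p ^ 4 / 10 ^ 6),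
    le_div_iff₀ (by positivity)] at hle
  rw [initSize, div_mul_eq_mul_div, div_le_iff₀ hlam]
  linarith

theorem SmallInitScale.initLaw_not_reachesBy_le
    (h : SmallInitScale p (sigma S d) √(sigma S 1) ε d (m + n)) (hS : S.rank = d) (hδ : 0 < δ) :
    initLaw m n d ε {z | ¬ ReachesBy S δ (reachTime p (sigma S d) √(sigma S 1) ε d δ)
      (of z.1) (of z.2)} ≤ ENNReal.ofReal p := by
  obtain ⟨Φ, Ψ, σ, hΦ, hΨ, hSVD, hσ⟩ := exists_thin_svd hS
  have hσ₁ := Real.sqrt_pos.1 h.r_pos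
  refine le_trans (measure_mono fun z hz => ?_) (h.initLaw_not_isSmallStart_le hΦ hΨ)
  refine mt (fun hgood => ?_) hz
  have hreach := reachesBy_of_isSmallStart hΦ hΨ (Nat.cast_pos.1 h.d_pos)
    (fun i => ⟨(hσ i).1, (hσ i).2.trans (Real.sq_sqrt hσ₁.le).ge⟩) hδ rfl
    h.mul_initBound_mul_convergenceTime_le hgood
  rwa [← hSVD] at hreach

end Conclusion

end MatrixFactorization

end

open MatrixFactorization in
theorem corollary1 :
    ∃ (C : ℝ) (q : ℕ), 0 < C ∧ ∀ p : ℝ, 0 < p → p < 1 → ∃ k : ℝ, 0 < k ∧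
      ∀ (m n d : ℕ) (S : Matrix (Fin m) (Fin n) ℝ), 0 < d → S.rank = d →
      ∀ ε : ℝ, 0 < ε →
        ε ≤ k * (sigma S d / (Real.sqrt ((d : ℝ) ^ 3 * sigma S 1) * ((m : ℝ) + n))) /
              (1 + Real.log (((m : ℝ) + n) * (sigma S 1 / sigma S d))) ^ q →
      ∀ δ : ℝ, 0 < δ →
      ∃ T : ℝ, 0 ≤ T ∧
        T ≤ C * (1 / sigma S d * Real.log (d * sigma S d / ε ^ 2)
              + 1 / sigma S d * Real.posLog (sigma S d ^ 2 / δ)) ∧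
        (1 ≤ sigma S d ∨ δ ≤ sigma S d ^ 2 →
          T ≤ C * (1 / sigma S d * Real.log (d * sigma S d / ε)
                + 1 / sigma S d * Real.posLog (sigma S d / δ))) ∧
        initLaw m n d ε {z | ¬ ReachesBy S δ T (Matrix.of z.1) (Matrix.of z.2)}
          ≤ ENNReal.ofReal p := by
  refine ⟨64, 1, by norm_num, fun p hp hp₁ => ⟨p ^ 4 / 10 ^ 6, by positivity, ?_⟩⟩
  intro m n d S hd hS ε hε hle δ hδ
  rw [pow_one] at hle
  have h := smallInitScale_of_le hd hS hp hp₁ hε hle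
  exact ⟨reachTime p (sigma S d) √(sigma S 1) ε d δ, h.reachTime_nonneg, h.reachTime_le,
    h.reachTime_le_of_one_le_or_le hδ, h.initLaw_not_reachesBy_le hS hδ⟩
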